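/- **Definitions.** A *locos* is a lextensive category (finite limits, and finite coproducts that are disjoint and stable under pullback) with parametrised list objects: for each object $A$ there are an object $L$ and maps $\mathrm{nil} : 1 \to L$, $\mathrm{cons} : A \times L \to L$ such that for all $b : X \to Y$ and $g : A \times Y \to Y$ there is a unique $r : X \times L \to Y$ with $r(x,\mathrm{nil}) = b(x)$ and $r(x,\mathrm{cons}(a,l)) = g(a, r(x,l))$. A *regular locos* is a locos that is also a regular category. An *arithmetic universe* (AU, or list-arithmetic pretopos) is a locos that is exact, i.e. in which every equivalence relation has an effective, pullback-stable quotient. $\mathrm{LOCOS}$ is the $2$-category of locoses, functors preserving finite limits, finite coproducts and list objects, and natural transformations; $\mathrm{REGLOC}$ is that of regular locoses, those functors of this kind that moreover preserve regular epimorphisms, and natural transformations; $\mathrm{AU}$ is that of arithmetic universes, functors preserving finite limits, finite coproducts, quotients of equivalence relations and list objects, and natural transformations. The *ex/lex completion* $\mathcal{E}_{\mathrm{ex/lex}}$ of a category $\mathcal{E}$ with finite limits has as objects the pseudo-equivalence relations in $\mathcal{E}$, i.e. the pairs $p_1,p_2 : R \rightrightarrows A$ (not necessarily jointly monic) satisfying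 reflexivity, symmetry and transitivity. Maps from $R \rightrightarrows A$ to $S \rightrightarrows B$ are maps $f : A \to B$ for which there is $g : R \to S$ with $p_i g = f p_i$ for $i = 1,2$, modulo identifying $f$ and $f'$ whenever there is $h : A \to S$ with $p_1 h = f$ and $p_2 h = f'$. The *ex/reg completion* $\mathcal{E}_{\mathrm{ex/reg}}$ of a regular category $\mathcal{E}$ has as objects the equivalence relations $R \rightarrowtail A \times A$ in $\mathcal{E}$. Maps from $R \rightarrowtail A \times A$ to $S \rightarrowtail B \times B$ are functional relations, i.e. subobjects of $A \times B$ that are invariant under $R$ and $S$, total, and single-valued up to $S$; they are composed as relations. There are canonical functors $\mathcal{E} \to \mathcal{E}_{\mathrm{ex/lex}}$ and $\mathcal{E} \to \mathcal{E}_{\mathrm{ex/reg}}$ sending $A$ to the trivial equivalence relation on $A$, and sending a map to its class, respectively to its graph. **Theorem.** 1. If $\mathcal{E}$ is a locos, then $\mathcal{E}_{\mathrm{ex/lex}}$ is an arithmetic universe. 2. If $\mathcal{E}$ is a regular locos, then $\mathcal{E}_{\mathrm{ex/reg}}$ is an arithmetic universe. 3. The assignment $\mathcal{E} \mapsto \mathcal{E}_{\mathrm{ex/lex}}$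 on locally small locoses underlies a pseudofunctor that is left biadjoint to the forgetful $2$-functor $\mathrm{AU} \to \mathrm{LOCOS}$, with unit the canonical functors $\mathcal{E} \to \mathcal{E}_{\mathrm{ex/lex}}$. 4. The assignment $\mathcal{E} \mapsto \mathcal{E}_{\mathrm{ex/reg}}$ on regular locoses that are small (relative to an arbitrary universe) underlies a pseudofunctor that is left biadjoint to the forgetful $2$-functor $\mathrm{AU} \to \mathrm{REGLOC}$, with unit the canonical functors $\mathcal{E} \to \mathcal{E}_{\mathrm{ex/reg}}$. Here $L$ is left biadjoint to $U$ if there is a pseudonatural transformation $\eta : \mathrm{id} \to UL$ such that, for all $X$ and $Y$, the functor $\mathrm{Hom}(LX, Y) \to \mathrm{Hom}(X, UY)$, $g \mapsto U(g) \circ \eta_X$, is an equivalence of categories. -/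

import Mathlib

open CategoryTheory CategoryTheory.Limits CategoryTheory.Bicategory

universe v u

namespace AriUniv

/-! ### Locoses and arithmetic universes -/

section Lists

variable {C : Type u} [Category.{v} C] [HasFiniteProducts C]

/-- `L`, with `nil : T ⟶ L` and `cons : P ⟶ L`, is a parametrised list object on `A`. Here `T` is
any terminal object and `P`, with projections `fst` and `snd`, is any product of `A` and `L`, so
that one may think of `nil : 1 ⟶ L` and `cons : A ⨯ L ⟶ L`. For each object `X` of parameters, each
`b : X ⟶ Y` and each `g : A ⨯ Y ⟶ Y`, there is a unique `r : X ⨯ L ⟶ Y` such that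
`r (x, nil) = b x` and `r (x, cons (a, l)) = g (a, r (x, l))`. -/
structure IsParamListObject {A L T P : C} (nil : T ⟶ L) (fst : P ⟶ A) (snd : P ⟶ L)
    (cons : P ⟶ L) : Prop where
  isTerminal : Nonempty (IsTerminal T)
  isProduct : Nonempty (IsLimit (BinaryFan.mk fst snd))
  existsUnique_rec : ∀ {X Y : C} (b : X ⟶ Y) (g : A ⨯ Y ⟶ Y), ∃! r : X ⨯ L ⟶ Y,
    (∀ t : X ⟶ T, prod.lift (𝟙 X) (t ≫ nil) ≫ r = b) ∧
      prod.map (𝟙 X) cons ≫ r =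
        prod.lift (prod.snd ≫ fst) (prod.map (𝟙 X) snd ≫ r) ≫ g

end Lists

/-- A locos: a lextensive category (finite limits, and finite coproducts which are disjoint and
stable under pullback) with parametrised list objects. -/
class IsLocos (C : Type u) [Category.{v} C] : Prop extends
    HasFiniteLimits C, FinitaryExtensive C where
  exists_list : ∀ A : C, ∃ (L : C) (nil : ⊤_ C ⟶ L) (cons : A ⨯ L ⟶ L),
    IsParamListObject nil prod.fst prod.snd cons

/-- A regular locos: a locos which is moreover a regular category. -/
class IsRegularLocos (C : Type u) [Category.{v} C] : Prop extends IsLocos C, Regular C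

/-- An exact category: it has finite limits, and every equivalence relation has a quotient which is
effective and stable under pullback. -/
class IsExact (C : Type u) [Category.{v} C] : Prop extends HasFiniteLimits C where
  universallyEffective : ∀ {R A : C} (p₁ p₂ : R ⟶ A), IsEquivalenceRelation p₁ p₂ →
    IsUniversallyEffectiveEquivalenceRelation p₁ p₂

/-- An arithmetic universe (list-arithmetic pretopos): a locos which is moreover exact. -/
class IsArithmeticUniverse (C : Type u) [Category.{v} C] : Prop extends IsLocos C, IsExact C

/-- Exact categories are regular. -/
theorem IsExact.regular (C : Type u) [Category.{v} C] [IsExact C] : Regular C := by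
  have key : ∀ {X Y Z : C} {f : X ⟶ Y} {g₁ g₂ : Z ⟶ X}, IsKernelPair f g₁ g₂ →
      Nonempty (UniversallyEffectiveEquivalenceRelation g₁ g₂) := fun {X Y Z f g₁ g₂} h ↦
    (IsExact.universallyEffective g₁ g₂ (IsKernelPair.equivalenceRelation f g₁ g₂
      (pullbackIsPullback g₂ g₁) h).isEquivalenceRelation).1
  refine { hasCoequalizer_of_isKernelPair := ?_, regularEpiIsStableUnderBaseChange := ⟨?_⟩ }
  · intro X Y Z f g₁ g₂ h
    obtain ⟨e⟩ := key h
    exact ⟨⟨_, e.toEffectiveEquivalenceRelation.isCoequalizer⟩⟩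
  · intro X Y Y' S f g f' g' sq hg
    have hg' : IsRegularEpi g := hg
    obtain ⟨e⟩ := key (IsKernelPair.of_hasPullback g)
    let i : e.B ≅ S := e.toEffectiveEquivalenceRelation.isCoequalizer.coconePointUniqueUpToIso
      (isColimitCoforkOfEffectiveEpi g _ (pullback.isLimit g g))
    have hi : e.π ≫ i.hom = g :=
      e.toEffectiveEquivalenceRelation.isCoequalizer.comp_coconePointUniqueUpToIso_hom
        (isColimitCoforkOfEffectiveEpi g _ (pullback.isLimit g g)) WalkingParallelPair.one
    have sq' : IsPullback g' f' (f ≫ i.inv) e.π :=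
      sq.flip.of_iso (Iso.refl _) (Iso.refl _) (Iso.refl _) i.symm (by simp) (by simp) (by simp)
        (by simp [← hi])
    have : EffectiveEpi g' := e.universally_effectiveEpi_π _ _ _ sq'
    exact isRegularEpi_of_EffectiveEpi g'

instance (C : Type u) [Category.{v} C] [IsArithmeticUniverse C] : IsRegularLocos C where
  __ := (inferInstance : IsLocos C)
  __ := IsExact.regular C

/-- `F` preserves parametrised list objects: it takes each of them to one. -/
def PreservesListObjects {C D : Type*} [Category* C] [Category* D] [HasFiniteProducts C]
    [HasFiniteProducts D] (F : C ⥤ D) : Prop :=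
  ∀ {A L T P : C} (nil : T ⟶ L) (fst : P ⟶ A) (snd : P ⟶ L) (cons : P ⟶ L),
    IsParamListObject nil fst snd cons →
      IsParamListObject (F.map nil) (F.map fst) (F.map snd) (F.map cons)

/-- A locos functor: a functor which preserves finite limits, finite coproducts and list objects. -/
structure IsLocosFunctor {C D : Type*} [Category* C] [Category* D] [IsLocos C] [IsLocos D]
    (F : C ⥤ D) : Prop where
  preservesFiniteLimits : PreservesFiniteLimits F
  preservesFiniteCoproducts : PreservesFiniteCoproducts F
  preservesListObjects : PreservesListObjects F

/-- A regular locos functor: a locos functor which is moreover regular. -/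
structure IsRegularLocosFunctor {C D : Type*} [Category* C] [Category* D] [IsLocos C] [IsLocos D]
    (F : C ⥤ D) : Prop extends IsLocosFunctor F where
  map_isRegularEpi : ∀ {X Y : C} (f : X ⟶ Y), IsRegularEpi f → IsRegularEpi (F.map f)

/-- A functor of arithmetic universes: a pretopos functor (i.e. one which preserves finite limits,
finite coproducts and quotients of equivalence relations) which preserves list objects. -/
structure IsAUFunctor {C D : Type*} [Category* C] [Category* D] [IsArithmeticUniverse C]
    [IsArithmeticUniverse D] (F : C ⥤ D) : Prop extends IsLocosFunctor F where
  isColimit_map : ∀ {R A B : C} (p₁ p₂ : R ⟶ A) (π : A ⟶ B) (w : p₁ ≫ π = p₂ ≫ π),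
    IsEquivalenceRelation p₁ p₂ → Nonempty (IsColimit (Cofork.ofπ π w)) →
      Nonempty (IsColimit (Cofork.ofπ (F.map π)
        (by rw [← F.map_comp, w, F.map_comp] : F.map p₁ ≫ F.map π = F.map p₂ ≫ F.map π)))

theorem IsLocosFunctor.id (C : Type*) [Category* C] [IsLocos C] : IsLocosFunctor (𝟭 C) where
  preservesFiniteLimits := inferInstance
  preservesFiniteCoproducts := inferInstance
  preservesListObjects _ _ _ _ h := h

theorem IsLocosFunctor.comp {C D E : Type*} [Category* C] [Category* D] [Category* E] [IsLocos C]
    [IsLocos D] [IsLocos E] {F : C ⥤ D} {G : D ⥤ E} (hF : IsLocosFunctor F)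
    (hG : IsLocosFunctor G) : IsLocosFunctor (F ⋙ G) where
  preservesFiniteLimits :=
    have := hF.preservesFiniteLimits
    have := hG.preservesFiniteLimits
    comp_preservesFiniteLimits F G
  preservesFiniteCoproducts :=
    have := hF.preservesFiniteCoproducts
    have := hG.preservesFiniteCoproducts
    ⟨fun _ ↦ inferInstance⟩
  preservesListObjects _ _ _ _ h := hG.preservesListObjects _ _ _ _
    (hF.preservesListObjects _ _ _ _ h)

theorem IsAUFunctor.id (C : Type*) [Category* C] [IsArithmeticUniverse C] :
    IsAUFunctor (𝟭 C) where
  __ := IsLocosFunctor.id C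
  isColimit_map _ _ _ _ _ h := h

theorem IsAUFunctor.comp {C D E : Type*} [Category* C] [Category* D] [Category* E]
    [IsArithmeticUniverse C] [IsArithmeticUniverse D] [IsArithmeticUniverse E] {F : C ⥤ D}
    {G : D ⥤ E} (hF : IsAUFunctor F) (hG : IsAUFunctor G) : IsAUFunctor (F ⋙ G) where
  __ := hF.toIsLocosFunctor.comp hG.toIsLocosFunctor
  isColimit_map p₁ p₂ π w hp h := by
    have := hF.preservesFiniteLimits
    obtain ⟨⟨e⟩⟩ := IsExact.universallyEffective p₁ p₂ hp
    exact hG.isColimit_map _ _ _ _ (IsKernelPair.equivalenceRelation (F.map e.π) _ _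
      (pullbackIsPullback _ _) (e.isKernelPair.map F)).isEquivalenceRelation
      (hF.isColimit_map p₁ p₂ π w hp h)

theorem IsAUFunctor.isRegularLocosFunctor {C D : Type*} [Category* C] [Category* D]
    [IsArithmeticUniverse C] [IsArithmeticUniverse D] {F : C ⥤ D} (hF : IsAUFunctor F) :
    IsRegularLocosFunctor F where
  __ := hF.toIsLocosFunctor
  map_isRegularEpi f hf := by
    obtain ⟨h⟩ := hF.isColimit_map (pullback.fst f f) (pullback.snd f f) f pullback.condition
      (IsKernelPair.equivalenceRelation f _ _ (pullbackIsPullback _ _)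
        (IsKernelPair.of_hasPullback f)).isEquivalenceRelation
      ⟨isColimitCoforkOfEffectiveEpi f _ (pullback.isLimit f f)⟩
    exact ⟨⟨⟨_, _, _, _, h⟩⟩⟩

/-! ### The 2-categories of locoses, regular locoses and arithmetic universes -/

/-- Given categories `c i`, and a class `P i j` of functors `c i ⥤ c j` which contains identities
and is closed under composition, the 2-category whose objects are the indices `i`, whose
1-morphisms are the functors in the given class, and whose 2-morphisms are all natural
transformations. -/
@[reducible]
def bicategoryOfFunctors {ι : Type*} (c : ι → Type u) [∀ i, Category.{v} (c i)]
    (P : ∀ i j, ObjectProperty (c i ⥤ c j)) (hid : ∀ i, P i i (𝟭 (c i)))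
    (hcomp : ∀ {i j k} {F : c i ⥤ c j} {G : c j ⥤ c k}, P i j F → P j k G → P i k (F ⋙ G)) :
    Bicategory ι where
  Hom i j := (P i j).FullSubcategory
  id i := ⟨𝟭 (c i), hid i⟩
  comp F G := ⟨F.obj ⋙ G.obj, hcomp F.property G.property⟩
  homCategory i j := inferInstanceAs (Category (P i j).FullSubcategory)
  whiskerLeft F _ _ η := ObjectProperty.homMk (Functor.whiskerLeft F.obj η.hom)
  whiskerRight η H := ObjectProperty.homMk (Functor.whiskerRight η.hom H.obj)
  associator F G H := ObjectProperty.isoMk _ (Functor.associator F.obj G.obj H.obj)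
  leftUnitor F := ObjectProperty.isoMk _ (Functor.leftUnitor F.obj)
  rightUnitor F := ObjectProperty.isoMk _ (Functor.rightUnitor F.obj)

set_option linter.checkUnivs false in
/-- Locoses. -/
structure LOCOS : Type (max (u + 1) (v + 1)) where
  carrier : Type u
  [category : Category.{v} carrier]
  [isLocos : IsLocos carrier]

set_option linter.checkUnivs false in
/-- Regular locoses. -/
structure REGLOC : Type (max (u + 1) (v + 1)) where
  carrier : Type u
  [category : Category.{v} carrier]
  [isRegularLocos : IsRegularLocos carrier]

set_option linter.checkUnivs false in
/-- Arithmetic universes. -/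
structure AU : Type (max (u + 1) (v + 1)) where
  carrier : Type u
  [category : Category.{v} carrier]
  [isArithmeticUniverse : IsArithmeticUniverse carrier]

attribute [instance] LOCOS.category LOCOS.isLocos REGLOC.category REGLOC.isRegularLocos
  AU.category AU.isArithmeticUniverse

/-- The 2-category of locoses, locos functors and natural transformations. -/
instance : Bicategory LOCOS.{v, u} :=
  bicategoryOfFunctors LOCOS.carrier (fun _ _ F ↦ IsLocosFunctor F) (fun _ ↦ IsLocosFunctor.id _)
    (fun hF hG ↦ hF.comp hG)

/-- The 2-category of regular locoses, regular locos functors and natural transformations. -/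
instance : Bicategory REGLOC.{v, u} :=
  bicategoryOfFunctors REGLOC.carrier (fun _ _ F ↦ IsRegularLocosFunctor F)
    (fun _ ↦ { IsLocosFunctor.id _ with map_isRegularEpi := fun _ h ↦ h })
    (fun hF hG ↦ { hF.toIsLocosFunctor.comp hG.toIsLocosFunctor with
      map_isRegularEpi := fun _ h ↦ hG.map_isRegularEpi _ (hF.map_isRegularEpi _ h) })

/-- The 2-category of arithmetic universes, AU functors and natural transformations. -/
instance : Bicategory AU.{v, u} :=
  bicategoryOfFunctors AU.carrier (fun _ _ F ↦ IsAUFunctor F)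
    (fun _ ↦ IsAUFunctor.id _) (fun hF hG ↦ hF.comp hG)

/-- The forgetful 2-functor from arithmetic universes to locoses. -/
def AU.forgetToLOCOS : AU.{v, u} ⥤ᵖ LOCOS.{v, u} where
  obj E := ⟨E.carrier⟩
  map F := ⟨F.obj, F.property.toIsLocosFunctor⟩
  map₂ η := ObjectProperty.homMk η.hom
  mapId _ := Iso.refl _
  mapComp _ _ := Iso.refl _
  map₂_whisker_left _ _ _ _ := ObjectProperty.hom_ext _ (NatTrans.ext (funext fun _ ↦
    (by simp : ∀ {C : Type u} [Category.{v} C] {X Y : C} (f : X ⟶ Y), f = 𝟙 _ ≫ f ≫ 𝟙 _) _))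
  map₂_whisker_right _ _ := ObjectProperty.hom_ext _ (NatTrans.ext (funext fun _ ↦
    (by simp : ∀ {C : Type u} [Category.{v} C] {X Y : C} (f : X ⟶ Y), f = 𝟙 _ ≫ f ≫ 𝟙 _) _))
  map₂_associator _ _ H := ObjectProperty.hom_ext _ (NatTrans.ext (funext fun X ↦ by
    change 𝟙 _ = 𝟙 _ ≫ H.obj.map (𝟙 _) ≫ 𝟙 _ ≫ 𝟙 _ ≫ 𝟙 _
    simp))
  map₂_left_unitor F := ObjectProperty.hom_ext _ (NatTrans.ext (funext fun X ↦ by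
    change 𝟙 _ = 𝟙 _ ≫ F.obj.map (𝟙 _) ≫ 𝟙 _
    simp))
  map₂_right_unitor F := ObjectProperty.hom_ext _ (NatTrans.ext (funext fun X ↦ by
    change 𝟙 _ = 𝟙 _ ≫ 𝟙 _ ≫ 𝟙 _
    simp))

/-- The forgetful 2-functor from arithmetic universes to regular locoses. -/
def AU.forgetToREGLOC : AU.{v, u} ⥤ᵖ REGLOC.{v, u} where
  obj E := ⟨E.carrier⟩
  map F := ⟨F.obj, F.property.isRegularLocosFunctor⟩
  map₂ η := ObjectProperty.homMk η.hom
  mapId _ := Iso.refl _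
  mapComp _ _ := Iso.refl _
  map₂_whisker_left _ _ _ _ := ObjectProperty.hom_ext _ (NatTrans.ext (funext fun _ ↦
    (by simp : ∀ {C : Type u} [Category.{v} C] {X Y : C} (f : X ⟶ Y), f = 𝟙 _ ≫ f ≫ 𝟙 _) _))
  map₂_whisker_right _ _ := ObjectProperty.hom_ext _ (NatTrans.ext (funext fun _ ↦
    (by simp : ∀ {C : Type u} [Category.{v} C] {X Y : C} (f : X ⟶ Y), f = 𝟙 _ ≫ f ≫ 𝟙 _) _))
  map₂_associator _ _ H := ObjectProperty.hom_ext _ (NatTrans.ext (funext fun X ↦ by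
    change 𝟙 _ = 𝟙 _ ≫ H.obj.map (𝟙 _) ≫ 𝟙 _ ≫ 𝟙 _ ≫ 𝟙 _
    simp))
  map₂_left_unitor F := ObjectProperty.hom_ext _ (NatTrans.ext (funext fun X ↦ by
    change 𝟙 _ = 𝟙 _ ≫ F.obj.map (𝟙 _) ≫ 𝟙 _
    simp))
  map₂_right_unitor F := ObjectProperty.hom_ext _ (NatTrans.ext (funext fun X ↦ by
    change 𝟙 _ = 𝟙 _ ≫ 𝟙 _ ≫ 𝟙 _
    simp))

/-! ### Biadjunctions -/

section Biadjunctions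

universe w₁ w₂ v₁ v₂ u₁ u₂

variable {B : Type u₁} [Bicategory.{w₁, v₁} B] {C : Type u₂} [Bicategory.{w₂, v₂} C]

/-- For `η : X ⟶ U X'`, the functor `Hom(X', Y) ⥤ Hom(X, U Y)` which takes `g` to `η ≫ U g`. -/
def transpose (U : C ⥤ᵖ B) {X : B} {X' : C} (η : X ⟶ U.obj X') (Y : C) :
    (X' ⟶ Y) ⥤ (X ⟶ U.obj Y) where
  obj g := η ≫ U.map g
  map α := η ◁ U.map₂ α

/-- A biadjunction, with `L` left biadjoint to `U`: a pseudonatural transformation from the identity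
to `U ∘ L` such that the functors `Hom(L X, Y) ⥤ Hom(X, U Y)` which it induces (and which are
pseudonatural in `X` and `Y`) are equivalences of categories. -/
structure Biadjunction (L : B ⥤ᵖ C) (U : C ⥤ᵖ B) where
  unit : (Pseudofunctor.id B).StrongTrans (L.comp U)
  isEquivalence (X : B) (Y : C) :
    (transpose U (X := X) (X' := L.obj X) (unit.app X) Y).IsEquivalence

end Biadjunctions

/-! ### The ex/lex completion -/

/-- A pseudo-equivalence relation on an object `A`: maps `p₁, p₂ : R ⟶ A`, not necessarily jointly
monic, satisfying reflexivity, symmetry and transitivity. Transitivity is expressed by generalised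
elements; see `transitive_iff_exists_pullback`. -/
structure PseudoEquivRel (C : Type u) [Category.{v} C] where
  A : C
  R : C
  p₁ : R ⟶ A
  p₂ : R ⟶ A
  reflexive : ∃ r : A ⟶ R, r ≫ p₁ = 𝟙 A ∧ r ≫ p₂ = 𝟙 A
  symmetric : ∃ s : R ⟶ R, s ≫ p₁ = p₂ ∧ s ≫ p₂ = p₁
  transitive : ∀ {T : C} (x y : T ⟶ R), x ≫ p₂ = y ≫ p₁ →
    ∃ z : T ⟶ R, z ≫ p₁ = x ≫ p₁ ∧ z ≫ p₂ = y ≫ p₂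

/-- When pullbacks exist, transitivity amounts to a single map from `R ×_A R` to `R`. -/
theorem transitive_iff_exists_pullback {C : Type u} [Category.{v} C] [HasPullbacks C] {A R : C}
    (p₁ p₂ : R ⟶ A) :
    (∀ {T : C} (x y : T ⟶ R), x ≫ p₂ = y ≫ p₁ →
      ∃ z : T ⟶ R, z ≫ p₁ = x ≫ p₁ ∧ z ≫ p₂ = y ≫ p₂) ↔
    ∃ t : pullback p₂ p₁ ⟶ R, t ≫ p₁ = pullback.fst p₂ p₁ ≫ p₁ ∧
      t ≫ p₂ = pullback.snd p₂ p₁ ≫ p₂ := by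
  refine ⟨fun h ↦ h _ _ pullback.condition, fun ⟨t, h₁, h₂⟩ T x y h ↦
    ⟨pullback.lift x y h ≫ t, by simp [h₁, pullback.lift_fst_assoc],
      by simp [h₂, pullback.lift_snd_assoc]⟩⟩

namespace PseudoEquivRel

variable {C : Type u} [Category.{v} C]

/-- The generalised elements `x` and `y` of `X.A` are related by `X.R`. -/
def Rel (X : PseudoEquivRel C) {T : C} (x y : T ⟶ X.A) : Prop :=
  ∃ r : T ⟶ X.R, r ≫ X.p₁ = x ∧ r ≫ X.p₂ = y

theorem Rel.refl (X : PseudoEquivRel C) {T : C} (x : T ⟶ X.A) : X.Rel x x := by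
  obtain ⟨r, h₁, h₂⟩ := X.reflexive
  exact ⟨x ≫ r, by simp [h₁], by simp [h₂]⟩

theorem Rel.symm {X : PseudoEquivRel C} {T : C} {x y : T ⟶ X.A} (h : X.Rel x y) : X.Rel y x := by
  obtain ⟨s, h₁, h₂⟩ := X.symmetric
  obtain ⟨r, rfl, rfl⟩ := h
  exact ⟨r ≫ s, by simp [h₁], by simp [h₂]⟩

theorem Rel.trans {X : PseudoEquivRel C} {T : C} {x y z : T ⟶ X.A} (h : X.Rel x y)
    (h' : X.Rel y z) : X.Rel x z := by
  obtain ⟨r, rfl, rfl⟩ := h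
  obtain ⟨r', hr, rfl⟩ := h'
  exact X.transitive r r' hr.symm

theorem Rel.precomp {X : PseudoEquivRel C} {T T' : C} {x y : T ⟶ X.A} (h : X.Rel x y)
    (e : T' ⟶ T) : X.Rel (e ≫ x) (e ≫ y) := by
  obtain ⟨r, rfl, rfl⟩ := h
  exact ⟨e ≫ r, by simp, by simp⟩

/-- The trivial equivalence relation on `A`. -/
@[simps]
def discrete (A : C) : PseudoEquivRel C where
  A := A
  R := A
  p₁ := 𝟙 A
  p₂ := 𝟙 A
  reflexive := ⟨𝟙 A, by simp⟩
  symmetric := ⟨𝟙 A, by simp⟩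
  transitive x y h := ⟨x, by simpa using h⟩

theorem rel_discrete_iff {A T : C} (x y : T ⟶ A) : (discrete A).Rel x y ↔ x = y := by
  constructor
  · rintro ⟨r, rfl, rfl⟩
    rfl
  · rintro rfl
    exact .refl (discrete A) x

end PseudoEquivRel

/-- The ex/lex completion of `C` has the pseudo-equivalence relations in `C` as its objects. -/
structure ExLex (C : Type u) [Category.{v} C] where
  rel : PseudoEquivRel C

namespace ExLex

variable {C : Type u} [Category.{v} C]

/-- The maps `f : A ⟶ B` which respect the given pseudo-equivalence relations on `A` and `B`, i.e.
such that there is `g : R ⟶ S` with `g ≫ p₁ = p₁ ≫ f` and `g ≫ p₂ = p₂ ≫ f`. -/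
def PreHom (X Y : ExLex C) : Type v :=
  {f : X.rel.A ⟶ Y.rel.A // Y.rel.Rel (X.rel.p₁ ≫ f) (X.rel.p₂ ≫ f)}

/-- Two such maps `f` and `f'` are identified if there is `h : A ⟶ S` with `h ≫ p₁ = f` and
`h ≫ p₂ = f'`. -/
instance homSetoid (X Y : ExLex C) : Setoid (PreHom X Y) where
  r f f' := Y.rel.Rel f.1 f'.1
  iseqv := ⟨fun f ↦ .refl _ f.1, .symm, .trans⟩

theorem PreHom.map_rel {X Y : ExLex C} (f : PreHom X Y) {T : C} {x y : T ⟶ X.rel.A}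
    (h : X.rel.Rel x y) : Y.rel.Rel (x ≫ f.1) (y ≫ f.1) := by
  obtain ⟨r, rfl, rfl⟩ := h
  simpa using f.2.precomp r

instance : Category.{v} (ExLex C) where
  Hom X Y := Quotient (homSetoid X Y)
  id X := Quotient.mk _ ⟨𝟙 _, X.rel.reflexive.elim fun _ _ ↦ ⟨𝟙 _, by simp, by simp⟩⟩
  comp := Quotient.map₂ (fun f g ↦ ⟨f.1 ≫ g.1, by simpa using g.map_rel f.2⟩)
    (fun f f' hf g g' hg ↦ (g.map_rel hf).trans (PseudoEquivRel.Rel.precomp hg f'.1))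
  id_comp f := by
    induction f using Quotient.inductionOn
    exact congrArg (Quotient.mk _) (Subtype.ext (Category.id_comp _))
  comp_id f := by
    induction f using Quotient.inductionOn
    exact congrArg (Quotient.mk _) (Subtype.ext (Category.comp_id _))
  assoc f g h := by
    induction f using Quotient.inductionOn
    induction g using Quotient.inductionOn
    induction h using Quotient.inductionOn
    exact congrArg (Quotient.mk _) (Subtype.ext (Category.assoc _ _ _))

/-- The canonical functor from `C` to its ex/lex completion. -/
def embedding (C : Type u) [Category.{v} C] : C ⥤ ExLex C where
  obj A := ⟨.discrete A⟩
  map f := Quotient.mk _ ⟨f, .refl (.discrete _) (𝟙 _ ≫ f)⟩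
  map_id _ := rfl
  map_comp _ _ := rfl

end ExLex

/-! ### The ex/reg completion -/

/-- The ex/reg completion of a regular category `C` has the equivalence relations in `C`, i.e. the
jointly monic pseudo-equivalence relations, as its objects. -/
structure ExReg (C : Type u) [Category.{v} C] where
  rel : PseudoEquivRel C
  jointlyMono : JointlyMono₂ rel.p₁ rel.p₂

namespace ExReg

variable {C : Type u} [Category.{v} C] [Regular C]

attribute [local simp] prod.lift_fst prod.lift_snd prod.lift_fst_assoc prod.lift_snd_assoc
  pullback.lift_fst pullback.lift_snd pullback.lift_fst_assoc pullback.lift_snd_assoc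

/-- The generalised element `(x, y)` of `A ⨯ B` belongs to the subobject `F`. -/
def Holds {A B : C} (F : Subobject (A ⨯ B)) {T : C} (x : T ⟶ A) (y : T ⟶ B) : Prop :=
  F.Factors (prod.lift x y)

theorem Holds.precomp {A B : C} {F : Subobject (A ⨯ B)} {T T' : C} {x : T ⟶ A} {y : T ⟶ B}
    (h : Holds F x y) (e : T' ⟶ T) : Holds F (e ≫ x) (e ≫ y) := by
  have := F.factors_of_factors_right e h
  rwa [prod.comp_lift] at this

theorem holds_mk_iff {A B M T : C} (m : M ⟶ A ⨯ B) [Mono m] (x : T ⟶ A) (y : T ⟶ B) :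
    Holds (Subobject.mk m) x y ↔
      ∃ t : T ⟶ M, t ≫ m ≫ prod.fst = x ∧ t ≫ m ≫ prod.snd = y := by
  rw [Holds, Subobject.mk_factors_iff]
  constructor
  · rintro ⟨t, ht⟩
    let t' : T ⟶ M := t
    have ht : t' ≫ m = prod.lift x y := ht
    exact ⟨t', by simp [reassoc_of% ht], by simp [reassoc_of% ht]⟩
  · rintro ⟨t, rfl, rfl⟩
    exact ⟨t, by change t ≫ m = _; ext <;> simp⟩

theorem holds_arrow {A B : C} (F : Subobject (A ⨯ B)) :
    Holds F (F.arrow ≫ prod.fst) (F.arrow ≫ prod.snd) := by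
  have h : prod.lift (F.arrow ≫ prod.fst) (F.arrow ≫ prod.snd) = F.arrow := by ext <;> simp
  rw [Holds, h]
  exact F.factors_self

theorem le_of_holds {A B : C} {F G : Subobject (A ⨯ B)}
    (h : ∀ {T : C} (x : T ⟶ A) (y : T ⟶ B), Holds F x y → Holds G x y) : F ≤ G := by
  refine Subobject.le_of_factors ?_
  have h' : prod.lift (F.arrow ≫ prod.fst) (F.arrow ≫ prod.snd) = F.arrow := by ext <;> simp
  have := h _ _ (holds_arrow F)
  rwa [Holds, h'] at this

/-- Membership in a subobject is a local property. -/
theorem Holds.of_cover {A B : C} {F : Subobject (A ⨯ B)} {T T' : C} {x : T ⟶ A} {y : T ⟶ B}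
    (e : T' ⟶ T) [StrongEpi e] (h : Holds F (e ≫ x) (e ≫ y)) : Holds F x y := by
  have h' : F.Factors (e ≫ prod.lift x y) := by rwa [prod.comp_lift]
  have sq : CommSq (F.factorThru _ h') e F.arrow (prod.lift x y) := ⟨by simp⟩
  rw [Holds, ← sq.fac_right]
  exact Subobject.factors_comp_arrow _

/-- The image of a span `A ← M → B`, as a subobject of `A ⨯ B`. -/
noncomputable def image {A B M : C} (a : M ⟶ A) (b : M ⟶ B) : Subobject (A ⨯ B) :=
  Subobject.mk (Regular.strongEpiMonoFactorisation (prod.lift a b)).m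

theorem holds_image_iff {A B M T : C} (a : M ⟶ A) (b : M ⟶ B) (x : T ⟶ A) (y : T ⟶ B) :
    Holds (image a b) x y ↔ ∃ (T' : C) (e : T' ⟶ T) (_ : StrongEpi e) (m : T' ⟶ M),
      m ≫ a = e ≫ x ∧ m ≫ b = e ≫ y := by
  let F := Regular.strongEpiMonoFactorisation (prod.lift a b)
  have hF : F.e ≫ F.m = prod.lift a b := F.fac
  constructor
  · intro h
    obtain ⟨t, rfl, rfl⟩ := (holds_mk_iff F.m x y).1 h
    have : IsRegularEpi (pullback.fst t F.e) := inferInstance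
    refine ⟨pullback t F.e, pullback.fst _ _, inferInstance, pullback.snd _ _, ?_, ?_⟩
    · rw [pullback.condition_assoc, reassoc_of% hF, prod.lift_fst]
    · rw [pullback.condition_assoc, reassoc_of% hF, prod.lift_snd]
  · rintro ⟨T', e, _, m, h₁, h₂⟩
    refine Holds.of_cover e ((holds_mk_iff F.m _ _).2 ⟨m ≫ F.e, ?_, ?_⟩)
    · rw [Category.assoc, reassoc_of% hF, prod.lift_fst, h₁]
    · rw [Category.assoc, reassoc_of% hF, prod.lift_snd, h₂]

/-- The composite of the relations `F` and `G`: the image in `A ⨯ B'` of the pullback of `F` and `G`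
over `B`. -/
noncomputable def compRel {A B B' : C} (F : Subobject (A ⨯ B)) (G : Subobject (B ⨯ B')) :
    Subobject (A ⨯ B') :=
  image (pullback.fst (F.arrow ≫ prod.snd) (G.arrow ≫ prod.fst) ≫ F.arrow ≫ prod.fst)
    (pullback.snd (F.arrow ≫ prod.snd) (G.arrow ≫ prod.fst) ≫ G.arrow ≫ prod.snd)

theorem holds_compRel_iff {A B B' T : C} (F : Subobject (A ⨯ B)) (G : Subobject (B ⨯ B'))
    (x : T ⟶ A) (z : T ⟶ B') :
    Holds (compRel F G) x z ↔ ∃ (T' : C) (e : T' ⟶ T) (_ : StrongEpi e) (y : T' ⟶ B),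
      Holds F (e ≫ x) y ∧ Holds G y (e ≫ z) := by
  rw [compRel, holds_image_iff]
  constructor
  · rintro ⟨T', e, he, m, h₁, h₂⟩
    refine ⟨T', e, he, m ≫ pullback.fst _ _ ≫ F.arrow ≫ prod.snd, ?_, ?_⟩
    · rw [← h₁]
      simpa using (holds_arrow F).precomp (m ≫ pullback.fst _ _)
    · rw [← h₂, pullback.condition]
      simpa using (holds_arrow G).precomp (m ≫ pullback.snd _ _)
  · rintro ⟨T', e, he, y, h₁, h₂⟩
    have k₁ : F.factorThru _ h₁ ≫ F.arrow = prod.lift (e ≫ x) y := F.factorThru_arrow _ h₁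
    have k₂ : G.factorThru _ h₂ ≫ G.arrow = prod.lift y (e ≫ z) := G.factorThru_arrow _ h₂
    refine ⟨T', e, he, pullback.lift (F.factorThru _ h₁) (G.factorThru _ h₂)
      (by simp [reassoc_of% k₁, reassoc_of% k₂]), ?_, ?_⟩ <;>
      simp [reassoc_of% k₁, reassoc_of% k₂]

theorem total_iff {A B : C} (F : Subobject (A ⨯ B)) :
    IsRegularEpi (F.arrow ≫ prod.fst) ↔ ∀ {T : C} (x : T ⟶ A),
      ∃ (T' : C) (e : T' ⟶ T) (_ : StrongEpi e) (y : T' ⟶ B), Holds F (e ≫ x) y := by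
  constructor
  · intro h T x
    have : IsRegularEpi (pullback.fst x (F.arrow ≫ prod.fst)) := inferInstance
    refine ⟨pullback x (F.arrow ≫ prod.fst), pullback.fst _ _, inferInstance,
      pullback.snd _ _ ≫ F.arrow ≫ prod.snd, ?_⟩
    rw [pullback.condition]
    exact (holds_arrow F).precomp _
  · intro h
    obtain ⟨T', e, he, y, hy⟩ := h (𝟙 A)
    have h' : F.factorThru _ hy ≫ F.arrow ≫ prod.fst = e := by simp
    rw [← h'] at he
    have := strongEpi_of_strongEpi (F.factorThru _ hy) (F.arrow ≫ prod.fst)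
    infer_instance

/-- The maps in the ex/reg completion from `R ↣ A ⨯ A` to `S ↣ B ⨯ B`: functional relations, that
is, subobjects of `A ⨯ B` which are invariant under `R` and `S`, total, and single-valued up to
`S`. -/
@[ext]
structure FunRel (X Y : ExReg C) where
  graph : Subobject (X.rel.A ⨯ Y.rel.A)
  invariant : ∀ {T : C} {x x' : T ⟶ X.rel.A} {y y' : T ⟶ Y.rel.A}, X.rel.Rel x x' →
    Y.rel.Rel y y' → Holds graph x y → Holds graph x' y'
  total : IsRegularEpi (graph.arrow ≫ prod.fst)
  singleValued : ∀ {T : C} {x : T ⟶ X.rel.A} {y y' : T ⟶ Y.rel.A}, Holds graph x y →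
    Holds graph x y' → Y.rel.Rel y y'

theorem FunRel.ext_holds {X Y : ExReg C} {F G : FunRel X Y} (h : ∀ {T : C} (x : T ⟶ X.rel.A)
    (y : T ⟶ Y.rel.A), Holds F.graph x y ↔ Holds G.graph x y) : F = G :=
  FunRel.ext (le_antisymm (le_of_holds fun x y ↦ (h x y).1) (le_of_holds fun x y ↦ (h x y).2))

theorem mono_lift (X : ExReg C) : Mono (prod.lift X.rel.p₁ X.rel.p₂) where
  right_cancellation f g h := X.jointlyMono.right_cancellation f g
    (by simpa using congrArg (· ≫ prod.fst) h) (by simpa using congrArg (· ≫ prod.snd) h)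

/-- The equivalence relation on `X`, as a subobject of `X.rel.A ⨯ X.rel.A`. -/
noncomputable def subobject (X : ExReg C) : Subobject (X.rel.A ⨯ X.rel.A) :=
  have := mono_lift X
  Subobject.mk (prod.lift X.rel.p₁ X.rel.p₂)

theorem holds_subobject_iff (X : ExReg C) {T : C} (x y : T ⟶ X.rel.A) :
    Holds X.subobject x y ↔ X.rel.Rel x y := by
  have := mono_lift X
  simp [subobject, holds_mk_iff, PseudoEquivRel.Rel]

/-- The equivalence relation on an object of the ex/reg completion is a local property. -/
theorem rel_of_cover (X : ExReg C) {T T' : C} {x y : T ⟶ X.rel.A} (e : T' ⟶ T) [StrongEpi e]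
    (h : X.rel.Rel (e ≫ x) (e ≫ y)) : X.rel.Rel x y := by
  rw [← holds_subobject_iff] at h ⊢
  exact h.of_cover e

/-- The identity on `R ↣ A ⨯ A` is the relation `R` itself. -/
noncomputable def FunRel.id (X : ExReg C) : FunRel X X where
  graph := X.subobject
  invariant hx hy h := by
    rw [holds_subobject_iff] at h ⊢
    exact (hx.symm.trans h).trans hy
  total := (total_iff _).2 fun x ↦ ⟨_, 𝟙 _, inferInstance, x, by
    rw [holds_subobject_iff, Category.id_comp]
    exact .refl _ x⟩
  singleValued h h' := by
    rw [holds_subobject_iff] at h h'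
    exact h.symm.trans h'

/-- Functional relations are composed as relations. -/
noncomputable def FunRel.comp {X Y Z : ExReg C} (F : FunRel X Y) (G : FunRel Y Z) :
    FunRel X Z where
  graph := compRel F.graph G.graph
  invariant hx hz h := by
    rw [holds_compRel_iff] at h ⊢
    obtain ⟨T', e, he, y, h₁, h₂⟩ := h
    exact ⟨T', e, he, y, F.invariant (hx.precomp e) (.refl _ y) h₁,
      G.invariant (.refl _ y) (hz.precomp e) h₂⟩
  total := (total_iff _).2 fun x ↦ by
    obtain ⟨T', e, he, y, hy⟩ := (total_iff _).1 F.total x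
    obtain ⟨T'', e', he', z, hz⟩ := (total_iff _).1 G.total y
    refine ⟨T'', e' ≫ e, inferInstance, z,
      (holds_compRel_iff _ _ _ _).2 ⟨T'', 𝟙 _, inferInstance, e' ≫ y, ?_, ?_⟩⟩
    · simpa using hy.precomp e'
    · simpa using hz
  singleValued h h' := by
    rw [holds_compRel_iff] at h h'
    obtain ⟨T₁, e₁, he₁, y₁, h₁, k₁⟩ := h
    obtain ⟨T₂, e₂, he₂, y₂, h₂, k₂⟩ := h'
    have i₁ : IsRegularEpi (pullback.fst e₁ e₂) := inferInstance
    have i₂ : StrongEpi (pullback.fst e₁ e₂ ≫ e₁) := inferInstance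
    refine rel_of_cover Z (pullback.fst e₁ e₂ ≫ e₁) ?_
    have hy := F.singleValued (by simpa using h₁.precomp (pullback.fst e₁ e₂))
      (by simpa [pullback.condition_assoc] using h₂.precomp (pullback.snd e₁ e₂))
    refine G.singleValued (by simpa using k₁.precomp (pullback.fst e₁ e₂)) ?_
    refine G.invariant hy.symm (.refl _ _) ?_
    simpa [pullback.condition_assoc] using k₂.precomp (pullback.snd e₁ e₂)

noncomputable instance : Category.{max u v} (ExReg C) where
  Hom X Y := FunRel X Y
  id X := FunRel.id X
  comp F G := FunRel.comp F G
  id_comp {X Y} F := FunRel.ext_holds fun x y ↦ by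
    refine (holds_compRel_iff _ _ _ _).trans ⟨?_, fun h ↦ ?_⟩
    · rintro ⟨T', e, he, x', h₁, h₂⟩
      exact .of_cover e (F.invariant ((holds_subobject_iff X _ _).1 h₁).symm (.refl _ _) h₂)
    · exact ⟨_, 𝟙 _, inferInstance, x, (holds_subobject_iff X _ _).2 (by simpa using .refl _ x),
        by simpa using h⟩
  comp_id {X Y} F := FunRel.ext_holds fun x y ↦ by
    refine (holds_compRel_iff _ _ _ _).trans ⟨?_, fun h ↦ ?_⟩
    · rintro ⟨T', e, he, y', h₁, h₂⟩
      exact .of_cover e (F.invariant (.refl _ _) ((holds_subobject_iff Y _ _).1 h₂) h₁)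
    · exact ⟨_, 𝟙 _, inferInstance, y, by simpa using h,
        (holds_subobject_iff Y _ _).2 (by simpa using .refl _ y)⟩
  assoc F G H := FunRel.ext_holds fun x w ↦ by
    refine (holds_compRel_iff _ _ _ _).trans (Iff.trans ?_ (holds_compRel_iff _ _ _ _).symm)
    constructor
    · rintro ⟨T₁, e₁, he₁, z, h₁, h₂⟩
      obtain ⟨T₂, e₂, he₂, y, h₃, h₄⟩ := (holds_compRel_iff _ _ _ _).1 h₁
      refine ⟨T₂, e₂ ≫ e₁, inferInstance, y, by simpa using h₃,
        (holds_compRel_iff _ _ _ _).2 ⟨T₂, 𝟙 _, inferInstance, e₂ ≫ z, by simpa using h₄, ?_⟩⟩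
      simpa using h₂.precomp e₂
    · rintro ⟨T₁, e₁, he₁, y, h₁, h₂⟩
      obtain ⟨T₂, e₂, he₂, z, h₃, h₄⟩ := (holds_compRel_iff _ _ _ _).1 h₂
      refine ⟨T₂, e₂ ≫ e₁, inferInstance, z,
        (holds_compRel_iff _ _ _ _).2 ⟨T₂, 𝟙 _, inferInstance, e₂ ≫ y, ?_, by simpa using h₃⟩,
        by simpa using h₄⟩
      simpa using h₁.precomp e₂

/-- The graph of a map `f : A ⟶ B`, as a functional relation between the trivial equivalence
relations on `A` and on `B`. -/
noncomputable def graphOf {A B : C} (f : A ⟶ B) : Subobject (A ⨯ B) :=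
  Subobject.mk (prod.lift (𝟙 A) f)

theorem holds_graphOf_iff {A B T : C} (f : A ⟶ B) (x : T ⟶ A) (y : T ⟶ B) :
    Holds (graphOf f) x y ↔ x ≫ f = y := by
  simp [graphOf, holds_mk_iff]

theorem holds_compRel_graphOf_iff {A B B' T : C} (f : A ⟶ B) (g : B ⟶ B') (x : T ⟶ A)
    (y : T ⟶ B') : Holds (compRel (graphOf f) (graphOf g)) x y ↔ x ≫ f ≫ g = y := by
  simp only [holds_compRel_iff, holds_graphOf_iff]
  constructor
  · rintro ⟨T', e, he, z, h₁, h₂⟩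
    rw [← cancel_epi e, ← h₂, ← h₁]
    simp
  · rintro rfl
    exact ⟨_, 𝟙 _, inferInstance, x ≫ f, by simp, by simp⟩

theorem holds_graphOf_id_iff {A T : C} (x y : T ⟶ A) : Holds (graphOf (𝟙 A)) x y ↔ x = y := by
  simp [holds_graphOf_iff]

/-- The canonical functor from a regular category `C` to its ex/reg completion, which takes `A` to
the trivial equivalence relation on `A`, and a map to its graph. -/
noncomputable def embedding (C : Type u) [Category.{v} C] [Regular C] : C ⥤ ExReg C where
  obj A := ⟨.discrete A, ⟨fun _ f g h _ ↦ (cancel_mono (𝟙 A)).1 h⟩⟩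
  map f :=
    { graph := graphOf f
      invariant := fun hx hy h ↦ by
        obtain rfl := (PseudoEquivRel.rel_discrete_iff _ _).1 hx
        obtain rfl := (PseudoEquivRel.rel_discrete_iff _ _).1 hy
        exact h
      total := (total_iff _).2 fun x ↦ ⟨_, 𝟙 _, inferInstance, (𝟙 _ ≫ x) ≫ f,
        (holds_graphOf_iff _ _ _).2 rfl⟩
      singleValued := fun h h' ↦ (PseudoEquivRel.rel_discrete_iff _ _).2
        (((holds_graphOf_iff _ _ _).1 h).symm.trans ((holds_graphOf_iff _ _ _).1 h')) }
  map_id A := FunRel.ext_holds fun x y ↦ (holds_graphOf_id_iff x y).trans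
    ((PseudoEquivRel.rel_discrete_iff x y).symm.trans (holds_subobject_iff _ x y).symm)
  map_comp f g := FunRel.ext_holds fun x y ↦ (holds_graphOf_iff (f ≫ g) x y).trans
    (holds_compRel_graphOf_iff f g x y).symm

end ExReg

end AriUniv

/-! Both completions are treated as instances of one notion, `IsExactCompletion J I`. Here `I : C ⥤
D` is fully faithful, every object of `D` is a quotient of some `I.obj A` by a pseudo-equivalence
relation in `C`, and surjectivity is tested on generalised elements `I.obj T ⟶ X` up to a class `J`
of covers in `C`. For ex/lex the covers are the split epimorphisms, so local existence is plain
existence; for ex/reg they are the strong epimorphisms. An exact category is its own completion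
relative to strong epimorphisms. Elements of `X` lift locally to `C`, and maps out of `X` descend
along locally surjective maps. Finite limits, effective quotients and extensive coproducts in `D`
follow by reasoning with elements. The key point is that equality in `D` of maps out of `I.obj V` is
a representable predicate on `V` (`isRepr_eq`), so that it can be proved in `C` by case distinction
on sums and by induction over lists.

Lists are the substance. In `C`, induction over lists is recursion into the object that represents
the predicate; a well-founded form follows from truncated subtraction of lists. The functor `I`
preserves list objects (`isUniversal_map`): recursion data in `D` lift to `C` only over covers, so
no recursion in `C` computes the answer, but the object of valid traces of the recursion exists in
`C`, covers `X ⨯ I.obj L` locally, and has a value that is well defined in `Y`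
(`trace_singleValued`). The list object on a quotient of `A` by `R` is then the quotient of the
lists on `A` by the lists on `R` (`transitive_list`, `ListAlg.IsUniversal.of_quotient`).

For the universal property, a left exact `F : C ⥤ E` that takes covers to regular epimorphisms, with
`E` exact, is extended by sending the quotient of `A` by `R` to the quotient of `F.obj A` by the
image of `R`. Equality in such a quotient is witnessed locally by a stage in `C`
(`exists_of_comp_val_eq`), which makes the extension left exact. It preserves coproducts because
they are pulled back from `1 ⨿ 1`, and list objects because they are the quotients just described.
Natural transformations extend uniquely because covers become regular epimorphisms.
`UniversalFunctors` turns these extension properties formally into a pseudofunctor and a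
biadjunction. -/

namespace AriUniv

attribute [local simp] prod.lift_fst prod.lift_snd prod.lift_fst_assoc prod.lift_snd_assoc
  prod.comp_lift prod.comp_lift_assoc coprod.inl_desc coprod.inr_desc coprod.inl_desc_assoc
  coprod.inr_desc_assoc

/-! ### Binary products and coproducts -/

section

variable {C : Type u} [Category.{v} C]

/-- The map into a binary product with given components. -/
def fanLift {A B P T : C} {fst : P ⟶ A} {snd : P ⟶ B} (h : IsLimit (BinaryFan.mk fst snd))
    (a : T ⟶ A) (b : T ⟶ B) : T ⟶ P :=
  BinaryFan.IsLimit.lift h a b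

@[simp]
theorem fanLift_fst {A B P T : C} {fst : P ⟶ A} {snd : P ⟶ B}
    (h : IsLimit (BinaryFan.mk fst snd)) (a : T ⟶ A) (b : T ⟶ B) : fanLift h a b ≫ fst = a :=
  BinaryFan.IsLimit.lift_fst h a b

@[simp]
theorem fanLift_fst_assoc {A B P T Z : C} {fst : P ⟶ A} {snd : P ⟶ B}
    (h : IsLimit (BinaryFan.mk fst snd)) (a : T ⟶ A) (b : T ⟶ B) (f : A ⟶ Z) :
    fanLift h a b ≫ fst ≫ f = a ≫ f := by
  rw [← Category.assoc, fanLift_fst]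

@[simp]
theorem fanLift_snd {A B P T : C} {fst : P ⟶ A} {snd : P ⟶ B}
    (h : IsLimit (BinaryFan.mk fst snd)) (a : T ⟶ A) (b : T ⟶ B) : fanLift h a b ≫ snd = b :=
  BinaryFan.IsLimit.lift_snd h a b

@[simp]
theorem fanLift_snd_assoc {A B P T Z : C} {fst : P ⟶ A} {snd : P ⟶ B}
    (h : IsLimit (BinaryFan.mk fst snd)) (a : T ⟶ A) (b : T ⟶ B) (f : B ⟶ Z) :
    fanLift h a b ≫ snd ≫ f = b ≫ f := by
  rw [← Category.assoc, fanLift_snd]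

theorem fan_hom_ext {A B P T : C} {fst : P ⟶ A} {snd : P ⟶ B}
    (h : IsLimit (BinaryFan.mk fst snd)) {x y : T ⟶ P} (h₁ : x ≫ fst = y ≫ fst)
    (h₂ : x ≫ snd = y ≫ snd) : x = y :=
  BinaryFan.IsLimit.hom_ext h h₁ h₂

/-- The maps `i₁` and `i₂` are the injections of a binary coproduct. -/
def IsSum {A B S : C} (i₁ : A ⟶ S) (i₂ : B ⟶ S) : Prop :=
  Nonempty (IsColimit (BinaryCofan.mk i₁ i₂))

theorem IsSum.exists_desc {A B S Z : C} {i₁ : A ⟶ S} {i₂ : B ⟶ S} (h : IsSum i₁ i₂) (f : A ⟶ Z)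
    (g : B ⟶ Z) : ∃ d : S ⟶ Z, i₁ ≫ d = f ∧ i₂ ≫ d = g :=
  ⟨h.some.desc (BinaryCofan.mk f g), h.some.fac (BinaryCofan.mk f g) ⟨.left⟩,
    h.some.fac (BinaryCofan.mk f g) ⟨.right⟩⟩

theorem IsSum.hom_ext {A B S Z : C} {i₁ : A ⟶ S} {i₂ : B ⟶ S} (h : IsSum i₁ i₂) {x y : S ⟶ Z}
    (h₁ : i₁ ≫ x = i₁ ≫ y) (h₂ : i₂ ≫ x = i₂ ≫ y) : x = y :=
  BinaryCofan.IsColimit.hom_ext h.some h₁ h₂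

theorem IsSum.mk' {A B S : C} {i₁ : A ⟶ S} {i₂ : B ⟶ S}
    (h : ∀ {Z : C} (f : A ⟶ Z) (g : B ⟶ Z), ∃ d : S ⟶ Z, i₁ ≫ d = f ∧ i₂ ≫ d = g)
    (h' : ∀ {Z : C} {x y : S ⟶ Z}, i₁ ≫ x = i₁ ≫ y → i₂ ≫ x = i₂ ≫ y → x = y) :
    IsSum i₁ i₂ := by
  choose d h₁ h₂ using @h
  exact ⟨BinaryCofan.isColimitMk (fun s ↦ d s.inl s.inr) (fun s ↦ h₁ _ _) (fun s ↦ h₂ _ _)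
    fun s m k₁ k₂ ↦ h' (k₁.trans (h₁ _ _).symm) (k₂.trans (h₂ _ _).symm)⟩

theorem isSum_coprod [HasBinaryCoproducts C] (A B : C) :
    IsSum (coprod.inl : A ⟶ A ⨿ B) coprod.inr :=
  ⟨coprodIsCoprod A B⟩

end

/-! ### List algebras in terms of generalised elements -/

section ListAlgebras

variable {C : Type u} [Category.{v} C]

/-- An algebra for list operations with entries in `A`, in terms of generalised elements. -/
structure ListAlg (A L : C) where
  nil : ∀ T : C, T ⟶ L
  cons : ∀ {T : C}, (T ⟶ A) → (T ⟶ L) → (T ⟶ L)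
  comp_nil : ∀ {T T' : C} (f : T' ⟶ T), f ≫ nil T = nil T'
  comp_cons : ∀ {T T' : C} (f : T' ⟶ T) (a : T ⟶ A) (l : T ⟶ L),
    f ≫ cons a l = cons (f ≫ a) (f ≫ l)

namespace ListAlg

attribute [simp] comp_nil comp_cons

@[simp]
theorem comp_cons_assoc {A L : C} (S : ListAlg A L) {T T' Z : C} (f : T' ⟶ T) (a : T ⟶ A)
    (l : T ⟶ L) (h : L ⟶ Z) : f ≫ S.cons a l ≫ h = S.cons (f ≫ a) (f ≫ l) ≫ h := by
  rw [← Category.assoc, comp_cons]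

/-- The list algebra given by maps out of a terminal object and out of a product. -/
def ofMaps {A L T P : C} {nil : T ⟶ L} {fst : P ⟶ A} {snd : P ⟶ L} {cons : P ⟶ L}
    (hT : IsTerminal T) (hP : IsLimit (BinaryFan.mk fst snd)) : ListAlg A L where
  nil S := hT.from S ≫ nil
  cons a l := fanLift hP a l ≫ cons
  comp_nil f := by rw [← Category.assoc, hT.comp_from]
  comp_cons f a l := by
    rw [← Category.assoc]
    congr 1
    apply fan_hom_ext hP <;> simp

/-- The pair `(f, φ)` is a homomorphism of list algebras. -/
structure IsHom {A L A' L' : C} (S : ListAlg A L) (S' : ListAlg A' L') (f : A ⟶ A')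
    (φ : L ⟶ L') : Prop where
  nil : ∀ T : C, S.nil T ≫ φ = S'.nil T
  cons : ∀ {T : C} (a : T ⟶ A) (l : T ⟶ L), S.cons a l ≫ φ = S'.cons (a ≫ f) (l ≫ φ)

theorem IsHom.comp {A L A' L' A'' L'' : C} {S : ListAlg A L} {S' : ListAlg A' L'}
    {S'' : ListAlg A'' L''} {f : A ⟶ A'} {φ : L ⟶ L'} {f' : A' ⟶ A''} {φ' : L' ⟶ L''}
    (h : IsHom S S' f φ) (h' : IsHom S' S'' f' φ') : IsHom S S'' (f ≫ f') (φ ≫ φ') where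
  nil T := by rw [← Category.assoc, h.nil, h'.nil]
  cons a l := by rw [← Category.assoc, h.cons, h'.cons, Category.assoc, Category.assoc]

theorem IsHom.id {A L : C} (S : ListAlg A L) : IsHom S S (𝟙 A) (𝟙 L) where
  nil T := by simp
  cons a l := by simp

variable [HasFiniteProducts C]

/-- `r` is defined by recursion from `b` and `g`. -/
structure IsRec {A L X Y : C} (S : ListAlg A L) (b : X ⟶ Y) (g : A ⨯ Y ⟶ Y) (r : X ⨯ L ⟶ Y) :
    Prop where
  nil : ∀ {T : C} (x : T ⟶ X), prod.lift x (S.nil T) ≫ r = x ≫ b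
  cons : ∀ {T : C} (x : T ⟶ X) (a : T ⟶ A) (l : T ⟶ L),
    prod.lift x (S.cons a l) ≫ r = prod.lift a (prod.lift x l ≫ r) ≫ g

/-- Maps can be defined uniquely by parametrised recursion over `L`. -/
def IsUniversal {A L : C} (S : ListAlg A L) : Prop :=
  ∀ {X Y : C} (b : X ⟶ Y) (g : A ⨯ Y ⟶ Y), ∃! r : X ⨯ L ⟶ Y, S.IsRec b g r

/-- The equations for all generalised elements are restrictions of those at the generic ones, namely
`𝟙 X` for `nil` and the two projections of `X ⨯ P` for `cons`. -/
theorem isRec_ofMaps_iff {A L T P : C} {nil : T ⟶ L} {fst : P ⟶ A} {snd : P ⟶ L} {cons : P ⟶ L}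
    (hT : IsTerminal T) (hP : IsLimit (BinaryFan.mk fst snd)) {X Y : C} (b : X ⟶ Y)
    (g : A ⨯ Y ⟶ Y) (r : X ⨯ L ⟶ Y) :
    (ofMaps (nil := nil) (cons := cons) hT hP).IsRec b g r ↔
      (∀ t : X ⟶ T, prod.lift (𝟙 X) (t ≫ nil) ≫ r = b) ∧
      prod.map (𝟙 X) cons ≫ r =
        prod.lift (prod.snd ≫ fst) (prod.map (𝟙 X) snd ≫ r) ≫ g := by
  constructor
  · intro h
    refine ⟨fun t ↦ ?_, ?_⟩
    · have := h.nil (𝟙 X)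
      obtain rfl := hT.hom_ext t (hT.from X)
      rwa [Category.id_comp] at this
    · have := h.cons (T := X ⨯ P) prod.fst (prod.snd ≫ fst) (prod.snd ≫ snd)
      have hl : fanLift hP (prod.snd ≫ fst : X ⨯ P ⟶ _) (prod.snd ≫ snd) = prod.snd := by
        apply fan_hom_ext hP <;> simp
      dsimp only [ofMaps] at this
      rw [hl] at this
      have e₁ : prod.map (𝟙 X) cons = prod.lift prod.fst (prod.snd ≫ cons) := by
        ext <;> simp
      have e₂ : prod.map (𝟙 X) snd = prod.lift prod.fst (prod.snd ≫ snd) := by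
        ext <;> simp
      rw [e₁, e₂]
      exact this
  · rintro ⟨h₁, h₂⟩
    refine ⟨fun {S} x ↦ ?_, fun {S} x a l ↦ ?_⟩
    · rw [← h₁ (hT.from X)]
      simp [ofMaps, ← Category.assoc]
    · have := congrArg (prod.lift x (fanLift hP a l) ≫ ·) h₂
      simp only [prod.lift_map_assoc, Category.comp_id, prod.comp_lift_assoc, prod.lift_snd_assoc,
        fanLift_fst, fanLift_snd] at this
      exact this

/-- Later arguments use only `ListAlg.IsUniversal`, where the particular `T` and `P` no longer
appear; this is the bridge to the definition of list objects. -/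
theorem _root_.AriUniv.isParamListObject_iff {A L T P : C} (nil : T ⟶ L) (fst : P ⟶ A)
    (snd : P ⟶ L) (cons : P ⟶ L) : IsParamListObject nil fst snd cons ↔
      ∃ (hT : IsTerminal T) (hP : IsLimit (BinaryFan.mk fst snd)),
        (ofMaps (nil := nil) (cons := cons) hT hP).IsUniversal := by
  constructor
  · rintro ⟨⟨hT⟩, ⟨hP⟩, h⟩
    refine ⟨hT, hP, fun {X Y} b g ↦ ?_⟩
    simpa only [isRec_ofMaps_iff] using h b g
  · rintro ⟨hT, hP, h⟩
    exact ⟨⟨hT⟩, ⟨hP⟩, fun {X Y} b g ↦ by simpa only [isRec_ofMaps_iff] using h b g⟩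

theorem IsUniversal.hom_ext {A L X Y : C} {S : ListAlg A L} (hS : S.IsUniversal) {b : X ⟶ Y}
    {g : A ⨯ Y ⟶ Y} {r r' : X ⨯ L ⟶ Y} (h : S.IsRec b g r) (h' : S.IsRec b g r') : r = r' :=
  (hS b g).unique h h'

theorem IsUniversal.exists_rec {A L X Y : C} {S : ListAlg A L} (hS : S.IsUniversal) (b : X ⟶ Y)
    (g : A ⨯ Y ⟶ Y) : ∃ r : X ⨯ L ⟶ Y, S.IsRec b g r :=
  (hS b g).exists

/-- A homomorphism of list algebras, as a map defined by recursion. -/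
theorem IsHom.isRec {A L A' L' X : C} {S : ListAlg A L} {S' : ListAlg A' L'} {f : A ⟶ A'}
    {φ : L ⟶ L'} (h : IsHom S S' f φ) :
    S.IsRec (S'.nil X) (S'.cons (prod.fst ≫ f) prod.snd) (prod.snd ≫ φ) where
  nil x := by simp [h.nil]
  cons x a l := by simp [h.cons]

/-- Homomorphisms are recursions whose parameters range over the terminal object, so uniqueness of
recursion applies. -/
theorem IsUniversal.isHom_ext {A L A' L' : C} {S : ListAlg A L} (hS : S.IsUniversal)
    {S' : ListAlg A' L'} {f : A ⟶ A'} {φ φ' : L ⟶ L'} (h : IsHom S S' f φ)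
    (h' : IsHom S S' f φ') : φ = φ' := by
  have := hS.hom_ext (h.isRec (X := ⊤_ C)) h'.isRec
  have := congrArg (prod.lift (terminal.from L) (𝟙 L) ≫ ·) this
  simpa using this

theorem IsUniversal.exists_isHom {A L A' L' : C} {S : ListAlg A L} (hS : S.IsUniversal)
    (S' : ListAlg A' L') (f : A ⟶ A') : ∃ φ : L ⟶ L', IsHom S S' f φ := by
  obtain ⟨r, hr⟩ := hS.exists_rec (S'.nil (⊤_ C)) (S'.cons (prod.fst ≫ f) prod.snd)
  refine ⟨prod.lift (terminal.from L) (𝟙 L) ≫ r, ⟨fun T ↦ ?_, fun {T} a l ↦ ?_⟩⟩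
  · have := hr.nil (terminal.from T)
    simpa using this
  · have := hr.cons (terminal.from T) a l
    simpa using this

/-- Being universal is invariant under isomorphism. -/
theorem IsUniversal.of_iso {A L L' : C} {S : ListAlg A L} (hS : S.IsUniversal)
    {S' : ListAlg A L'} (i : L ≅ L') (h : IsHom S S' (𝟙 A) i.hom) : S'.IsUniversal := by
  have hn (T : C) : S'.nil T ≫ i.inv = S.nil T := by rw [← h.nil]; simp
  have hc {T : C} (a : T ⟶ A) (l : T ⟶ L') : S'.cons a l ≫ i.inv = S.cons a (l ≫ i.inv) := by
    have := h.cons a (l ≫ i.inv)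
    simp only [Category.comp_id, Category.assoc, Iso.inv_hom_id] at this
    rw [← this]
    simp
  intro X Y b g
  have key (r : X ⨯ L' ⟶ Y) : S'.IsRec b g r ↔ S.IsRec b g (prod.map (𝟙 X) i.hom ≫ r) := by
    constructor
    · exact fun k ↦ ⟨fun x ↦ by simpa [h.nil] using k.nil x, fun x a l ↦ by
        simpa [h.cons] using k.cons x a (l ≫ i.hom)⟩
    · exact fun k ↦ ⟨fun x ↦ by simpa [h.nil] using k.nil x, fun x a l ↦ by
        simpa [h.cons] using k.cons x a (l ≫ i.inv)⟩
  obtain ⟨r, hr, hr'⟩ := hS b g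
  refine ⟨prod.map (𝟙 X) i.inv ≫ r, (key _).2 ?_, fun r' h' ↦ ?_⟩
  · simpa using hr
  · rw [← hr' _ ((key _).1 h')]
    simp

theorem IsUniversal.exists_iso {A L L' : C} {S : ListAlg A L} (hS : S.IsUniversal)
    {S' : ListAlg A L'} (hS' : S'.IsUniversal) : ∃ i : L ≅ L', IsHom S S' (𝟙 A) i.hom := by
  obtain ⟨φ, hφ⟩ := hS.exists_isHom S' (𝟙 A)
  obtain ⟨ψ, hψ⟩ := hS'.exists_isHom S (𝟙 A)
  exact ⟨⟨φ, ψ, hS.isHom_ext (by simpa using hφ.comp hψ) (.id S),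
    hS'.isHom_ext (by simpa using hψ.comp hφ) (.id S')⟩, hφ⟩

end ListAlg

end ListAlgebras

/-! ### Representable predicates, and induction over lists -/

section Predicates

variable {C : Type u} [Category.{v} C]

/-- A predicate on the generalised elements of `V` is representable if there is a map to `V` along
which precisely the elements that satisfy the predicate lift. -/
def IsRepr {V : C} (Φ : ∀ ⦃T : C⦄, (T ⟶ V) → Prop) : Prop :=
  ∃ (P : C) (π : P ⟶ V), ∀ ⦃T : C⦄ (v : T ⟶ V), Φ v ↔ ∃ t : T ⟶ P, t ≫ π = v

variable {V : C} {Φ Ψ : ∀ ⦃T : C⦄, (T ⟶ V) → Prop}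

theorem IsRepr.precomp (h : IsRepr Φ) {T T' : C} {v : T ⟶ V} (hv : Φ v) (e : T' ⟶ T) :
    Φ (e ≫ v) := by
  obtain ⟨P, π, h⟩ := h
  obtain ⟨t, rfl⟩ := (h v).1 hv
  exact (h _).2 ⟨e ≫ t, by simp⟩

theorem IsRepr.congr (h : IsRepr Φ) (hΨ : ∀ ⦃T : C⦄ (v : T ⟶ V), Ψ v ↔ Φ v) : IsRepr Ψ := by
  obtain ⟨P, π, h⟩ := h
  exact ⟨P, π, fun T v ↦ (hΨ v).trans (h v)⟩

theorem IsRepr.comap [HasPullbacks C] (h : IsRepr Φ) {V' : C} (f : V' ⟶ V) :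
    IsRepr fun T (v : T ⟶ V') ↦ Φ (v ≫ f) := by
  obtain ⟨P, π, h⟩ := h
  refine ⟨pullback f π, pullback.fst f π, fun T v ↦ (h _).trans ⟨?_, ?_⟩⟩
  · rintro ⟨t, ht⟩
    exact ⟨pullback.lift v t ht.symm, pullback.lift_fst _ _ _⟩
  · rintro ⟨t, rfl⟩
    exact ⟨t ≫ pullback.snd f π, by simp [pullback.condition]⟩

theorem IsRepr.and [HasPullbacks C] (h : IsRepr Φ) (h' : IsRepr Ψ) :
    IsRepr fun T (v : T ⟶ V) ↦ Φ v ∧ Ψ v := by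
  obtain ⟨P, π, h⟩ := h
  obtain ⟨P', π', h'⟩ := h'
  refine ⟨pullback π π', pullback.fst π π' ≫ π, fun T v ↦ ⟨?_, ?_⟩⟩
  · rintro ⟨k, k'⟩
    obtain ⟨t, ht⟩ := (h v).1 k
    obtain ⟨t', ht'⟩ := (h' v).1 k'
    exact ⟨pullback.lift t t' (ht.trans ht'.symm), by rw [pullback.lift_fst_assoc, ht]⟩
  · rintro ⟨t, rfl⟩
    exact ⟨(h _).2 ⟨t ≫ pullback.fst π π', by simp⟩,
      (h' _).2 ⟨t ≫ pullback.snd π π', by simp [pullback.condition]⟩⟩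

theorem IsRepr.eq [HasEqualizers C] {M : C} (f g : V ⟶ M) :
    IsRepr fun T (v : T ⟶ V) ↦ v ≫ f = v ≫ g :=
  ⟨equalizer f g, equalizer.ι f g, fun T v ↦ ⟨fun h ↦ ⟨equalizer.lift v h, equalizer.lift_ι _ _⟩,
    by rintro ⟨t, rfl⟩; rw [Category.assoc, Category.assoc, equalizer.condition]⟩⟩

/-- No image is needed: the representing map need not be monic, so composing it with a projection
represents existence of a witness over the same stage. -/
theorem IsRepr.exists [HasBinaryProducts C] {N : C} {Φ : ∀ ⦃T : C⦄, (T ⟶ V ⨯ N) → Prop}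
    (h : IsRepr Φ) : IsRepr fun T (v : T ⟶ V) ↦ ∃ n : T ⟶ N, Φ (prod.lift v n) := by
  obtain ⟨P, π, h⟩ := h
  refine ⟨P, π ≫ prod.fst, fun T v ↦ ⟨?_, ?_⟩⟩
  · rintro ⟨n, hn⟩
    obtain ⟨t, ht⟩ := (h _).1 hn
    exact ⟨t, by rw [reassoc_of% ht, prod.lift_fst]⟩
  · rintro ⟨t, rfl⟩
    exact ⟨t ≫ π ≫ prod.snd, (h _).2 ⟨t, by ext <;> simp⟩⟩

/-- Lifts over the two summands are combined by the universal property of the sum. This is what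
permits case distinctions. -/
theorem IsRepr.of_isSum (h : IsRepr Φ) {T T₁ T₂ : C} {i₁ : T₁ ⟶ T} {i₂ : T₂ ⟶ T}
    (hT : IsSum i₁ i₂) {v : T ⟶ V} (h₁ : Φ (i₁ ≫ v)) (h₂ : Φ (i₂ ≫ v)) :
    Φ v := by
  obtain ⟨P, π, h⟩ := h
  obtain ⟨t₁, ht₁⟩ := (h _).1 h₁
  obtain ⟨t₂, ht₂⟩ := (h _).1 h₂
  obtain ⟨t, k₁, k₂⟩ := hT.exists_desc t₁ t₂
  refine (h _).2 ⟨t, hT.hom_ext ?_ ?_⟩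
  · rw [reassoc_of% k₁, ht₁]
  · rw [reassoc_of% k₂, ht₂]

/-- Induction over lists. -/
theorem ListAlg.IsUniversal.induction [HasFiniteProducts C] {A L X : C} {S : ListAlg A L}
    (hS : S.IsUniversal) {Φ : ∀ ⦃T : C⦄, (T ⟶ X ⨯ L) → Prop} (hΦ : IsRepr Φ)
    (nil : ∀ {T : C} (x : T ⟶ X), Φ (prod.lift x (S.nil T)))
    (cons : ∀ {T : C} (x : T ⟶ X) (a : T ⟶ A) (l : T ⟶ L), Φ (prod.lift x l) →
      Φ (prod.lift x (S.cons a l))) {T : C} (v : T ⟶ X ⨯ L) : Φ v := by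
  suffices h : Φ (𝟙 (X ⨯ L)) by simpa using hΦ.precomp h v
  obtain ⟨P, π, h⟩ := hΦ
  -- At generic elements, the two hypotheses provide recursion data on `P`. The resulting `r` is a
  -- section of `π`, since `r ≫ π` and the identity satisfy the same recursion.
  obtain ⟨b, hb⟩ := (h _).1 (nil (𝟙 X))
  obtain ⟨g, hg⟩ := (h _).1 (cons (prod.snd ≫ π ≫ prod.fst : A ⨯ P ⟶ X) prod.fst
    (prod.snd ≫ π ≫ prod.snd) ((h _).2 ⟨prod.snd, by ext <;> simp⟩))
  obtain ⟨r, hr⟩ := hS.exists_rec b g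
  have h₁ : S.IsRec (prod.lift (𝟙 X) (S.nil X))
      (prod.lift (prod.snd ≫ prod.fst) (S.cons prod.fst (prod.snd ≫ prod.snd))) (r ≫ π) := by
    refine ⟨fun x ↦ ?_, fun x a l ↦ ?_⟩
    · have := congrArg (· ≫ π) (hr.nil x)
      simpa [hb] using this
    · have := congrArg (· ≫ π) (hr.cons x a l)
      simpa [hg] using this
  have h₂ : S.IsRec (prod.lift (𝟙 X) (S.nil X))
      (prod.lift (prod.snd ≫ prod.fst) (S.cons prod.fst (prod.snd ≫ prod.snd))) (𝟙 (X ⨯ L)) :=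
    ⟨fun x ↦ by simp, fun x a l ↦ by simp⟩
  exact (h _).2 ⟨r, hS.hom_ext h₁ h₂⟩

end Predicates

/-! ### Extensive categories -/

section Extensive

variable {C : Type u} [Category.{v} C]

/-- Contradictory cases are dismissed in this way: a contradiction shows that the stage is initial.
-/
theorem IsRepr.of_isInitial {V T : C} {Φ : ∀ ⦃T : C⦄, (T ⟶ V) → Prop} (hΦ : IsRepr Φ)
    (hT : Nonempty (IsInitial T)) (v : T ⟶ V) : Φ v := by
  obtain ⟨P, π, h⟩ := hΦ
  exact (h v).2 ⟨hT.some.to P, hT.some.hom_ext _ _⟩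

variable [FinitaryExtensive C]

/-- Pulling the injections back along `t` splits the stage, by extensivity. -/
theorem IsSum.exists_decomposition [HasPullbacks C] {A B S T : C} {i₁ : A ⟶ S} {i₂ : B ⟶ S}
    (h : IsSum i₁ i₂) (t : T ⟶ S) : ∃ (T₁ T₂ : C) (j₁ : T₁ ⟶ T) (j₂ : T₂ ⟶ T) (a : T₁ ⟶ A)
      (b : T₂ ⟶ B), IsSum j₁ j₂ ∧ j₁ ≫ t = a ≫ i₁ ∧ j₂ ≫ t = b ≫ i₂ := by
  have hv := (BinaryCofan.isVanKampen_iff _).1 (FinitaryExtensive.van_kampen' _ h.some)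
    (BinaryCofan.mk (pullback.fst t i₁) (pullback.fst t i₂)) (pullback.snd t i₁)
    (pullback.snd t i₂) t pullback.condition.symm pullback.condition.symm
  exact ⟨_, _, pullback.fst t i₁, pullback.fst t i₂, pullback.snd t i₁, pullback.snd t i₂,
    hv.2 ⟨IsPullback.of_hasPullback _ _, IsPullback.of_hasPullback _ _⟩, pullback.condition,
    pullback.condition⟩

theorem IsSum.mono_inl {A B S : C} {i₁ : A ⟶ S} {i₂ : B ⟶ S} (h : IsSum i₁ i₂) : Mono i₁ :=
  FinitaryExtensive.mono_inl_of_isColimit h.some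

theorem IsSum.mono_inr {A B S : C} {i₁ : A ⟶ S} {i₂ : B ⟶ S} (h : IsSum i₁ i₂) : Mono i₂ :=
  FinitaryExtensive.mono_inr_of_isColimit h.some

theorem isInitial_of_hom {T I : C} (hI : IsInitial I) (f : T ⟶ I) : Nonempty (IsInitial T) := by
  have := hI.isIso_to f
  exact ⟨hI.ofIso (asIso f).symm⟩

theorem IsSum.isInitial_of_eq {A B S T : C} {i₁ : A ⟶ S} {i₂ : B ⟶ S} (h : IsSum i₁ i₂)
    {a : T ⟶ A} {b : T ⟶ B} (hab : a ≫ i₁ = b ≫ i₂) : Nonempty (IsInitial T) :=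
  isInitial_of_hom initialIsInitial
    ((FinitaryExtensive.isPullback_initial_to_binaryCofan h.some).lift a b hab)

end Extensive

/-! ### Destructuring lists -/

section Destructuring

variable {C : Type u} [Category.{v} C] [HasFiniteLimits C] [FinitaryExtensive C]

namespace ListAlg.IsUniversal

variable {A L : C} {S : ListAlg A L} (hS : S.IsUniversal)
include hS

/-- Lambek's argument. The structure map `k` is a homomorphism for the algebra structure `U` that it
induces on its source, and `o` is the homomorphism given by recursion. Then `o ≫ k` is an
endomorphism of the universal algebra, hence the identity, and the values of `o` follow. -/
theorem exists_out : ∃ o : L ⟶ (⊤_ C) ⨿ (A ⨯ L),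
    (∀ T : C, S.nil T ≫ o = terminal.from T ≫ coprod.inl) ∧
    (∀ {T : C} (a : T ⟶ A) (l : T ⟶ L), S.cons a l ≫ o = prod.lift a l ≫ coprod.inr) ∧
    o ≫ coprod.desc (S.nil (⊤_ C)) (S.cons prod.fst prod.snd) = 𝟙 L := by
  let k : (⊤_ C) ⨿ (A ⨯ L) ⟶ L := coprod.desc (S.nil (⊤_ C)) (S.cons prod.fst prod.snd)
  let U : ListAlg A ((⊤_ C) ⨿ (A ⨯ L)) :=
    { nil := fun T ↦ terminal.from T ≫ coprod.inl
      cons := fun a l ↦ prod.lift a (l ≫ k) ≫ coprod.inr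
      comp_nil := fun f ↦ by rw [← Category.assoc, terminal.comp_from]
      comp_cons := fun f a l ↦ by simp }
  obtain ⟨o, ho⟩ := hS.exists_isHom U (𝟙 A)
  have hk : U.IsHom S (𝟙 A) k := ⟨fun T ↦ by simp [U, k], fun a l ↦ by simp [U, k]⟩
  have hok : o ≫ k = 𝟙 L := hS.isHom_ext (by simpa using ho.comp hk) (.id S)
  exact ⟨o, ho.nil, fun a l ↦ by simpa [hok, U] using ho.cons a l, hok⟩

theorem exists_tail : ∃ tl : L ⟶ L, (∀ T : C, S.nil T ≫ tl = S.nil T) ∧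
    ∀ {T : C} (a : T ⟶ A) (l : T ⟶ L), S.cons a l ≫ tl = l := by
  obtain ⟨o, h₁, h₂, h₃⟩ := hS.exists_out
  refine ⟨o ≫ coprod.desc (S.nil _) prod.snd, fun T ↦ ?_, fun a l ↦ ?_⟩
  · rw [reassoc_of% (h₁ T)]
    simp
  · rw [reassoc_of% (h₂ a l)]
    simp

theorem cons_injective {T : C} {a a' : T ⟶ A} {l l' : T ⟶ L} (h : S.cons a l = S.cons a' l') :
    a = a' ∧ l = l' := by
  obtain ⟨o, h₁, h₂, h₃⟩ := hS.exists_out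
  have := (isSum_coprod (⊤_ C) (A ⨯ L)).mono_inr
  have e : prod.lift a l = prod.lift a' l' := by
    rw [← cancel_mono (coprod.inr : _ ⟶ (⊤_ C) ⨿ (A ⨯ L)), ← h₂, ← h₂, h]
  exact ⟨by simpa using congrArg (· ≫ prod.fst) e, by simpa using congrArg (· ≫ prod.snd) e⟩

theorem isInitial_of_nil_eq_cons {T : C} {a : T ⟶ A} {l : T ⟶ L} (h : S.nil T = S.cons a l) :
    Nonempty (IsInitial T) := by
  obtain ⟨o, h₁, h₂, h₃⟩ := hS.exists_out
  exact (isSum_coprod (⊤_ C) (A ⨯ L)).isInitial_of_eq (by rw [← h₁, ← h₂, h])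

/-- Case distinction on whether a list is empty. -/
theorem cases {V T : C} {Φ : ∀ ⦃T : C⦄, (T ⟶ V) → Prop} (hΦ : IsRepr Φ) (v : T ⟶ V) (l : T ⟶ L)
    (nil : ∀ {T' : C} (e : T' ⟶ T), e ≫ l = S.nil T' → Φ (e ≫ v))
    (cons : ∀ {T' : C} (e : T' ⟶ T) (a : T' ⟶ A) (l' : T' ⟶ L), e ≫ l = S.cons a l' →
      Φ (e ≫ v)) : Φ v := by
  obtain ⟨o, h₁, h₂, h₃⟩ := hS.exists_out
  obtain ⟨T₁, T₂, j₁, j₂, a, b, hj, k₁, k₂⟩ :=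
    (isSum_coprod (⊤_ C) (A ⨯ L)).exists_decomposition (l ≫ o)
  have e₁ := congrArg (· ≫ coprod.desc (S.nil (⊤_ C)) (S.cons prod.fst prod.snd)) k₁
  have e₂ := congrArg (· ≫ coprod.desc (S.nil (⊤_ C)) (S.cons prod.fst prod.snd)) k₂
  simp only [Category.assoc, h₃, Category.comp_id, coprod.inl_desc, coprod.inr_desc,
    comp_nil, comp_cons] at e₁ e₂
  exact hΦ.of_isSum hj (nil j₁ e₁) (cons j₂ _ _ e₂)

/-- Well-founded induction along a map to an object of lists, given an operation `p` on `V` which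
removes the first entry of the list. -/
theorem wellFounded_induction {V : C} (ℓ : V ⟶ L) (p : V ⟶ V)
    (p_nil : ∀ {T : C} (v : T ⟶ V), v ≫ ℓ = S.nil T → v ≫ p = v)
    (p_cons : ∀ {T : C} (v : T ⟶ V) (a : T ⟶ A) (l : T ⟶ L), v ≫ ℓ = S.cons a l →
      v ≫ p ≫ ℓ = l)
    {Φ : ∀ ⦃T : C⦄, (T ⟶ V) → Prop} (hΦ : IsRepr Φ)
    (nil : ∀ {T : C} (v : T ⟶ V), v ≫ ℓ = S.nil T → Φ v)
    (cons : ∀ {T : C} (v : T ⟶ V) (a : T ⟶ A) (l : T ⟶ L), v ≫ ℓ = S.cons a l → Φ (v ≫ p) → Φ v)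
    {T : C} (v : T ⟶ V) : Φ v := by
  obtain ⟨tl, tl_nil, tl_cons⟩ := hS.exists_tail
  have hpℓ : p ≫ ℓ = ℓ ≫ tl := by
    have := hS.cases (IsRepr.eq (p ≫ ℓ) (ℓ ≫ tl)) (𝟙 V) ℓ
      (fun e he ↦ by
        have := p_nil e he
        simp only [Category.comp_id]
        rw [reassoc_of% this, he, reassoc_of% he, tl_nil])
      (fun e a l he ↦ by
        simp only [Category.comp_id]
        rw [p_cons e a l he, reassoc_of% he, tl_cons])
    simpa using this
  -- Lists serve as lengths: `sub (n, i)` is `n` with as many entries removed as `i` has, and `it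
  -- (v, i)` applies `p` to `v` that many times. The entries of `i` play no part.
  obtain ⟨sub, hsub⟩ := hS.exists_rec (𝟙 L) (prod.snd ≫ tl)
  obtain ⟨it, hit⟩ := hS.exists_rec (𝟙 V) (prod.snd ≫ p)
  have sub_nil {T : C} (n : T ⟶ L) : prod.lift n (S.nil T) ≫ sub = n := by
    simpa using hsub.nil n
  have sub_cons {T : C} (n : T ⟶ L) (a : T ⟶ A) (l : T ⟶ L) :
      prod.lift n (S.cons a l) ≫ sub = prod.lift n l ≫ sub ≫ tl := by
    simpa using hsub.cons n a l
  have it_nil {T : C} (v : T ⟶ V) : prod.lift v (S.nil T) ≫ it = v := by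
    simpa using hit.nil v
  have it_cons {T : C} (v : T ⟶ V) (a : T ⟶ A) (l : T ⟶ L) :
      prod.lift v (S.cons a l) ≫ it = prod.lift v l ≫ it ≫ p := by
    simpa using hit.cons v a l
  have tl_sub {T : C} (n l : T ⟶ L) : prod.lift (n ≫ tl) l ≫ sub = prod.lift n l ≫ sub ≫ tl := by
    have h : prod.map tl (𝟙 L) ≫ sub = sub ≫ tl := by
      refine hS.hom_ext (b := tl) (g := prod.snd ≫ tl) ⟨fun x ↦ ?_, fun x a l ↦ ?_⟩
        ⟨fun x ↦ ?_, fun x a l ↦ ?_⟩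
      · simp [sub_nil]
      · simp [sub_cons]
      · simp [reassoc_of% sub_nil]
      · simp [reassoc_of% sub_cons]
    simpa using congrArg (prod.lift n l ≫ ·) h
  -- The analogue of `n - n = 0`; in the inductive step, `tl_sub` cancels the heads of the two
  -- arguments against each other.
  have sub_self {T : C} (n : T ⟶ L) : prod.lift n n ≫ sub = S.nil T := by
    have h : (prod.snd : (⊤_ C) ⨯ L ⟶ L) ≫ prod.lift (𝟙 L) (𝟙 L) ≫ sub = S.nil _ := by
      refine hS.hom_ext (b := S.nil _) (g := prod.snd) ⟨fun x ↦ ?_, fun x a l ↦ ?_⟩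
        ⟨fun x ↦ ?_, fun x a l ↦ ?_⟩
      · simp [sub_nil]
      · simp [sub_cons, ← tl_sub, tl_cons]
      · simp
      · simp
    simpa using congrArg (prod.lift (terminal.from T) n ≫ ·) h
  have it_ℓ {T : C} (v : T ⟶ V) (i : T ⟶ L) :
      prod.lift v i ≫ it ≫ ℓ = prod.lift (v ≫ ℓ) i ≫ sub := by
    have h : it ≫ ℓ = prod.map ℓ (𝟙 L) ≫ sub := by
      refine hS.hom_ext (b := ℓ) (g := prod.snd ≫ tl) ⟨fun x ↦ ?_, fun x a l ↦ ?_⟩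
        ⟨fun x ↦ ?_, fun x a l ↦ ?_⟩
      · simp [reassoc_of% it_nil]
      · simp [reassoc_of% it_cons, hpℓ]
      · simp [sub_nil]
      · simp [sub_cons]
    simpa using congrArg (prod.lift v i ≫ ·) h
  have step {T : C} (v : T ⟶ V) (h : Φ (v ≫ p)) : Φ v :=
    hS.cases hΦ v (v ≫ ℓ)
      (fun e he ↦ nil _ (by simpa using he))
      (fun e a l he ↦ cons _ a l (by simpa using he) (by simpa using hΦ.precomp h e))
  -- `κ (v, i)` applies `p` to `v` as many times as `ℓ v` is longer than `i`. Ordinary induction on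
  -- `i` proves `Φ` of it: for empty `i` all entries have been removed, and for `i` equal to `ℓ v`
  -- the result is `v` itself.
  let κ : V ⨯ L ⟶ V := prod.lift prod.fst (prod.lift (prod.fst ≫ ℓ) prod.snd ≫ sub) ≫ it
  have key := hS.induction (hΦ.comap κ)
    (fun v ↦ nil _ (by simp [κ, sub_nil, it_ℓ, sub_self]))
    (fun v a l h ↦ by
      simp only [κ, prod.comp_lift_assoc, prod.lift_fst, prod.lift_fst_assoc,
        prod.lift_snd, sub_cons] at h ⊢
      -- If the difference is already empty, its tail is empty too and `κ` does not change;
      -- otherwise there is one application of `p` fewer, and `step` accounts for it.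
      refine hS.cases hΦ _ (prod.lift (v ≫ ℓ) l ≫ sub) (fun e he ↦ ?_) (fun e a' l' he ↦ ?_)
      · have := hΦ.precomp h e
        simp only [prod.comp_lift_assoc] at this he ⊢
        rw [reassoc_of% he, tl_nil]
        rwa [he] at this
      · have := hΦ.precomp h e
        simp only [prod.comp_lift_assoc] at this he ⊢
        rw [reassoc_of% he, tl_cons]
        rw [he, it_cons] at this
        exact step _ (by simpa using this))
    (prod.lift v (v ≫ ℓ))
  simpa [κ, sub_self, it_nil] using key

/-- Well-founded induction on the pairs of equal values of two maps. -/
theorem wellFounded_induction_on {Q M : C} {f g : Q ⟶ M} (ℓ : Q ⟶ L) (p : Q ⟶ Q)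
    (hp : ∀ {T : C} (q : T ⟶ Q), q ≫ f = q ≫ g → q ≫ p ≫ f = q ≫ p ≫ g)
    (p_nil : ∀ {T : C} (q : T ⟶ Q), q ≫ f = q ≫ g → q ≫ ℓ = S.nil T → q ≫ p = q)
    (p_cons : ∀ {T : C} (q : T ⟶ Q) (a : T ⟶ A) (l : T ⟶ L), q ≫ ℓ = S.cons a l →
      q ≫ p ≫ ℓ = l)
    {Φ : ∀ ⦃T : C⦄, (T ⟶ Q) → Prop} (hΦ : IsRepr Φ)
    (nil : ∀ {T : C} (q : T ⟶ Q), q ≫ f = q ≫ g → q ≫ ℓ = S.nil T → Φ q)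
    (cons : ∀ {T : C} (q : T ⟶ Q) (a : T ⟶ A) (l : T ⟶ L), q ≫ f = q ≫ g → q ≫ ℓ = S.cons a l →
      Φ (q ≫ p) → Φ q)
    {T : C} (q : T ⟶ Q) (hq : q ≫ f = q ≫ g) : Φ q := by
  have hι {T : C} (v : T ⟶ equalizer f g) :
      (v ≫ equalizer.ι f g) ≫ f = (v ≫ equalizer.ι f g) ≫ g := by
    rw [Category.assoc, Category.assoc, equalizer.condition]
  let p' : equalizer f g ⟶ equalizer f g := equalizer.lift (equalizer.ι f g ≫ p)
    (by simpa using hp _ (equalizer.condition f g))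
  have hp' : p' ≫ equalizer.ι f g = equalizer.ι f g ≫ p := equalizer.lift_ι _ _
  have := hS.wellFounded_induction (equalizer.ι f g ≫ ℓ) p'
    (fun v hv ↦ by
      rw [← cancel_mono (equalizer.ι f g), Category.assoc, hp', ← Category.assoc]
      exact p_nil _ (hι v) (by simpa using hv))
    (fun v a l hv ↦ by
      rw [reassoc_of% hp']
      simpa using p_cons (v ≫ equalizer.ι f g) a l (by simpa using hv))
    (hΦ.comap (equalizer.ι f g))
    (fun v hv ↦ nil _ (hι v) (by simpa using hv))
    (fun v a l hv h ↦ cons _ a l (hι v) (by simpa using hv) (by simpa [hp'] using h))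
    (equalizer.lift q hq)
  simpa using this

end ListAlg.IsUniversal

theorem ListAlg.IsHom.comp_tail {A L A' L' : C} {S : ListAlg A L} {S' : ListAlg A' L'} {f : A ⟶ A'}
    {φ : L ⟶ L'} (h : S.IsHom S' f φ) (hS : S.IsUniversal) {tl : L ⟶ L} {tl' : L' ⟶ L'}
    (tl_nil : ∀ T : C, S.nil T ≫ tl = S.nil T)
    (tl_cons : ∀ {T : C} (a : T ⟶ A) (l : T ⟶ L), S.cons a l ≫ tl = l)
    (tl'_nil : ∀ T : C, S'.nil T ≫ tl' = S'.nil T)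
    (tl'_cons : ∀ {T : C} (a : T ⟶ A') (l : T ⟶ L'), S'.cons a l ≫ tl' = l) :
    tl ≫ φ = φ ≫ tl' := by
  have := hS.cases (IsRepr.eq (tl ≫ φ) (φ ≫ tl')) (𝟙 L) (𝟙 L)
    (fun e he ↦ by
      obtain rfl : e = _ := by simpa using he
      simp only [Category.comp_id]
      rw [reassoc_of% (tl_nil _), h.nil, reassoc_of% (h.nil _), tl'_nil])
    (fun e a l he ↦ by
      obtain rfl : e = _ := by simpa using he
      simp only [Category.comp_id]
      rw [reassoc_of% (tl_cons a l), reassoc_of% (h.cons a l), tl'_cons])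
  simpa using this

section

variable {X : PseudoEquivRel C} {L LR : C} {S : ListAlg X.A L} {SR : ListAlg X.R LR}
  (hS : S.IsUniversal) (hSR : SR.IsUniversal) {q₁ q₂ : LR ⟶ L} (h₁ : SR.IsHom S X.p₁ q₁)
  (h₂ : SR.IsHom S X.p₂ q₂)
include hS hSR h₁ h₂

/-- The two lists are zipped. Their middle lists agree, so they are empty together or have matching
heads, which transitivity of `X` combines. The induction removes both heads at once and runs over
the pairs whose middle lists agree. -/
theorem PseudoEquivRel.transitive_list {T : C} (x y : T ⟶ LR) (hxy : x ≫ q₂ = y ≫ q₁) :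
    ∃ z : T ⟶ LR, z ≫ q₁ = x ≫ q₁ ∧ z ≫ q₂ = y ≫ q₂ := by
  obtain ⟨tl, tl_nil, tl_cons⟩ := hSR.exists_tail
  obtain ⟨tl', tl'_nil, tl'_cons⟩ := hS.exists_tail
  have tl_q₁ := h₁.comp_tail hSR tl_nil tl_cons tl'_nil tl'_cons
  have tl_q₂ := h₂.comp_tail hSR tl_nil tl_cons tl'_nil tl'_cons
  let Φ : ∀ ⦃T : C⦄, (T ⟶ LR ⨯ LR) → Prop := fun T q ↦ ∃ z : T ⟶ LR,
    z ≫ q₁ = q ≫ prod.fst ≫ q₁ ∧ z ≫ q₂ = q ≫ prod.snd ≫ q₂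
  have hΦ : IsRepr Φ := by
    refine (((IsRepr.eq (V := (LR ⨯ LR) ⨯ LR) (prod.snd ≫ q₁) (prod.fst ≫ prod.fst ≫ q₁)).and
      (IsRepr.eq (prod.snd ≫ q₂) (prod.fst ≫ prod.snd ≫ q₂))).exists).congr fun T q ↦ ?_
    simp [Φ]
  have := hSR.wellFounded_induction_on (f := prod.fst ≫ q₂) (g := prod.snd ≫ q₁) prod.fst
    (prod.map tl tl) (Φ := Φ)
    (fun q hq ↦ by
      rw [prod.map_fst_assoc, prod.map_snd_assoc, tl_q₁, tl_q₂]
      simpa using congrArg (· ≫ tl') hq)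
    (fun {T} q hq hn ↦ by
      rw [reassoc_of% hn, h₂.nil] at hq
      -- When the first list is empty so is the second, because a nonempty one makes the stage
      -- initial; hence taking tails changes neither.
      have : q ≫ prod.snd = SR.nil T := by
        refine hSR.cases (V := LR) (Φ := fun T v ↦ v = SR.nil T)
          ((IsRepr.eq (𝟙 LR) (SR.nil LR)).congr fun T v ↦ by simp) _ (q ≫ prod.snd)
          (fun e he ↦ he) fun e a l he ↦ ?_
        have h' := congrArg (e ≫ ·) hq
        simp only [reassoc_of% he, ListAlg.comp_nil, h₁.cons] at h'
        exact (hS.isInitial_of_nil_eq_cons h').some.hom_ext _ _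
      ext
      · simp [reassoc_of% hn, tl_nil, hn]
      · simp [reassoc_of% this, tl_nil, this])
    (fun q a l h ↦ by rw [prod.map_fst, reassoc_of% h, tl_cons])
    hΦ
    (fun {T} q hq hn ↦ ?_) (fun {T} q a l hq hn h ↦ ?_)
    (prod.lift x y) (by simpa using hxy)
  · simpa [Φ] using this
  · refine hSR.cases hΦ q (q ≫ prod.snd) (fun e he ↦ ?_) fun e a l he ↦ ?_
    · refine ⟨SR.nil _, ?_, ?_⟩
      · simp [reassoc_of% hn, h₁.nil]
      · simp [reassoc_of% he, h₂.nil]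
    · rw [reassoc_of% hn, h₂.nil] at hq
      have h' := congrArg (e ≫ ·) hq
      simp only [reassoc_of% he, ListAlg.comp_nil, h₁.cons] at h'
      exact hΦ.of_isInitial (hS.isInitial_of_nil_eq_cons h') _
  · refine hSR.cases hΦ q (q ≫ prod.snd) (fun e he ↦ ?_) fun {T'} e a' l' he ↦ ?_
    · rw [reassoc_of% hn, h₂.cons] at hq
      have h' := congrArg (e ≫ ·) hq
      simp only [reassoc_of% he, ListAlg.comp_cons, h₁.nil] at h'
      exact hΦ.of_isInitial (hS.isInitial_of_nil_eq_cons h'.symm) _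
    · rw [reassoc_of% hn, h₂.cons] at hq
      have h' := congrArg (e ≫ ·) hq
      simp only [reassoc_of% he, ListAlg.comp_cons, h₁.cons] at h'
      obtain ⟨ha, -⟩ := hS.cons_injective h'
      obtain ⟨z, hz₁, hz₂⟩ := hΦ.precomp h e
      obtain ⟨c, hc₁, hc₂⟩ := X.transitive (e ≫ a) a' (by simpa using ha)
      have t₁ := tl_cons (e ≫ a) (e ≫ l)
      have t₂ := tl_cons a' l'
      refine ⟨SR.cons c z, ?_, ?_⟩
      · simp [h₁.cons, hc₁, hz₁, reassoc_of% hn, reassoc_of% t₁]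
      · simp [h₂.cons, hc₂, hz₂, reassoc_of% he, reassoc_of% t₂]

/-- The lists of related pairs form a pseudo-equivalence relation on the lists. -/
def PseudoEquivRel.list : PseudoEquivRel C where
  A := L
  R := LR
  p₁ := q₁
  p₂ := q₂
  reflexive := by
    obtain ⟨r, hr₁, hr₂⟩ := X.reflexive
    obtain ⟨r', hr'⟩ := hS.exists_isHom SR r
    exact ⟨r', hS.isHom_ext (by simpa [hr₁] using hr'.comp h₁) (.id S),
      hS.isHom_ext (by simpa [hr₂] using hr'.comp h₂) (.id S)⟩
  symmetric := by
    obtain ⟨s, hs₁, hs₂⟩ := X.symmetric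
    obtain ⟨s', hs'⟩ := hSR.exists_isHom SR s
    exact ⟨s', hSR.isHom_ext (by simpa [hs₁] using hs'.comp h₁) h₂,
      hSR.isHom_ext (by simpa [hs₂] using hs'.comp h₂) h₁⟩
  transitive x y hxy := transitive_list hS hSR h₁ h₂ x y hxy

end

end Destructuring

/-! ### Exact completions relative to a class of covers -/

section

variable {C : Type*} [Category* C] {D : Type*} [Category* D]

/-- The generalised element `v` lifts along `π` after passing to a cover. -/
def LiftsLocally (J : MorphismProperty C) {P V T : C} (π : P ⟶ V) (v : T ⟶ V) : Prop :=
  ∃ (T' : C) (e : T' ⟶ T) (t : T' ⟶ P), J e ∧ t ≫ π = e ≫ v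

/-- A class of maps, called covers, to which existential quantification is relativised. -/
class IsCovering [HasPullbacks C] (J : MorphismProperty C) : Prop where
  id_mem (X : C) : J (𝟙 X)
  comp_mem {X Y Z : C} (f : X ⟶ Y) (g : Y ⟶ Z) : J f → J g → J (f ≫ g)
  pullback_fst {X Y Z : C} (f : X ⟶ Z) (g : Y ⟶ Z) : J g → J (pullback.fst f g)
  sum {A B S A' B' S' : C} {i₁ : A ⟶ S} {i₂ : B ⟶ S} {j₁ : A' ⟶ S'} {j₂ : B' ⟶ S'} {f : A' ⟶ A}
    {g : B' ⟶ B} {h : S' ⟶ S} : IsSum i₁ i₂ → IsSum j₁ j₂ → j₁ ≫ h = f ≫ i₁ → j₂ ≫ h = g ≫ i₂ →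
      J f → J g → J h
  exists_image {P V : C} (π : P ⟶ V) : ∃ (P' : C) (π' : P' ⟶ V), ∀ {T : C} (v : T ⟶ V),
    LiftsLocally J π v ↔ ∃ t : T ⟶ P', t ≫ π' = v

/-- The purpose of `exists_image`: local existence becomes a predicate that induction over lists can
prove. -/
theorem isRepr_liftsLocally [HasPullbacks C] (J : MorphismProperty C) [IsCovering J] {P V : C}
    (π : P ⟶ V) : IsRepr fun T (v : T ⟶ V) ↦ LiftsLocally J π v := by
  obtain ⟨P', π', h⟩ := IsCovering.exists_image (J := J) π
  exact ⟨P', π', fun T v ↦ h v⟩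

/-- The map `f` is surjective, up to covers in `C`, on generalised elements defined over objects of
`C`. -/
structure LocSurj (J : MorphismProperty C) (I : C ⥤ D) {X Y : D} (f : X ⟶ Y) : Prop where
  exists_lift : ∀ {T : C} (y : I.obj T ⟶ Y), ∃ (T' : C) (e : T' ⟶ T) (x : I.obj T' ⟶ X),
    J e ∧ x ≫ f = I.map e ≫ y

/-- `D` is an exact completion of `C`, relative to the covers in `C`: its objects are the quotients
of the objects of `C` by pseudo-equivalence relations. -/
class IsExactCompletion (J : MorphismProperty C) (I : C ⥤ D) : Prop where
  full : I.Full
  faithful : I.Faithful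
  exists_cover (X : D) : ∃ (P : PseudoEquivRel C) (π : I.obj P.A ⟶ X), LocSurj J I π ∧
    ∀ {T : C} (a a' : T ⟶ P.A), I.map a ≫ π = I.map a' ≫ π ↔ P.Rel a a'
  existsUnique_desc {A : C} {X Y : D} (π : I.obj A ⟶ X) (hπ : LocSurj J I π) (f : I.obj A ⟶ Y)
    (hf : ∀ {T : C} (a a' : T ⟶ A), I.map a ≫ π = I.map a' ≫ π → I.map a ≫ f = I.map a' ≫ f) :
    ∃! d : X ⟶ Y, π ≫ d = f
  exists_quotient (P : PseudoEquivRel C) (hP : ∀ {T T' : C} (x y : T ⟶ P.A) (e : T' ⟶ T), J e →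
    P.Rel (e ≫ x) (e ≫ y) → P.Rel x y) : ∃ (X : D) (π : I.obj P.A ⟶ X), LocSurj J I π ∧
    ∀ {T : C} (a a' : T ⟶ P.A), I.map a ≫ π = I.map a' ≫ π ↔ P.Rel a a'

theorem PseudoEquivRel.isRepr_rel [HasBinaryProducts C] (P : PseudoEquivRel C) :
    IsRepr fun T (v : T ⟶ P.A ⨯ P.A) ↦ P.Rel (v ≫ prod.fst) (v ≫ prod.snd) := by
  refine ⟨P.R, prod.lift P.p₁ P.p₂, fun T v ↦ ⟨?_, ?_⟩⟩
  · rintro ⟨r, h₁, h₂⟩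
    exact ⟨r, by ext <;> simp [h₁, h₂]⟩
  · rintro ⟨r, rfl⟩
    exact ⟨r, by simp, by simp⟩

namespace LocSurj

variable {J : MorphismProperty C} {I : C ⥤ D} {X Y Z : D} {f : X ⟶ Y} {g : Y ⟶ Z}

theorem of_comp (h : LocSurj J I (f ≫ g)) : LocSurj J I g where
  exists_lift y := by
    obtain ⟨T', e, x, he, hx⟩ := h.exists_lift y
    exact ⟨T', e, x ≫ f, he, by rw [Category.assoc, hx]⟩

theorem of_isPullback {P : D} {p : P ⟶ X} {q : P ⟶ Z} {h : Z ⟶ Y} (sq : IsPullback q p h f)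
    (hf : LocSurj J I f) : LocSurj J I q where
  exists_lift z := by
    obtain ⟨T', e, x, he, hx⟩ := hf.exists_lift (z ≫ h)
    exact ⟨T', e, sq.lift (I.map e ≫ z) x (by rw [hx, Category.assoc]), he, sq.lift_fst _ _ _⟩

variable [HasPullbacks C] [IsCovering J]

theorem comp (hf : LocSurj J I f) (hg : LocSurj J I g) : LocSurj J I (f ≫ g) where
  exists_lift z := by
    obtain ⟨T₁, e₁, y, he₁, hy⟩ := hg.exists_lift z
    obtain ⟨T₂, e₂, x, he₂, hx⟩ := hf.exists_lift y
    exact ⟨T₂, e₂ ≫ e₁, x, IsCovering.comp_mem _ _ he₂ he₁, by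
      rw [← Category.assoc, hx, Category.assoc, hy, I.map_comp, Category.assoc]⟩

theorem of_isIso [IsIso f] : LocSurj J I f where
  exists_lift {T} y := ⟨T, 𝟙 T, y ≫ inv f, IsCovering.id_mem _, by simp⟩

end LocSurj

namespace IsExactCompletion

variable {J : MorphismProperty C} {I : C ⥤ D} [IsExactCompletion J I]
include J I

variable (J) in
theorem exists_map_eq {A B : C} (x : I.obj A ⟶ I.obj B) : ∃ a : A ⟶ B, I.map a = x :=
  have := full (J := J) (I := I)
  I.map_surjective x

variable (J) in
theorem map_injective {A B : C} {a b : A ⟶ B} (h : I.map a = I.map b) : a = b :=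
  have := faithful (J := J) (I := I)
  I.map_injective h

variable [HasFiniteLimits C] [IsCovering J]

theorem locSurj_map {A B : C} {e : A ⟶ B} (he : J e) : LocSurj J I (I.map e) where
  exists_lift {T} y := by
    obtain ⟨b, rfl⟩ := exists_map_eq J y
    exact ⟨_, pullback.fst b e, I.map (pullback.snd b e), IsCovering.pullback_fst _ _ he, by
      rw [← I.map_comp, ← I.map_comp, pullback.condition]⟩

omit [HasFiniteLimits C] [IsCovering J] in
theorem exists_lift {A T : C} {X : D} {π : I.obj A ⟶ X} (hπ : LocSurj J I π) (x : I.obj T ⟶ X) :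
    ∃ (T' : C) (e : T' ⟶ T) (a : T' ⟶ A), J e ∧ I.map a ≫ π = I.map e ≫ x := by
  obtain ⟨T', e, y, he, hy⟩ := hπ.exists_lift x
  obtain ⟨a, rfl⟩ := exists_map_eq J y
  exact ⟨T', e, a, he, hy⟩

/-- Maps descend uniquely along locally surjective maps. -/
theorem existsUnique_desc' {X Y Z : D} (f : X ⟶ Y) (hf : LocSurj J I f) (g : X ⟶ Z)
    (h : ∀ {T : C} (x x' : I.obj T ⟶ X), x ≫ f = x' ≫ f → x ≫ g = x' ≫ g) :
    ∃! d : Y ⟶ Z, f ≫ d = g := by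
  obtain ⟨P, π, hπ, -⟩ := exists_cover (J := J) (I := I) X
  obtain ⟨d, hd, hd'⟩ := existsUnique_desc (π ≫ f) (hπ.comp hf) (π ≫ g) (fun a a' haa' ↦ by
    simpa using h (I.map a ≫ π) (I.map a' ≫ π) (by simpa using haa'))
  -- `π` is not yet known to be epic; the uniqueness part of descent along it takes the place of
  -- cancellation.
  obtain ⟨k, -, hk'⟩ := existsUnique_desc (Y := Z) π hπ (π ≫ g) (fun a a' haa' ↦ by
    rw [reassoc_of% haa'])
  refine ⟨d, ?_, fun d' h' ↦ hd' _ (by simp only [Category.assoc, h'])⟩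
  rw [Category.assoc] at hd
  exact (hk' _ hd).trans (hk' _ rfl).symm

theorem _root_.AriUniv.LocSurj.epi {X Y : D} {f : X ⟶ Y} (hf : LocSurj J I f) : Epi f where
  left_cancellation g h hgh :=
    (existsUnique_desc' f hf (f ≫ h) (fun x x' hx ↦ by rw [reassoc_of% hx])).unique hgh rfl

theorem epi_map {A B : C} {e : A ⟶ B} (he : J e) : Epi (I.map e) :=
  (locSurj_map (J := J) he).epi

variable (J I) in
/-- Maps out of an object of `D` are determined by their values on generalised elements. -/
theorem hom_ext {X Y : D} {f g : X ⟶ Y} (h : ∀ {T : C} (x : I.obj T ⟶ X), x ≫ f = x ≫ g) :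
    f = g := by
  obtain ⟨P, π, hπ, -⟩ := exists_cover (J := J) (I := I) X
  have := hπ.epi
  rw [← cancel_epi π, h]

variable (J I) in
/-- A square is a pullback if it is one on generalised elements. -/
theorem isPullback_of_elements {P X Y Z : D} {p : P ⟶ X} {q : P ⟶ Y} {f : X ⟶ Z} {g : Y ⟶ Z}
    (w : p ≫ f = q ≫ g)
    (h : ∀ {T : C} (x : I.obj T ⟶ X) (y : I.obj T ⟶ Y), x ≫ f = y ≫ g →
      ∃ z : I.obj T ⟶ P, z ≫ p = x ∧ z ≫ q = y)
    (h' : ∀ {T : C} (z z' : I.obj T ⟶ P), z ≫ p = z' ≫ p → z ≫ q = z' ≫ q → z = z') :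
    IsPullback p q f g := by
  have hom_ext' {W : D} {m m' : W ⟶ P} (hm : m ≫ p = m' ≫ p) (hm' : m ≫ q = m' ≫ q) : m = m' :=
    hom_ext J I fun x ↦ h' _ _ (by simp [hm]) (by simp [hm'])
  have key (s : PullbackCone f g) : ∃ l : s.pt ⟶ P, l ≫ p = s.fst ∧ l ≫ q = s.snd := by
    obtain ⟨E, π, hπ, -⟩ := exists_cover (J := J) (I := I) s.pt
    obtain ⟨z, hz, hz'⟩ := h (π ≫ s.fst) (π ≫ s.snd) (by simp [s.condition])
    obtain ⟨d, hd, -⟩ := existsUnique_desc' π hπ z (fun x x' hx ↦ hom_ext'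
      (by simp [hz, reassoc_of% hx]) (by simp [hz', reassoc_of% hx]))
    have := hπ.epi
    exact ⟨d, by rw [← cancel_epi π, reassoc_of% hd, hz], by rw [← cancel_epi π, reassoc_of% hd, hz']⟩
  choose l hl hl' using key
  exact ⟨⟨w⟩, ⟨PullbackCone.IsLimit.mk w l hl hl' fun s m hm hm' ↦
    hom_ext' (hm.trans (hl s).symm) (hm'.trans (hl' s).symm)⟩⟩

variable (J) in
-- Over a cover of `V` both maps have representatives in the object `P.A` covering `Y`, where
-- equality in `Y` means being related by `P`; this is representable, and its local image represents
-- equality on `V`. Equations in `D` thereby become accessible to induction and case distinction in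
-- `C`.
theorem isRepr_eq {V : C} {Y : D} (f g : I.obj V ⟶ Y) :
    IsRepr fun T (v : T ⟶ V) ↦ I.map v ≫ f = I.map v ≫ g := by
  obtain ⟨P, π, hπ, hP⟩ := exists_cover (J := J) (I := I) Y
  obtain ⟨A₁, e₁, f₁, he₁, hf₁⟩ := exists_lift hπ f
  obtain ⟨A₂, e₂, g₂, he₂, hg₂⟩ := exists_lift hπ (I.map e₁ ≫ g)
  obtain ⟨K, k, hk⟩ := P.isRepr_rel.comap (prod.lift (e₂ ≫ f₁) g₂)
  refine (isRepr_liftsLocally J (k ≫ e₂ ≫ e₁)).congr fun T v ↦ ⟨fun h ↦ ?_, ?_⟩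
  · obtain ⟨t, ht⟩ := (hk (pullback.snd v (e₂ ≫ e₁))).1 (by
      simp only [Category.assoc, prod.lift_fst, prod.lift_snd]
      rw [← hP]
      simp only [I.map_comp, Category.assoc, hf₁, hg₂]
      have := congrArg (I.map (pullback.fst v (e₂ ≫ e₁)) ≫ ·) h
      simpa only [← I.map_comp, ← I.map_comp_assoc, pullback.condition, Category.assoc] using this)
    exact ⟨_, pullback.fst v (e₂ ≫ e₁), t,
      IsCovering.pullback_fst _ _ (IsCovering.comp_mem _ _ he₂ he₁), by
        rw [reassoc_of% ht, pullback.condition]⟩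
  · rintro ⟨T', e, t, he, ht⟩
    have := epi_map (I := I) he
    rw [← cancel_epi (I.map e), ← I.map_comp_assoc, ← I.map_comp_assoc, ← ht]
    have := (hk (t ≫ k)).2 ⟨t, rfl⟩
    simp only [Category.assoc, prod.lift_fst, prod.lift_snd] at this
    rw [← Category.assoc, ← Category.assoc, ← hP] at this
    simp only [I.map_comp, Category.assoc, hf₁, hg₂] at this
    simpa using this

variable (J) in
omit [IsCovering J] in
/-- The quotient of an object of `C` by an equivalence relation on its generalised elements. -/
theorem exists_quotient' {A : C} (r : ∀ ⦃T : C⦄, (T ⟶ A) → (T ⟶ A) → Prop)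
    (hr : ∀ T, Equivalence (r (T := T)))
    (h : IsRepr fun T (v : T ⟶ A ⨯ A) ↦ r (v ≫ prod.fst) (v ≫ prod.snd))
    (h' : ∀ ⦃T T' : C⦄ (x y : T ⟶ A) (e : T' ⟶ T), J e → r (e ≫ x) (e ≫ y) → r x y) :
    ∃ (X : D) (π : I.obj A ⟶ X), LocSurj J I π ∧
      ∀ {T : C} (a a' : T ⟶ A), I.map a ≫ π = I.map a' ≫ π ↔ r a a' := by
  obtain ⟨R, p, hp⟩ := h
  have key {T : C} (x y : T ⟶ A) :
      r x y ↔ ∃ t : T ⟶ R, t ≫ p ≫ prod.fst = x ∧ t ≫ p ≫ prod.snd = y := by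
    have := hp (prod.lift x y)
    simp only [prod.lift_fst, prod.lift_snd] at this
    rw [this]
    refine exists_congr fun t ↦ ⟨fun h ↦ by simp [reassoc_of% h], ?_⟩
    rintro ⟨rfl, rfl⟩
    ext <;> simp
  let P : PseudoEquivRel C :=
    { A := A
      R := R
      p₁ := p ≫ prod.fst
      p₂ := p ≫ prod.snd
      reflexive := (key _ _).1 ((hr A).refl (𝟙 A))
      symmetric := (key _ _).1 ((hr R).symm ((key _ _).2 ⟨𝟙 R, by simp, by simp⟩))
      transitive := fun x y hxy ↦ (key _ _).1 ((hr _).trans ((key _ _).2 ⟨x, rfl, hxy⟩)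
        ((key _ _).2 ⟨y, rfl, rfl⟩)) }
  have hP {T : C} (x y : T ⟶ A) : P.Rel x y ↔ r x y := (key x y).symm
  obtain ⟨X, π, hπ, hX⟩ := exists_quotient (J := J) (I := I) P fun x y e he ↦ by
    rw [hP, hP]
    exact h' x y e he
  exact ⟨X, π, hπ, fun a a' ↦ (hX a a').trans (hP a a')⟩

/-- Generalised elements can be glued along covers. -/
theorem exists_glue {T T' : C} {X Y : D} {e : T' ⟶ T} (he : J e) (x : I.obj T' ⟶ X)
    (f : X ⟶ Y) (y : I.obj T ⟶ Y) (hxy : x ≫ f = I.map e ≫ y)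
    (hf : ∀ {S : C} (s s' : I.obj S ⟶ X), s ≫ f = s' ≫ f → s = s') :
    ∃ z : I.obj T ⟶ X, z ≫ f = y := by
  obtain ⟨d, hd, -⟩ := existsUnique_desc' (I.map e) (locSurj_map he) x (fun s s' h ↦ hf _ _ (by
    rw [Category.assoc, Category.assoc, hxy, reassoc_of% h]))
  have := epi_map (I := I) he
  exact ⟨d, by rw [← cancel_epi (I.map e), reassoc_of% hd, hxy]⟩

variable (J I) in
theorem nonempty_isTerminal_map : Nonempty (IsTerminal (I.obj (⊤_ C))) := by
  have huniq {X : D} (f g : X ⟶ I.obj (⊤_ C)) : f = g := hom_ext J I fun x ↦ by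
    obtain ⟨a, ha⟩ := exists_map_eq J (x ≫ f)
    obtain ⟨b, hb⟩ := exists_map_eq J (x ≫ g)
    rw [← ha, ← hb, terminal.hom_ext a b]
  have (X : D) : Nonempty (X ⟶ I.obj (⊤_ C)) := by
    obtain ⟨P, π, hπ, -⟩ := exists_cover (J := J) (I := I) X
    obtain ⟨d, -⟩ := existsUnique_desc π hπ (I.map (terminal.from P.A))
      (fun _ _ _ ↦ huniq _ _)
    exact ⟨d⟩
  exact ⟨IsTerminal.ofUniqueHom (fun X ↦ (this X).some) fun X m ↦ huniq _ _⟩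

variable (J I) in
-- `V` represents the pairs of representatives on which `f` and `g` agree, and `P` is the quotient
-- of `V` that identifies pairs with equal images in both `X` and `Y`.
theorem exists_isPullback {X Y Z : D} (f : X ⟶ Z) (g : Y ⟶ Z) :
    ∃ (P : D) (p : P ⟶ X) (q : P ⟶ Y), IsPullback p q f g := by
  obtain ⟨EX, πX, hπX, -⟩ := exists_cover (J := J) (I := I) X
  obtain ⟨EY, πY, hπY, -⟩ := exists_cover (J := J) (I := I) Y
  obtain ⟨V, k, hk⟩ := isRepr_eq J (V := EX.A ⨯ EY.A) (I.map prod.fst ≫ πX ≫ f)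
    (I.map prod.snd ≫ πY ≫ g)
  let a : I.obj V ⟶ X := I.map (k ≫ prod.fst) ≫ πX
  let b : I.obj V ⟶ Y := I.map (k ≫ prod.snd) ≫ πY
  have hab : a ≫ f = b ≫ g := by simpa [a, b] using (hk k).2 ⟨𝟙 _, by simp⟩
  obtain ⟨P, π, hπ, hP⟩ := exists_quotient' J (I := I) (A := V)
    (fun T v v' ↦ I.map v ≫ a = I.map v' ≫ a ∧ I.map v ≫ b = I.map v' ≫ b)
    (fun T ↦ ⟨fun v ↦ ⟨rfl, rfl⟩, fun h ↦ ⟨h.1.symm, h.2.symm⟩,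
      fun h h' ↦ ⟨h.1.trans h'.1, h.2.trans h'.2⟩⟩)
    (((isRepr_eq J (I.map prod.fst ≫ a) (I.map prod.snd ≫ a)).and
      (isRepr_eq J (I.map prod.fst ≫ b) (I.map prod.snd ≫ b))).congr fun T v ↦ by simp)
    (fun T T' x y e he h ↦ by
      have := epi_map (I := I) he
      simpa [cancel_epi] using h)
  obtain ⟨p, hp, -⟩ := existsUnique_desc π hπ a (fun v v' h ↦ ((hP v v').1 h).1)
  obtain ⟨q, hq, -⟩ := existsUnique_desc π hπ b (fun v v' h ↦ ((hP v v').1 h).2)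
  have := hπ.epi
  have hom_ext' {T : C} (z z' : I.obj T ⟶ P) (h : z ≫ p = z' ≫ p) (h' : z ≫ q = z' ≫ q) :
      z = z' := by
    obtain ⟨T₁, e₁, v, he₁, hv⟩ := exists_lift hπ z
    obtain ⟨T₂, e₂, v', he₂, hv'⟩ := exists_lift hπ (I.map e₁ ≫ z')
    have := epi_map (I := I) he₁
    have := epi_map (I := I) he₂
    rw [← cancel_epi (I.map e₁), ← cancel_epi (I.map e₂), ← hv', ← hv, ← Category.assoc,
      ← I.map_comp, hP, ← hp, ← hq]
    constructor
    · simp [reassoc_of% hv, reassoc_of% hv', h]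
    · simp [reassoc_of% hv, reassoc_of% hv', h']
  refine ⟨P, p, q, isPullback_of_elements J I ?_ (fun {T} x y h ↦ ?_) hom_ext'⟩
  · rw [← cancel_epi π, reassoc_of% hp, reassoc_of% hq, hab]
  · obtain ⟨T₁, e₁, v, he₁, hv⟩ := exists_lift hπX x
    obtain ⟨T₂, e₂, v', he₂, hv'⟩ := exists_lift hπY (I.map e₁ ≫ y)
    obtain ⟨t, ht⟩ := (hk (prod.lift (e₂ ≫ v) v')).1 (by
      simp only [← I.map_comp_assoc, prod.lift_fst, prod.lift_snd]
      rw [reassoc_of% hv', ← h, I.map_comp_assoc, reassoc_of% hv])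
    have h₁ : I.map t ≫ π ≫ p = I.map (e₂ ≫ e₁) ≫ x := by
      rw [hp, ← I.map_comp_assoc, reassoc_of% ht, prod.lift_fst, I.map_comp_assoc, hv,
        I.map_comp_assoc]
    have h₂ : I.map t ≫ π ≫ q = I.map (e₂ ≫ e₁) ≫ y := by
      rw [hq, ← I.map_comp_assoc, reassoc_of% ht, prod.lift_snd, hv', I.map_comp_assoc]
    -- The element of `P` exists only over a cover, but it is unique, so it descends.
    obtain ⟨d, hd, -⟩ := existsUnique_desc' (I.map (e₂ ≫ e₁))
      (locSurj_map (IsCovering.comp_mem _ _ he₂ he₁)) (I.map t ≫ π) (fun s s' hs ↦ hom_ext' _ _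
        (by simp only [Category.assoc, h₁, reassoc_of% hs])
        (by simp only [Category.assoc, h₂, reassoc_of% hs]))
    have := epi_map (I := I) (IsCovering.comp_mem _ _ he₂ he₁)
    refine ⟨d, ?_, ?_⟩
    · rw [← cancel_epi (I.map (e₂ ≫ e₁)), reassoc_of% hd, h₁]
    · rw [← cancel_epi (I.map (e₂ ≫ e₁)), reassoc_of% hd, h₂]

variable (J I) in
theorem hasFiniteLimits : HasFiniteLimits D := by
  have : HasTerminal D := (nonempty_isTerminal_map J I).some.hasTerminal
  have : HasPullbacks D := by
    refine @hasPullbacks_of_hasLimit_cospan D _ (fun {X Y Z f g} ↦ ?_)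
    obtain ⟨P, p, q, h⟩ := exists_isPullback J I f g
    exact h.hasPullback
  exact hasFiniteLimits_of_hasTerminal_and_pullbacks

variable (J) in
/-- The canonical functor preserves pullbacks. -/
theorem isPullback_map {P X Y Z : C} {p : P ⟶ X} {q : P ⟶ Y} {f : X ⟶ Z} {g : Y ⟶ Z}
    (sq : IsPullback p q f g) : IsPullback (I.map p) (I.map q) (I.map f) (I.map g) := by
  refine isPullback_of_elements J I (by rw [← I.map_comp, ← I.map_comp, sq.w])
    (fun x y h ↦ ?_) (fun z z' h h' ↦ ?_)
  · obtain ⟨a, rfl⟩ := exists_map_eq J x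
    obtain ⟨b, rfl⟩ := exists_map_eq J y
    rw [← I.map_comp, ← I.map_comp] at h
    exact ⟨I.map (sq.lift a b (map_injective J h)), by rw [← I.map_comp, sq.lift_fst],
      by rw [← I.map_comp, sq.lift_snd]⟩
  · obtain ⟨a, rfl⟩ := exists_map_eq J z
    obtain ⟨b, rfl⟩ := exists_map_eq J z'
    rw [← I.map_comp, ← I.map_comp] at h h'
    rw [sq.hom_ext (map_injective J h) (map_injective J h')]

variable (J I) in
theorem preservesFiniteLimits : PreservesFiniteLimits I := by
  have : HasFiniteLimits D := hasFiniteLimits J I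
  have : PreservesLimit (Functor.empty.{0} C) I := preservesTerminal_of_iso I
    ((nonempty_isTerminal_map J I).some.uniqueUpToIso terminalIsTerminal)
  have := preservesLimitsOfShape_pempty_of_preservesTerminal I
  have : PreservesLimitsOfShape WalkingCospan I :=
    preservesLimitsOfShape_walkingCospan_of_forall_isPullback fun X Y Z f g _ ↦
      ⟨_, _, _, .of_hasPullback f g, isPullback_map J (.of_hasPullback f g)⟩
  exact preservesFiniteLimits_of_preservesTerminal_and_pullbacks I

end IsExactCompletion

end

/-! ### Effective quotients and coproducts in an exact completion -/

section

variable {C : Type*} [Category* C] {D : Type*} [Category* D]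

theorem IsSum.isPullback_inl [FinitaryExtensive C] {A B S A' B' S' : C} {i₁ : A ⟶ S} {i₂ : B ⟶ S}
    (h : IsSum i₁ i₂) {j₁ : A' ⟶ S'} {j₂ : B' ⟶ S'} (h' : IsSum j₁ j₂) {f : A' ⟶ A} {g : B' ⟶ B}
    {k : S' ⟶ S} (h₁ : j₁ ≫ k = f ≫ i₁) (h₂ : j₂ ≫ k = g ≫ i₂) : IsPullback j₁ f k i₁ :=
  (((BinaryCofan.isVanKampen_iff _).1 (FinitaryExtensive.van_kampen' _ h.some)
    (BinaryCofan.mk j₁ j₂) f g k h₁.symm h₂.symm).1 h').1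

theorem IsSum.symm {A B S : C} {i₁ : A ⟶ S} {i₂ : B ⟶ S} (h : IsSum i₁ i₂) : IsSum i₂ i₁ :=
  ⟨BinaryCofan.isColimitFlip h.some⟩

theorem IsSum.isPullback_inr [FinitaryExtensive C] {A B S A' B' S' : C} {i₁ : A ⟶ S} {i₂ : B ⟶ S}
    (h : IsSum i₁ i₂) {j₁ : A' ⟶ S'} {j₂ : B' ⟶ S'} (h' : IsSum j₁ j₂) {f : A' ⟶ A} {g : B' ⟶ B}
    {k : S' ⟶ S} (h₁ : j₁ ≫ k = f ≫ i₁) (h₂ : j₂ ≫ k = g ≫ i₂) : IsPullback j₂ g k i₂ :=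
  h.symm.isPullback_inl h'.symm h₂ h₁

namespace IsExactCompletion

variable [HasFiniteLimits C] {J : MorphismProperty C} [IsCovering J] {I : C ⥤ D}
  [IsExactCompletion J I]
include J I

/-- Descent along `f` is the universal property of a coequaliser of the kernel pair of `f`. -/
theorem _root_.AriUniv.LocSurj.isRegularEpi {X Y : D} {f : X ⟶ Y} (hf : LocSurj J I f) :
    IsRegularEpi f := by
  have := hasFiniteLimits J I
  have := hf.epi
  have key (s : Cofork (pullback.fst f f) (pullback.snd f f)) :=
    existsUnique_desc' f hf s.π (fun x x' h ↦ by
      simpa [pullback.lift_fst_assoc, pullback.lift_snd_assoc] using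
        congrArg (pullback.lift x x' h ≫ ·) s.condition)
  refine ⟨⟨⟨_, _, _, pullback.condition, Cofork.IsColimit.mk _ (fun s ↦ (key s).choose)
    (fun s ↦ (key s).choose_spec.1) fun s m hm ↦ (key s).choose_spec.2 _ hm⟩⟩⟩

/-- The relation is pulled back to the cover `I.obj E.A` of `X`, where it is represented in `C`, and
divided out there. The quotient map descends to `X` by reflexivity, since representatives of the
same element are related. -/
theorem exists_isUniversallyEffective {R X : D} (p₁ p₂ : R ⟶ X)
    (h : IsEquivalenceRelation p₁ p₂) : ∃ (Q : D) (q : X ⟶ Q), LocSurj J I q ∧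
      IsKernelPair q p₁ p₂ := by
  have := hasFiniteLimits J I
  obtain ⟨⟨h⟩⟩ := h
  have hmono := h.right_cancellation
  obtain ⟨E, π, hπ, -⟩ := exists_cover (J := J) (I := I) X
  let m : R ⟶ X ⨯ X := prod.lift p₁ p₂
  let n : I.obj (E.A ⨯ E.A) ⟶ X ⨯ X := prod.lift (I.map prod.fst ≫ π) (I.map prod.snd ≫ π)
  obtain ⟨K, ρ, hρ, -⟩ := exists_cover (J := J) (I := I) (pullback m n)
  obtain ⟨k, hk⟩ := exists_map_eq J (ρ ≫ pullback.snd m n)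
  -- Relatedness in `D` is a local existence statement in `C`. The local witnesses glue because `p₁`
  -- and `p₂` are jointly monic.
  have key {T : C} (v : T ⟶ E.A ⨯ E.A) : LiftsLocally J k v ↔
      ∃ r : I.obj T ⟶ R, r ≫ p₁ = I.map (v ≫ prod.fst) ≫ π ∧
        r ≫ p₂ = I.map (v ≫ prod.snd) ≫ π := by
    constructor
    · rintro ⟨T', e, t, he, ht⟩
      have hm : I.map t ≫ ρ ≫ pullback.fst m n ≫ m = I.map e ≫ I.map v ≫ n := by
        rw [pullback.condition, ← reassoc_of% hk, ← I.map_comp_assoc, ht, I.map_comp_assoc]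
      have h₁ : (I.map t ≫ ρ ≫ pullback.fst m n) ≫ p₁ =
          I.map e ≫ I.map (v ≫ prod.fst) ≫ π := by
        simpa [m, n] using congrArg (· ≫ prod.fst) hm
      have h₂ : (I.map t ≫ ρ ≫ pullback.fst m n) ≫ p₂ =
          I.map e ≫ I.map (v ≫ prod.snd) ≫ π := by
        simpa [m, n] using congrArg (· ≫ prod.snd) hm
      obtain ⟨d, hd, -⟩ := existsUnique_desc' (I.map e) (locSurj_map he)
        (I.map t ≫ ρ ≫ pullback.fst m n) (fun s s' hs ↦ hmono _ _
          (by rw [Category.assoc s, Category.assoc s', h₁, reassoc_of% hs])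
          (by rw [Category.assoc s, Category.assoc s', h₂, reassoc_of% hs]))
      have := epi_map (I := I) he
      exact ⟨d, by rw [← cancel_epi (I.map e), reassoc_of% hd, ← h₁]; simp,
        by rw [← cancel_epi (I.map e), reassoc_of% hd, ← h₂]; simp⟩
    · rintro ⟨r, h₁, h₂⟩
      obtain ⟨T', e, t, he, ht⟩ := exists_lift hρ (pullback.lift r (I.map v) (by
        ext <;> simp [m, n, h₁, h₂]))
      refine ⟨T', e, t, he, map_injective (I := I) J ?_⟩
      rw [I.map_comp, hk, reassoc_of% ht, pullback.lift_snd, I.map_comp]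
  obtain ⟨Q, q, hq, hQ⟩ := exists_quotient' J (I := I) (A := E.A)
    (fun T a a' ↦ ∃ r : I.obj T ⟶ R, r ≫ p₁ = I.map a ≫ π ∧ r ≫ p₂ = I.map a' ≫ π)
    (fun T ↦ ⟨fun a ↦ ⟨I.map a ≫ π ≫ h.r, by simp, by simp⟩,
      fun ⟨r, h₁, h₂⟩ ↦ ⟨r ≫ h.s, by rw [Category.assoc, h.symmetry₁, h₂],
        by rw [Category.assoc, h.symmetry₂, h₁]⟩,
      fun ⟨r, h₁, h₂⟩ ⟨r', h₁', h₂'⟩ ↦ ⟨PullbackCone.IsLimit.lift h.isLimit r r'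
        (h₂.trans h₁'.symm) ≫ h.t, by
          rw [Category.assoc, h.transitivity₁]
          exact (PullbackCone.IsLimit.lift_fst_assoc h.isLimit _ _ _ _).trans h₁, by
          rw [Category.assoc, h.transitivity₂]
          exact (PullbackCone.IsLimit.lift_snd_assoc h.isLimit _ _ _ _).trans h₂'⟩⟩)
    ((isRepr_liftsLocally J k).congr fun T v ↦ (key v).symm)
    (fun T T' x y e he ⟨r, h₁, h₂⟩ ↦ by
      have := (key (prod.lift x y)).1 ?_
      · simpa using this
      · obtain ⟨T'', e', t, he', ht⟩ := (key (e ≫ prod.lift x y)).2 ⟨r, by simpa using h₁,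
          by simpa using h₂⟩
        exact ⟨T'', e' ≫ e, t, IsCovering.comp_mem _ _ he' he, by simpa using ht⟩)
  obtain ⟨d, hd, -⟩ := existsUnique_desc' π hπ q (fun x x' hx ↦ by
    obtain ⟨a, rfl⟩ := exists_map_eq J x
    obtain ⟨a', rfl⟩ := exists_map_eq J x'
    exact (hQ a a').2 ⟨I.map a ≫ π ≫ h.r, by simp, by simpa using hx⟩)
  have hdq : LocSurj J I d := LocSurj.of_comp (f := π) (by rwa [hd])
  refine ⟨Q, d, hdq, isPullback_of_elements J I (hom_ext J I fun x ↦ ?_) (fun x x' hx ↦ ?_)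
    (fun z z' h h' ↦ hmono _ _ h h')⟩
  · obtain ⟨T₁, e₁, a, he₁, ha⟩ := exists_lift hπ (x ≫ p₁)
    obtain ⟨T₂, e₂, a', he₂, ha'⟩ := exists_lift hπ (I.map e₁ ≫ x ≫ p₂)
    have := epi_map (I := I) he₁
    have := epi_map (I := I) he₂
    have := (hQ (e₂ ≫ a) a').2 ⟨I.map (e₂ ≫ e₁) ≫ x, by simp [ha], by simp [ha']⟩
    rw [← hd, reassoc_of% ha', I.map_comp_assoc, reassoc_of% ha] at this
    rw [← cancel_epi (I.map e₁), ← cancel_epi (I.map e₂), this]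
  · obtain ⟨T₁, e₁, a, he₁, ha⟩ := exists_lift hπ x
    obtain ⟨T₂, e₂, a', he₂, ha'⟩ := exists_lift hπ (I.map e₁ ≫ x')
    obtain ⟨r, h₁, h₂⟩ := (hQ (e₂ ≫ a) a').1 (by
      rw [← hd, reassoc_of% ha', I.map_comp_assoc, reassoc_of% ha, hx])
    have he : J (e₂ ≫ e₁) := IsCovering.comp_mem _ _ he₂ he₁
    have k₁ : r ≫ p₁ = I.map (e₂ ≫ e₁) ≫ x := by rw [h₁]; simp [ha]
    have k₂ : r ≫ p₂ = I.map (e₂ ≫ e₁) ≫ x' := by rw [h₂]; simp [ha']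
    obtain ⟨l, hl, -⟩ := existsUnique_desc' (I.map (e₂ ≫ e₁)) (locSurj_map he) r
      (fun s s' hs ↦ hmono _ _
        (by rw [Category.assoc, Category.assoc, k₁, reassoc_of% hs])
        (by rw [Category.assoc, Category.assoc, k₂, reassoc_of% hs]))
    have := epi_map (I := I) he
    exact ⟨l, by rw [← cancel_epi (I.map (e₂ ≫ e₁)), reassoc_of% hl, k₁],
      by rw [← cancel_epi (I.map (e₂ ≫ e₁)), reassoc_of% hl, k₂]⟩

variable (J I) in
theorem isExact : IsExact D where
  __ := hasFiniteLimits J I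
  universallyEffective {R X} p₁ p₂ h := by
    have := hasFiniteLimits J I
    obtain ⟨Q, q, hq, hk⟩ := exists_isUniversallyEffective (J := J) (I := I) p₁ p₂ h
    obtain ⟨⟨e⟩⟩ := h
    have := hq.isRegularEpi
    have hc := hk.toCoequalizer'
    exact ⟨⟨{ e with
      B := Q
      π := q
      isKernelPair := hk
      -- A pushout is wanted rather than a coequaliser; as `e.r` is a common section of `p₁` and
      -- `p₂`, the two legs of any cocone are equal.
      isPushout := ⟨⟨hk.w⟩, ⟨PushoutCocone.IsColimit.mk hk.w
        (fun s ↦ Cofork.IsColimit.desc hc s.inl (by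
          have : s.inl = s.inr := by
            simpa [← Category.assoc] using congrArg (e.r ≫ ·) s.condition
          rw [s.condition, this]))
        (fun s ↦ Cofork.IsColimit.π_desc' hc _ _)
        (fun s ↦ (Cofork.IsColimit.π_desc' hc _ _).trans (by
          simpa [← Category.assoc] using congrArg (e.r ≫ ·) s.condition))
        (fun s m h₁ _ ↦ Cofork.IsColimit.hom_ext hc
          (h₁.trans (Cofork.IsColimit.π_desc' hc _ _).symm))⟩⟩
      universally_effectiveEpi_π := fun X' Y' f g q' sq ↦ by
        have := (hq.of_isPullback sq).isRegularEpi
        infer_instance }⟩⟩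

/-! #### Coproducts -/

variable (J) in
/-- The canonical functor preserves initial objects. -/
theorem nonempty_isInitial_map {T : C} (hT : IsInitial T) : Nonempty (IsInitial (I.obj T)) := by
  have (Y : D) : Nonempty (I.obj T ⟶ Y) := by
    obtain ⟨P, π, -⟩ := exists_cover (J := J) (I := I) Y
    exact ⟨I.map (hT.to P.A) ≫ π⟩
  refine ⟨IsInitial.ofUniqueHom (fun Y ↦ (this Y).some) fun Y m ↦ ?_⟩
  simpa using (isRepr_eq J m (this Y).some).of_isInitial ⟨hT⟩ (𝟙 T)

variable [FinitaryExtensive C]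

variable (J) in
theorem _root_.AriUniv.IsSum.map_hom_ext {A B S : C} {i₁ : A ⟶ S} {i₂ : B ⟶ S}
    (h : IsSum i₁ i₂) {Z : D} {f g : I.obj S ⟶ Z} (h₁ : I.map i₁ ≫ f = I.map i₁ ≫ g)
    (h₂ : I.map i₂ ≫ f = I.map i₂ ≫ g) : f = g := by
  simpa using (isRepr_eq J f g).of_isSum h (v := 𝟙 S) (by simpa using h₁) (by simpa using h₂)

variable (J) in
/-- The canonical functor preserves binary coproducts. -/
theorem _root_.AriUniv.IsSum.map {A B S : C} {i₁ : A ⟶ S} {i₂ : B ⟶ S} (h : IsSum i₁ i₂) :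
    IsSum (I.map i₁) (I.map i₂) := by
  refine IsSum.mk' (fun {Z} f g ↦ ?_) fun h₁ h₂ ↦ h.map_hom_ext J h₁ h₂
  obtain ⟨P, π, hπ, -⟩ := exists_cover (J := J) (I := I) Z
  obtain ⟨A', e₁, f', he₁, hf'⟩ := exists_lift hπ f
  obtain ⟨B', e₂, g', he₂, hg'⟩ := exists_lift hπ g
  have h' := isSum_coprod A' B'
  have := h.mono_inl
  have := h.mono_inr
  obtain ⟨k, hk₁, hk₂⟩ := h'.exists_desc (e₁ ≫ i₁) (e₂ ≫ i₂)
  obtain ⟨d, hd₁, hd₂⟩ := h'.exists_desc f' g'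
  have hk : J k := IsCovering.sum h h' hk₁ hk₂ he₁ he₂
  obtain ⟨l, hl, -⟩ := existsUnique_desc (I.map k) (locSurj_map hk) (I.map d ≫ π)
    -- Two points of `A' ⨿ B'` over the same point of `S` lie in the same summand, and there the
    -- composite with `π` is given by `f` or by `g`.
    (fun {T} s s' hs ↦ by
      have hs : s ≫ k = s' ≫ k := map_injective (I := I) J (by simpa using hs)
      obtain ⟨T₁, T₂, j₁, j₂, a, b, hj, ha, hb⟩ := h.exists_decomposition (s ≫ k)
      refine hj.map_hom_ext J ?_ ?_
      · have sq := h.isPullback_inl h' hk₁ hk₂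
        have key (s : T ⟶ A' ⨿ B') (hs : (j₁ ≫ s) ≫ k = a ≫ i₁) :
            I.map j₁ ≫ I.map s ≫ I.map d ≫ π = I.map a ≫ f := by
          obtain ⟨m, hm, hm'⟩ : ∃ m, m ≫ coprod.inl = j₁ ≫ s ∧ m ≫ e₁ = a :=
            ⟨sq.lift _ _ hs, sq.lift_fst _ _ _, sq.lift_snd _ _ _⟩
          rw [← I.map_comp_assoc, ← I.map_comp_assoc, ← hm, Category.assoc, hd₁, I.map_comp_assoc,
            hf', ← I.map_comp_assoc, hm']
        rw [key s (by simpa using ha), key s' (by rw [Category.assoc, ← hs, ha])]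
      · have sq := h.isPullback_inr h' hk₁ hk₂
        have key (s : T ⟶ A' ⨿ B') (hs : (j₂ ≫ s) ≫ k = b ≫ i₂) :
            I.map j₂ ≫ I.map s ≫ I.map d ≫ π = I.map b ≫ g := by
          obtain ⟨m, hm, hm'⟩ : ∃ m, m ≫ coprod.inr = j₂ ≫ s ∧ m ≫ e₂ = b :=
            ⟨sq.lift _ _ hs, sq.lift_fst _ _ _, sq.lift_snd _ _ _⟩
          rw [← I.map_comp_assoc, ← I.map_comp_assoc, ← hm, Category.assoc, hd₂, I.map_comp_assoc,
            hg', ← I.map_comp_assoc, hm']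
        rw [key s (by simpa using hb), key s' (by rw [Category.assoc, ← hs, hb])])
  have := epi_map (I := I) he₁
  have := epi_map (I := I) he₂
  refine ⟨l, ?_, ?_⟩
  · rw [← cancel_epi (I.map e₁), ← I.map_comp_assoc, ← hk₁, I.map_comp_assoc, hl,
      ← I.map_comp_assoc, hd₁, hf']
  · rw [← cancel_epi (I.map e₂), ← I.map_comp_assoc, ← hk₂, I.map_comp_assoc, hl,
      ← I.map_comp_assoc, hd₂, hg']

variable (J I) in
omit [HasFiniteLimits C] [IsCovering J] [FinitaryExtensive C] in
theorem exists_cover' (X : D) : ∃ (A R : C) (p₁ p₂ : R ⟶ A) (π : I.obj A ⟶ X), LocSurj J I π ∧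
    ∀ {T : C} (a a' : T ⟶ A), I.map a ≫ π = I.map a' ≫ π ↔
      ∃ r : T ⟶ R, r ≫ p₁ = a ∧ r ≫ p₂ = a' := by
  obtain ⟨P, π, hπ, hP⟩ := exists_cover (J := J) (I := I) X
  exact ⟨P.A, P.R, P.p₁, P.p₂, π, hπ, hP⟩

variable (J I) in
/-- Binary coproducts exist, and are covered by binary coproducts in `C`. -/
theorem exists_isSum (X Y : D) : ∃ (S : D) (j₁ : X ⟶ S) (j₂ : Y ⟶ S) (A B : C) (a : I.obj A ⟶ X)
    (b : I.obj B ⟶ Y) (π : I.obj (A ⨿ B) ⟶ S), IsSum j₁ j₂ ∧ LocSurj J I a ∧ LocSurj J I b ∧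
    LocSurj J I π ∧ I.map coprod.inl ≫ π = a ≫ j₁ ∧ I.map coprod.inr ≫ π = b ≫ j₂ ∧
    (∀ {T : C} (x x' : I.obj T ⟶ X), x ≫ j₁ = x' ≫ j₁ → x = x') ∧
    (∀ {T : C} (y y' : I.obj T ⟶ Y), y ≫ j₂ = y' ≫ j₂ → y = y') := by
  obtain ⟨A, R, p₁, p₂, a, ha, hA⟩ := exists_cover' J I X
  obtain ⟨B, R', p₁', p₂', b, hb, hB⟩ := exists_cover' J I Y
  have hS := isSum_coprod A B
  have := hS.mono_inl
  have := hS.mono_inr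
  have hS₁ := isSum_coprod (⊤_ C) (⊤_ C)
  -- `c` records the summand of an element; the squares `sq₁` and `sq₂` then lift an element whose
  -- summand is known to that summand.
  obtain ⟨c, hc₁, hc₂⟩ := hS.exists_desc (terminal.from A ≫ (coprod.inl : _ ⟶ (⊤_ C) ⨿ (⊤_ C)))
    (terminal.from B ≫ coprod.inr)
  have sq₁ := hS₁.isPullback_inl hS hc₁ hc₂
  have sq₂ := hS₁.isPullback_inr hS hc₁ hc₂
  -- Two elements are related if they lie in the same summand and have the same image in `X` or in
  -- `Y`. Quantifying over later stages avoids choosing a decomposition; that `R ⨿ R'` represents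
  -- the relation is `hqr`.
  let r : ∀ ⦃T : C⦄, (T ⟶ A ⨿ B) → (T ⟶ A ⨿ B) → Prop := fun T s s' ↦ s ≫ c = s' ≫ c ∧
    (∀ {T' : C} (e : T' ⟶ T) (x x' : T' ⟶ A), e ≫ s = x ≫ coprod.inl → e ≫ s' = x' ≫ coprod.inl →
      I.map x ≫ a = I.map x' ≫ a) ∧
    (∀ {T' : C} (e : T' ⟶ T) (x x' : T' ⟶ B), e ≫ s = x ≫ coprod.inr → e ≫ s' = x' ≫ coprod.inr →
      I.map x ≫ b = I.map x' ≫ b)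
  have lift₁ {T : C} (s : T ⟶ A ⨿ B) (t : T ⟶ A) (s' : T ⟶ A ⨿ B) (h : s ≫ c = s' ≫ c)
      (h' : s = t ≫ coprod.inl) : ∃ t', s' = t' ≫ coprod.inl :=
    ⟨sq₁.lift s' (terminal.from T) (by rw [← h, h', Category.assoc, hc₁]; simp),
      (sq₁.lift_fst _ _ _).symm⟩
  have lift₂ {T : C} (s : T ⟶ A ⨿ B) (t : T ⟶ B) (s' : T ⟶ A ⨿ B) (h : s ≫ c = s' ≫ c)
      (h' : s = t ≫ coprod.inr) : ∃ t', s' = t' ≫ coprod.inr :=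
    ⟨sq₂.lift s' (terminal.from T) (by rw [← h, h', Category.assoc, hc₂]; simp),
      (sq₂.lift_fst _ _ _).symm⟩
  have hr (T : C) : Equivalence (r (T := T)) := by
    refine ⟨fun s ↦ ⟨rfl, fun e x x' h h' ↦ ?_, fun e x x' h h' ↦ ?_⟩,
      fun h ↦ ⟨h.1.symm, fun e x x' k k' ↦ (h.2.1 e x' x k' k).symm,
        fun e x x' k k' ↦ (h.2.2 e x' x k' k).symm⟩,
      fun {s s' s''} h h' ↦ ⟨h.1.trans h'.1, fun e x x' k k' ↦ ?_, fun e x x' k k' ↦ ?_⟩⟩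
    · rw [(cancel_mono _).1 (h.symm.trans h')]
    · rw [(cancel_mono _).1 (h.symm.trans h')]
    · obtain ⟨x'', hx⟩ := lift₁ (e ≫ s) x (e ≫ s') (by simp [h.1]) k
      exact (h.2.1 e x x'' k hx).trans (h'.2.1 e x'' x' hx k')
    · obtain ⟨x'', hx⟩ := lift₂ (e ≫ s) x (e ≫ s') (by simp [h.1]) k
      exact (h.2.2 e x x'' k hx).trans (h'.2.2 e x'' x' hx k')
  have hR := isSum_coprod R R'
  obtain ⟨q₁, hq₁, hq₁'⟩ := hR.exists_desc (p₁ ≫ coprod.inl) (p₁' ≫ (coprod.inr : _ ⟶ A ⨿ B))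
  obtain ⟨q₂, hq₂, hq₂'⟩ := hR.exists_desc (p₂ ≫ coprod.inl) (p₂' ≫ (coprod.inr : _ ⟶ A ⨿ B))
  have hqr : IsRepr fun T (v : T ⟶ (A ⨿ B) ⨯ (A ⨿ B)) ↦ r (v ≫ prod.fst) (v ≫ prod.snd) := by
    have hrep : IsRepr fun T (v : T ⟶ (A ⨿ B) ⨯ (A ⨿ B)) ↦ ∃ t, t ≫ prod.lift q₁ q₂ = v :=
      ⟨_, _, fun _ _ ↦ Iff.rfl⟩
    refine hrep.congr fun T v ↦ ⟨fun h ↦ ?_, ?_⟩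
    · obtain ⟨T₁, T₂, j₁, j₂, x, y, hj, hx, hy⟩ := hS.exists_decomposition (v ≫ prod.fst)
      refine hrep.of_isSum hj ?_ ?_
      · obtain ⟨x', hx'⟩ := lift₁ _ x (j₁ ≫ v ≫ prod.snd) (by simpa using congrArg (j₁ ≫ ·) h.1) hx
        obtain ⟨t, ht, ht'⟩ := (hA _ _).1 (h.2.1 j₁ x x' hx hx')
        refine ⟨t ≫ coprod.inl, ?_⟩
        ext
        · simp [hq₁, reassoc_of% ht, hx]
        · simp [hq₂, reassoc_of% ht', hx']
      · obtain ⟨x', hx'⟩ := lift₂ _ y (j₂ ≫ v ≫ prod.snd) (by simpa using congrArg (j₂ ≫ ·) h.1) hy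
        obtain ⟨t, ht, ht'⟩ := (hB _ _).1 (h.2.2 j₂ y x' hy hx')
        refine ⟨t ≫ coprod.inr, ?_⟩
        ext
        · simp [hq₁', reassoc_of% ht, hy]
        · simp [hq₂', reassoc_of% ht', hx']
    · rintro ⟨t, rfl⟩
      simp only [Category.assoc, prod.lift_fst, prod.lift_snd]
      refine ⟨?_, fun e x x' h h' ↦ ?_, fun e x x' h h' ↦ ?_⟩
      · have : q₁ ≫ c = q₂ ≫ c := hR.hom_ext
          (by rw [reassoc_of% hq₁, reassoc_of% hq₂, hc₁]; simp)
          (by rw [reassoc_of% hq₁', reassoc_of% hq₂', hc₂]; simp)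
        simp [this]
      · have sq := hS.isPullback_inl hR hq₁ hq₁'
        have k := sq.lift_fst (e ≫ t) x (by simpa using h)
        refine (hA _ _).2 ⟨sq.lift (e ≫ t) x (by simpa using h), sq.lift_snd _ _ _, ?_⟩
        rw [← cancel_mono (coprod.inl : A ⟶ A ⨿ B), ← h', Category.assoc, ← hq₂, reassoc_of% k]
      · have sq := hS.isPullback_inr hR hq₁ hq₁'
        have k := sq.lift_fst (e ≫ t) x (by simpa using h)
        refine (hB _ _).2 ⟨sq.lift (e ≫ t) x (by simpa using h), sq.lift_snd _ _ _, ?_⟩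
        rw [← cancel_mono (coprod.inr : B ⟶ A ⨿ B), ← h', Category.assoc, ← hq₂', reassoc_of% k]
  obtain ⟨S, π, hπ, hrS⟩ := exists_quotient' J (I := I) (A := A ⨿ B) r hr hqr
    (fun T T' s s' e he h ↦ by
      refine ⟨?_, fun e' x x' k k' ↦ ?_, fun e' x x' k k' ↦ ?_⟩
      · have := epi_map (I := I) he
        refine map_injective (I := I) J ?_
        rw [← cancel_epi (I.map e), ← I.map_comp, ← I.map_comp]
        simpa using congrArg I.map h.1
      · have := epi_map (I := I) (IsCovering.pullback_fst e' e he)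
        have := h.2.1 (pullback.snd e' e) (pullback.fst e' e ≫ x) (pullback.fst e' e ≫ x')
          (by rw [← pullback.condition_assoc, k, Category.assoc])
          (by rw [← pullback.condition_assoc, k', Category.assoc])
        simpa [cancel_epi] using this
      · have := epi_map (I := I) (IsCovering.pullback_fst e' e he)
        have := h.2.2 (pullback.snd e' e) (pullback.fst e' e ≫ x) (pullback.fst e' e ≫ x')
          (by rw [← pullback.condition_assoc, k, Category.assoc])
          (by rw [← pullback.condition_assoc, k', Category.assoc])
        simpa [cancel_epi] using this)
  have r_inl {T : C} (x x' : T ⟶ A) : r (x ≫ coprod.inl) (x' ≫ coprod.inl) ↔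
      I.map x ≫ a = I.map x' ≫ a := by
    refine ⟨fun h ↦ h.2.1 (𝟙 T) x x' (by simp) (by simp), fun h ↦ ⟨?_, fun e y y' k k' ↦ ?_,
      fun e y y' k k' ↦ ?_⟩⟩
    · simp [hc₁]
    · rw [← Category.assoc, cancel_mono] at k k'
      subst k k'
      simp [h]
    · rw [← Category.assoc] at k
      obtain ⟨hT⟩ := nonempty_isInitial_map (I := I) J (hS.isInitial_of_eq k).some
      exact hT.hom_ext _ _
  have r_inr {T : C} (x x' : T ⟶ B) : r (x ≫ coprod.inr) (x' ≫ coprod.inr) ↔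
      I.map x ≫ b = I.map x' ≫ b := by
    refine ⟨fun h ↦ h.2.2 (𝟙 T) x x' (by simp) (by simp), fun h ↦ ⟨?_, fun e y y' k k' ↦ ?_,
      fun e y y' k k' ↦ ?_⟩⟩
    · simp [hc₂]
    · rw [← Category.assoc] at k
      obtain ⟨hT⟩ := nonempty_isInitial_map (I := I) J (hS.isInitial_of_eq k.symm).some
      exact hT.hom_ext _ _
    · rw [← Category.assoc, cancel_mono] at k k'
      subst k k'
      simp [h]
  obtain ⟨j₁, hj₁, -⟩ := existsUnique_desc a ha (I.map coprod.inl ≫ π) (fun x x' h ↦ by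
    rw [← I.map_comp_assoc, ← I.map_comp_assoc, hrS, r_inl, h])
  obtain ⟨j₂, hj₂, -⟩ := existsUnique_desc b hb (I.map coprod.inr ≫ π) (fun x x' h ↦ by
    rw [← I.map_comp_assoc, ← I.map_comp_assoc, hrS, r_inr, h])
  have := ha.epi
  have := hb.epi
  have := hπ.epi
  refine ⟨S, j₁, j₂, A, B, a, b, π, IsSum.mk' (fun {Z} f g ↦ ?_) (fun {Z f g} h₁ h₂ ↦ ?_), ha, hb,
    hπ, hj₁.symm, hj₂.symm, fun x x' h ↦ ?_, fun x x' h ↦ ?_⟩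
  · obtain ⟨k, hk₁, hk₂⟩ := (hS.map (I := I) J).exists_desc (a ≫ f) (b ≫ g)
    obtain ⟨l, hl, -⟩ := existsUnique_desc π hπ k (fun s s' h ↦ by
      have h := (hrS s s').1 h
      obtain ⟨T₁, T₂, i₁, i₂, x, y, hi, hx, hy⟩ := hS.exists_decomposition s
      refine hi.map_hom_ext J ?_ ?_
      · obtain ⟨x', hx'⟩ := lift₁ _ x (i₁ ≫ s') (by simpa using congrArg (i₁ ≫ ·) h.1) hx
        rw [← I.map_comp_assoc, ← I.map_comp_assoc, hx, hx', I.map_comp_assoc, I.map_comp_assoc,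
          hk₁, reassoc_of% (h.2.1 i₁ x x' hx hx')]
      · obtain ⟨x', hx'⟩ := lift₂ _ y (i₂ ≫ s') (by simpa using congrArg (i₂ ≫ ·) h.1) hy
        rw [← I.map_comp_assoc, ← I.map_comp_assoc, hy, hx', I.map_comp_assoc, I.map_comp_assoc,
          hk₂, reassoc_of% (h.2.2 i₂ y x' hy hx')])
    exact ⟨l, by rw [← cancel_epi a, reassoc_of% hj₁, hl, hk₁],
      by rw [← cancel_epi b, reassoc_of% hj₂, hl, hk₂]⟩
  · rw [← cancel_epi π]
    refine hS.map_hom_ext J ?_ ?_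
    · rw [← reassoc_of% hj₁, ← reassoc_of% hj₁, h₁]
    · rw [← reassoc_of% hj₂, ← reassoc_of% hj₂, h₂]
  · obtain ⟨T₁, e₁, y, he₁, hy⟩ := exists_lift ha x
    obtain ⟨T₂, e₂, y', he₂, hy'⟩ := exists_lift ha (I.map e₁ ≫ x')
    have := epi_map (I := I) he₁
    have := epi_map (I := I) he₂
    rw [← cancel_epi (I.map e₁), ← cancel_epi (I.map e₂), ← hy', ← hy, ← I.map_comp_assoc,
      ← r_inl, ← hrS]
    simp only [I.map_comp, Category.assoc, ← hj₁, reassoc_of% hy, reassoc_of% hy', h]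
  · obtain ⟨T₁, e₁, y, he₁, hy⟩ := exists_lift hb x
    obtain ⟨T₂, e₂, y', he₂, hy'⟩ := exists_lift hb (I.map e₁ ≫ x')
    have := epi_map (I := I) he₁
    have := epi_map (I := I) he₂
    rw [← cancel_epi (I.map e₁), ← cancel_epi (I.map e₂), ← hy', ← hy, ← I.map_comp_assoc,
      ← r_inr, ← hrS]
    simp only [I.map_comp, Category.assoc, ← hj₂, reassoc_of% hy, reassoc_of% hy', h]

end IsExactCompletion

end

/-! ### Finite coproducts and extensivity of an exact completion -/

section

variable {C : Type*} [Category* C] {D : Type*} [Category* D]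

theorem IsSum.hasColimit {A B S : C} {i₁ : A ⟶ S} {i₂ : B ⟶ S} (h : IsSum i₁ i₂) :
    HasColimit (pair A B) :=
  ⟨⟨⟨_, h.some⟩⟩⟩

theorem preservesFiniteCoproducts_of_isSum [HasFiniteCoproducts C] (F : C ⥤ D)
    (hi : Nonempty (IsInitial (F.obj (⊥_ C))))
    (hs : ∀ {A B : C}, IsSum (F.map (coprod.inl : A ⟶ A ⨿ B)) (F.map coprod.inr)) :
    PreservesFiniteCoproducts F := by
  have : PreservesColimit (Functor.empty.{0} C) F := by
    have : HasInitial D := hi.some.hasInitial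
    exact preservesInitial_of_iso F (initialIsInitial.uniqueUpToIso hi.some)
  have := preservesColimitsOfShape_pempty_of_preservesInitial F
  have : PreservesColimitsOfShape (Discrete WalkingPair) F := by
    refine ⟨fun {K} ↦ ?_⟩
    have : PreservesColimit (pair (K.obj ⟨.left⟩) (K.obj ⟨.right⟩)) F :=
      preservesColimit_of_preserves_colimit_cocone (coprodIsCoprod _ _)
        ((isColimitMapCoconeBinaryCofanEquiv F _ _).symm hs.some)
    exact preservesColimit_of_iso_diagram F (diagramIsoPair K).symm
  exact ⟨fun n ↦ PreservesFiniteCoproducts.of_preserves_binary_and_initial F (Fin n)⟩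

theorem IsSum.map_of_preserves [HasFiniteCoproducts C] (F : C ⥤ D) [PreservesFiniteCoproducts F]
    {A B S : C} {i₁ : A ⟶ S} {i₂ : B ⟶ S} (h : IsSum i₁ i₂) : IsSum (F.map i₁) (F.map i₂) :=
  ⟨isColimitMapCoconeBinaryCofanEquiv F _ _ (isColimitOfPreserves F h.some)⟩

namespace IsExactCompletion

variable [HasFiniteLimits C] {J : MorphismProperty C} [IsCovering J] {I : C ⥤ D}
  [IsExactCompletion J I] [FinitaryExtensive C]
include J I

variable (J I) in
theorem hasFiniteCoproducts : HasFiniteCoproducts D := by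
  have : HasInitial D := (nonempty_isInitial_map (I := I) J initialIsInitial).some.hasInitial
  have : HasBinaryCoproducts D := by
    refine @hasBinaryCoproducts_of_hasColimit_pair D _ fun {X Y} ↦ ?_
    obtain ⟨S, j₁, j₂, -, -, -, -, -, h, -⟩ := exists_isSum J I X Y
    exact h.hasColimit
  exact hasFiniteCoproducts_of_has_binary_and_initial

variable (J I) in
theorem preservesFiniteCoproducts : PreservesFiniteCoproducts I :=
  preservesFiniteCoproducts_of_isSum I (nonempty_isInitial_map J initialIsInitial)
    ((isSum_coprod _ _).map J)

variable (J I) in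
theorem exists_cover_of_isSum {X Y S : D} {j₁ : X ⟶ S} {j₂ : Y ⟶ S} (h : IsSum j₁ j₂) :
    ∃ (A B : C) (a : I.obj A ⟶ X) (b : I.obj B ⟶ Y) (π : I.obj (A ⨿ B) ⟶ S), LocSurj J I π ∧
      I.map coprod.inl ≫ π = a ≫ j₁ ∧ I.map coprod.inr ≫ π = b ≫ j₂ ∧
      (∀ {T : C} (x x' : I.obj T ⟶ X), x ≫ j₁ = x' ≫ j₁ → x = x') := by
  obtain ⟨S', k₁, k₂, A, B, a, b, π, h', -, -, hπ, h₁, h₂, hk, -⟩ := exists_isSum J I X Y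
  obtain ⟨d, hd₁, hd₂⟩ := h'.exists_desc j₁ j₂
  obtain ⟨d', hd₁', hd₂'⟩ := h.exists_desc k₁ k₂
  have : IsIso d := ⟨d', h'.hom_ext (by rw [reassoc_of% hd₁, hd₁', Category.comp_id])
    (by rw [reassoc_of% hd₂, hd₂', Category.comp_id]),
    h.hom_ext (by rw [reassoc_of% hd₁', hd₁, Category.comp_id])
    (by rw [reassoc_of% hd₂', hd₂, Category.comp_id])⟩
  refine ⟨A, B, a, b, π ≫ d, hπ.comp .of_isIso, ?_, ?_, fun x x' hx ↦ hk _ _ ?_⟩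
  · rw [reassoc_of% h₁, hd₁]
  · rw [reassoc_of% h₂, hd₂]
  · rw [← hd₁', reassoc_of% hx]

variable (J) in
-- An element of `Z` lying over `A` lifts locally to `A' ⨿ B'`, which splits the stage. The part
-- over `B'` would lie over both summands of `S`, so it is initial, and the element comes from `X`.
theorem isPullback_of_isSum {A B S : C} {X Y Z : D} {i₁ : A ⟶ S} {i₂ : B ⟶ S}
    (h : IsSum i₁ i₂) {j₁ : X ⟶ Z} {j₂ : Y ⟶ Z} (h' : IsSum j₁ j₂) {f : X ⟶ I.obj A}
    {g : Y ⟶ I.obj B} {k : Z ⟶ I.obj S} (h₁ : j₁ ≫ k = f ≫ I.map i₁)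
    (h₂ : j₂ ≫ k = g ≫ I.map i₂) : IsPullback j₁ f k (I.map i₁) := by
  obtain ⟨A', B', a, b, π, hπ, ha, hb, hj⟩ := exists_cover_of_isSum J I h'
  refine isPullback_of_elements J I h₁ (fun {T} x y hxy ↦ ?_) fun z z' hz _ ↦ hj _ _ hz
  obtain ⟨T', e, s, he, hs⟩ := exists_lift hπ x
  obtain ⟨T₁, T₂, l₁, l₂, c, d, hl, hc, hd⟩ := (isSum_coprod A' B').exists_decomposition s
  obtain ⟨y, rfl⟩ := exists_map_eq J y
  have hi : Nonempty (IsInitial T₂) := by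
    obtain ⟨m, hm⟩ := exists_map_eq J (I.map d ≫ b ≫ g)
    refine h.isInitial_of_eq (a := l₂ ≫ e ≫ y) (b := m) (map_injective (I := I) J ?_)
    have : I.map (m ≫ i₂) = I.map d ≫ b ≫ g ≫ I.map i₂ := by
      rw [I.map_comp, hm, Category.assoc, Category.assoc]
    rw [this, ← h₂, ← reassoc_of% hb, ← I.map_comp_assoc, ← hd]
    simp only [I.map_comp, Category.assoc, reassoc_of% hs, hxy]
  obtain ⟨hi⟩ := nonempty_isInitial_map (I := I) J hi.some
  obtain ⟨z, hz₁, -⟩ := (hl.map (I := I) J).exists_desc (I.map c ≫ a) (hi.to X)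
  have hz : z ≫ j₁ = I.map e ≫ x := by
    refine hl.map_hom_ext J ?_ (hi.hom_ext _ _)
    rw [reassoc_of% hz₁, ← ha, ← I.map_comp_assoc, ← hc, I.map_comp_assoc, hs]
  obtain ⟨w, hw⟩ := exists_glue he z j₁ x hz hj
  have : Mono (I.map i₁) := by
    have := h.mono_inl
    have := preservesFiniteLimits J I
    infer_instance
  refine ⟨w, hw, ?_⟩
  rw [← cancel_mono (I.map i₁), ← hxy, ← hw, Category.assoc, Category.assoc, h₁]

variable (J) in
-- A cover of `Z` by an object of `C` is split by its map to `S`, and the two parts map to `X` and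
-- `Y`. Maps out of `X` and `Y` are combined on this cover and descend to `Z`.
theorem isSum_of_isPullback {A B S : C} {X Y Z : D} {i₁ : A ⟶ S} {i₂ : B ⟶ S}
    (h : IsSum i₁ i₂) {j₁ : X ⟶ Z} {j₂ : Y ⟶ Z} {f : X ⟶ I.obj A} {g : Y ⟶ I.obj B}
    {k : Z ⟶ I.obj S} (h₁ : IsPullback j₁ f k (I.map i₁)) (h₂ : IsPullback j₂ g k (I.map i₂)) :
    IsSum j₁ j₂ := by
  have := h.mono_inl
  have := h.mono_inr
  have := preservesFiniteLimits J I
  have hj₁ : Mono j₁ := PullbackCone.mono_fst_of_is_pullback_of_mono h₁.isLimit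
  have hj₂ : Mono j₂ := PullbackCone.mono_fst_of_is_pullback_of_mono h₂.isLimit
  obtain ⟨P, π, hπ, -⟩ := exists_cover (J := J) (I := I) Z
  obtain ⟨t, ht⟩ := exists_map_eq J (π ≫ k)
  obtain ⟨E₁, E₂, l₁, l₂, a, b, hl, ha, hb⟩ := h.exists_decomposition t
  obtain ⟨u₁, hu₁⟩ : ∃ u, u ≫ j₁ = I.map l₁ ≫ π :=
    ⟨h₁.lift (I.map l₁ ≫ π) (I.map a) (by rw [Category.assoc, ← ht, ← I.map_comp, ha, I.map_comp]),
      h₁.lift_fst _ _ _⟩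
  obtain ⟨u₂, hu₂⟩ : ∃ u, u ≫ j₂ = I.map l₂ ≫ π :=
    ⟨h₂.lift (I.map l₂ ≫ π) (I.map b) (by rw [Category.assoc, ← ht, ← I.map_comp, hb, I.map_comp]),
      h₂.lift_fst _ _ _⟩
  have := hπ.epi
  refine IsSum.mk' (fun {W} p q ↦ ?_) fun {W x y} hx hy ↦ ?_
  · obtain ⟨m, hm₁, hm₂⟩ := (hl.map (I := I) J).exists_desc (u₁ ≫ p) (u₂ ≫ q)
    obtain ⟨d, hd, -⟩ := existsUnique_desc π hπ m (fun {T} s s' hs ↦ by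
      have hst : s ≫ t = s' ≫ t := map_injective (I := I) J (by
        rw [I.map_comp, I.map_comp, ht, reassoc_of% hs])
      obtain ⟨T₁, T₂, n₁, n₂, c, d, hn, hc, hd⟩ := h.exists_decomposition (s ≫ t)
      refine hn.map_hom_ext J ?_ ?_
      · have sq := h.isPullback_inl hl ha hb
        have key (s : T ⟶ P.A) (hs : n₁ ≫ s ≫ t = c ≫ i₁) : ∃ v : T₁ ⟶ E₁, v ≫ l₁ = n₁ ≫ s :=
          ⟨sq.lift (n₁ ≫ s) c (by simpa using hs), sq.lift_fst _ _ _⟩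
        obtain ⟨v, hv⟩ := key s hc
        obtain ⟨v', hv'⟩ := key s' (by rw [← hst, hc])
        have : I.map v ≫ u₁ = I.map v' ≫ u₁ := by
          rw [← cancel_mono j₁, Category.assoc, Category.assoc, hu₁, ← I.map_comp_assoc,
            ← I.map_comp_assoc, hv, hv', I.map_comp_assoc, hs, I.map_comp_assoc]
        rw [← I.map_comp_assoc, ← I.map_comp_assoc, ← hv, ← hv', I.map_comp_assoc,
          I.map_comp_assoc, hm₁, reassoc_of% this]
      · have sq := h.isPullback_inr hl ha hb
        have key (s : T ⟶ P.A) (hs : n₂ ≫ s ≫ t = d ≫ i₂) : ∃ v : T₂ ⟶ E₂, v ≫ l₂ = n₂ ≫ s :=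
          ⟨sq.lift (n₂ ≫ s) d (by simpa using hs), sq.lift_fst _ _ _⟩
        obtain ⟨v, hv⟩ := key s hd
        obtain ⟨v', hv'⟩ := key s' (by rw [← hst, hd])
        have : I.map v ≫ u₂ = I.map v' ≫ u₂ := by
          rw [← cancel_mono j₂, Category.assoc, Category.assoc, hu₂, ← I.map_comp_assoc,
            ← I.map_comp_assoc, hv, hv', I.map_comp_assoc, hs, I.map_comp_assoc]
        rw [← I.map_comp_assoc, ← I.map_comp_assoc, ← hv, ← hv', I.map_comp_assoc,
          I.map_comp_assoc, hm₂, reassoc_of% this])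
    refine ⟨d, ?_, ?_⟩
    · refine hom_ext J I fun {T} x ↦ ?_
      obtain ⟨T', e, z, he, hz⟩ := exists_lift hπ (x ≫ j₁)
      obtain ⟨x', hx'⟩ := exists_map_eq J (I.map e ≫ x ≫ f)
      have sq := h.isPullback_inl hl ha hb
      obtain ⟨v, hv⟩ : ∃ v : T' ⟶ E₁, v ≫ l₁ = z :=
        ⟨sq.lift z x' (map_injective (I := I) J (by
          rw [I.map_comp, I.map_comp, hx', ht, reassoc_of% hz, h₁.w]; simp)), sq.lift_fst _ _ _⟩
      have hvu : I.map v ≫ u₁ = I.map e ≫ x := by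
        rw [← cancel_mono j₁, Category.assoc, hu₁, ← I.map_comp_assoc, hv, hz, Category.assoc]
      have := epi_map (I := I) he
      rw [← cancel_epi (I.map e), ← (reassoc_of% hvu) p, ← hm₁, ← I.map_comp_assoc, hv,
        ← hd, reassoc_of% hz]
    · refine hom_ext J I fun {T} x ↦ ?_
      obtain ⟨T', e, z, he, hz⟩ := exists_lift hπ (x ≫ j₂)
      obtain ⟨x', hx'⟩ := exists_map_eq J (I.map e ≫ x ≫ g)
      have sq := h.isPullback_inr hl ha hb
      obtain ⟨v, hv⟩ : ∃ v : T' ⟶ E₂, v ≫ l₂ = z :=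
        ⟨sq.lift z x' (map_injective (I := I) J (by
          rw [I.map_comp, I.map_comp, hx', ht, reassoc_of% hz, h₂.w]; simp)), sq.lift_fst _ _ _⟩
      have hvu : I.map v ≫ u₂ = I.map e ≫ x := by
        rw [← cancel_mono j₂, Category.assoc, hu₂, ← I.map_comp_assoc, hv, hz, Category.assoc]
      have := epi_map (I := I) he
      rw [← cancel_epi (I.map e), ← (reassoc_of% hvu) q, ← hm₂, ← I.map_comp_assoc, hv,
        ← hd, reassoc_of% hz]
  · rw [← cancel_epi π]
    refine hl.map_hom_ext J ?_ ?_
    · rw [← reassoc_of% hu₁, hx, reassoc_of% hu₁]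
    · rw [← reassoc_of% hu₂, hy, reassoc_of% hu₂]

variable (J I) in
-- It suffices that `1 ⨿ 1` is van Kampen, and this sum comes from `C`; therefore only sums over
-- objects in the image of `I` had to be considered.
theorem finitaryExtensive : FinitaryExtensive D := by
  have := hasFiniteLimits J I
  have := hasFiniteCoproducts J I
  have hs := isSum_coprod (⊤_ C) (⊤_ C)
  refine (finitaryExtensive_iff_of_isTerminal D _ (nonempty_isTerminal_map J I).some _
    (hs.map (I := I) J).some).2 ((BinaryCofan.isVanKampen_iff _).2
      fun {X Y} c f g k h₁ h₂ ↦ ⟨fun h ↦ ?_, fun h ↦ ?_⟩)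
  · have h : IsSum c.inl c.inr := ⟨h.some.ofIsoColimit (isoBinaryCofanMk c)⟩
    exact ⟨isPullback_of_isSum J hs h h₁.symm h₂.symm,
      isPullback_of_isSum J hs.symm h.symm h₂.symm h₁.symm⟩
  · exact ⟨(isSum_of_isPullback J hs h.1 h.2).some.ofIsoColimit (isoBinaryCofanMk c).symm⟩

end IsExactCompletion

end

/-! ### Simultaneous case distinction, and traces of recursions -/

section

variable {C : Type*} [Category* C] {D : Type*} [Category* D]

theorem ListAlg.eq_of_nil_cons {A L : C} {S S' : ListAlg A L} (h : S.nil = S'.nil)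
    (h' : ∀ {T : C} (a : T ⟶ A) (l : T ⟶ L), S.cons a l = S'.cons a l) : S = S' := by
  have h' : @S.cons = @S'.cons := by
    funext T a l
    exact h' a l
  cases S
  cases S'
  cases h
  cases h'
  rfl

theorem ListAlg.IsUniversal.isParamListObject [HasFiniteProducts C] {A L : C} {S : ListAlg A L}
    (hS : S.IsUniversal) :
    IsParamListObject (S.nil (⊤_ C)) (prod.fst : A ⨯ L ⟶ A) prod.snd (S.cons prod.fst prod.snd) := by
  rw [isParamListObject_iff]
  refine ⟨terminalIsTerminal, prodIsProd A L, ?_⟩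
  have h₁ {T : C} (a : T ⟶ A) (l : T ⟶ L) : fanLift (prodIsProd A L) a l = prod.lift a l :=
    fan_hom_ext (prodIsProd A L) (by simp) (by simp)
  have h₂ : ofMaps (nil := S.nil (⊤_ C)) (cons := S.cons prod.fst prod.snd) terminalIsTerminal
      (prodIsProd A L) = S := eq_of_nil_cons (funext fun T ↦ S.comp_nil _)
      fun a l ↦ (congrArg (· ≫ _) (h₁ a l)).trans (by simp)
  rw [h₂]
  exact fun {X Y} b g ↦ hS b g

theorem IsLocos.exists_isUniversal [IsLocos C] (A : C) :
    ∃ (L : C) (S : ListAlg A L), S.IsUniversal := by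
  obtain ⟨L, nil, cons, h⟩ := IsLocos.exists_list A
  obtain ⟨hT, hP, h⟩ := (isParamListObject_iff _ _ _ _).1 h
  exact ⟨L, _, h⟩

section

variable [HasFiniteLimits C] [FinitaryExtensive C]

/-- Simultaneous case distinction on two lists with the same image. -/
theorem ListAlg.IsUniversal.cases₂ {A L A₁ L₁ A₂ L₂ : C} {S : ListAlg A L} (hS : S.IsUniversal)
    {S₁ : ListAlg A₁ L₁} (hS₁ : S₁.IsUniversal) {S₂ : ListAlg A₂ L₂} (hS₂ : S₂.IsUniversal)
    {f₁ : A₁ ⟶ A} {φ₁ : L₁ ⟶ L} (h₁ : S₁.IsHom S f₁ φ₁) {f₂ : A₂ ⟶ A} {φ₂ : L₂ ⟶ L}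
    (h₂ : S₂.IsHom S f₂ φ₂) {V T : C} {Φ : ∀ ⦃T : C⦄, (T ⟶ V) → Prop} (hΦ : IsRepr Φ) (v : T ⟶ V)
    (l₁ : T ⟶ L₁) (l₂ : T ⟶ L₂) (hl : l₁ ≫ φ₁ = l₂ ≫ φ₂)
    (nil : ∀ {T' : C} (e : T' ⟶ T), e ≫ l₁ = S₁.nil T' → e ≫ l₂ = S₂.nil T' → Φ (e ≫ v))
    (cons : ∀ {T' : C} (e : T' ⟶ T) (a₁ : T' ⟶ A₁) (m₁ : T' ⟶ L₁) (a₂ : T' ⟶ A₂) (m₂ : T' ⟶ L₂),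
      e ≫ l₁ = S₁.cons a₁ m₁ → e ≫ l₂ = S₂.cons a₂ m₂ → a₁ ≫ f₁ = a₂ ≫ f₂ →
        m₁ ≫ φ₁ = m₂ ≫ φ₂ → Φ (e ≫ v)) : Φ v := by
  refine hS₁.cases hΦ v l₁ (fun e he ↦ ?_) fun e a₁ m₁ he ↦ ?_
  · refine hS₂.cases hΦ (e ≫ v) (e ≫ l₂) (fun e' he' ↦ ?_) fun e' a₂ m₂ he' ↦ ?_
    · rw [← Category.assoc]
      exact nil _ (by simp [he]) (by simpa using he')
    · have := congrArg ((e' ≫ e) ≫ ·) hl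
      simp only [Category.assoc, reassoc_of% he, reassoc_of% he', comp_nil, h₁.nil,
        h₂.cons] at this
      exact hΦ.of_isInitial (hS.isInitial_of_nil_eq_cons this) _
  · refine hS₂.cases hΦ (e ≫ v) (e ≫ l₂) (fun e' he' ↦ ?_) fun e' a₂ m₂ he' ↦ ?_
    · have := congrArg ((e' ≫ e) ≫ ·) hl
      simp only [Category.assoc, reassoc_of% he, reassoc_of% he', comp_cons, h₁.cons,
        h₂.nil] at this
      exact hΦ.of_isInitial (hS.isInitial_of_nil_eq_cons this.symm) _
    · have := congrArg ((e' ≫ e) ≫ ·) hl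
      simp only [Category.assoc, reassoc_of% he, reassoc_of% he', comp_cons, h₁.cons,
        h₂.cons] at this
      obtain ⟨k₁, k₂⟩ := hS.cons_injective this
      rw [← Category.assoc]
      exact cons _ (e' ≫ a₁) (e' ≫ m₁) a₂ m₂ (by simp [he]) (by simpa using he')
        (by rwa [Category.assoc]) (by rwa [Category.assoc])

end

namespace IsExactCompletion

variable [HasFiniteLimits C] [FinitaryExtensive C] {J : MorphismProperty C} [IsCovering J]
  {I : C ⥤ D} [IsExactCompletion J I] [HasFiniteLimits D]

section Trace

variable {A L B G Y₀ LG LY : C} {X Y : D} {S : ListAlg A L} (hS : S.IsUniversal)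
  {SG : ListAlg G LG} (hSG : SG.IsUniversal) {SY : ListAlg Y₀ LY} (hSY : SY.IsUniversal)
  {α : G ⟶ A} {mα : LG ⟶ L} (hα : SG.IsHom S α mα) {η : G ⟶ Y₀} {mη : LG ⟶ LY}
  (hη : SG.IsHom SY η mη) {β : B ⟶ Y₀} {w : G ⟶ Y₀} {ρ : B ⨯ LG ⟶ Y₀ ⨯ LY}
  (hρ : SG.IsRec (prod.lift β (SY.nil B))
    (prod.lift (prod.fst ≫ w) (SY.cons (prod.snd ≫ prod.fst) (prod.snd ≫ prod.snd))) ρ)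

include hρ in
omit [FinitaryExtensive C] in
theorem trace_nil {T : C} (x : T ⟶ B) :
    prod.lift x (SG.nil T) ≫ ρ = prod.lift (x ≫ β) (SY.nil T) := by
  rw [hρ.nil]
  simp

include hρ in
omit [FinitaryExtensive C] in
theorem trace_cons {T : C} (x : T ⟶ B) (γ : T ⟶ G) (t : T ⟶ LG) :
    prod.lift x (SG.cons γ t) ≫ ρ = prod.lift (γ ≫ w)
      (SY.cons (prod.lift x t ≫ ρ ≫ prod.fst) (prod.lift x t ≫ ρ ≫ prod.snd)) := by
  rw [hρ.cons]
  simp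

include hSY hη hρ in
-- Injectivity of `cons` separates the condition on the head from validity of the tail.
theorem of_trace_cons {T : C} {x : T ⟶ B} {γ : T ⟶ G} {t : T ⟶ LG}
    (h : prod.lift x (SG.cons γ t) ≫ ρ ≫ prod.snd = SG.cons γ t ≫ mη) :
    prod.lift x t ≫ ρ ≫ prod.fst = γ ≫ η ∧ prod.lift x t ≫ ρ ≫ prod.snd = t ≫ mη := by
  rw [← Category.assoc, trace_cons hρ, prod.lift_snd, hη.cons] at h
  exact hSY.cons_injective h

include J hS hSG hSY hα hη hρ in
-- By induction on pairs of valid traces over one list. The tails have equal values in `Y`, and by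
-- validity these are the values proposed by the heads; so the heads have the same image in `I.obj A
-- ⨯ Y`, and by `hw` the final values agree in `Y`. For empty traces, `hβ` reduces the claim to
-- equality of the starts in `X`.
theorem trace_singleValued {x : I.obj B ⟶ X} {b : X ⟶ Y} {g : I.obj A ⨯ Y ⟶ Y}
    {π : I.obj Y₀ ⟶ Y} (hβ : I.map β ≫ π = x ≫ b)
    (hw : I.map w ≫ π = prod.lift (I.map α) (I.map η ≫ π) ≫ g) {T : C} {v v' : T ⟶ B ⨯ LG}
    (hv : v ≫ ρ ≫ prod.snd = v ≫ prod.snd ≫ mη) (hv' : v' ≫ ρ ≫ prod.snd = v' ≫ prod.snd ≫ mη)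
    (hx : I.map (v ≫ prod.fst) ≫ x = I.map (v' ≫ prod.fst) ≫ x)
    (hl : v ≫ prod.snd ≫ mα = v' ≫ prod.snd ≫ mα) :
    I.map (v ≫ ρ ≫ prod.fst) ≫ π = I.map (v' ≫ ρ ≫ prod.fst) ≫ π := by
  -- Equality of the starts holds only in `X`, so it cannot be part of an equaliser in `C`; `K`
  -- represents it instead.
  obtain ⟨K, k, hk⟩ := isRepr_eq J (V := B ⨯ B) (I.map prod.fst ≫ x) (I.map prod.snd ≫ x)
  obtain ⟨tl, tl_nil, tl_cons⟩ := hSG.exists_tail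
  have hkx {T : C} (κ : T ⟶ K) : I.map (κ ≫ k ≫ prod.fst) ≫ x = I.map (κ ≫ k ≫ prod.snd) ≫ x := by
    simpa using (hk (κ ≫ k)).2 ⟨κ, rfl⟩
  let u : K ⨯ (LG ⨯ LG) ⟶ B ⨯ LG := prod.lift (prod.fst ≫ k ≫ prod.fst) (prod.snd ≫ prod.fst)
  let u' : K ⨯ (LG ⨯ LG) ⟶ B ⨯ LG := prod.lift (prod.fst ≫ k ≫ prod.snd) (prod.snd ≫ prod.snd)
  have hu {T : C} (κ : T ⟶ K) (t t' : T ⟶ LG) :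
      prod.lift κ (prod.lift t t') ≫ u = prod.lift (κ ≫ k ≫ prod.fst) t := by simp [u]
  have hu' {T : C} (κ : T ⟶ K) (t t' : T ⟶ LG) :
      prod.lift κ (prod.lift t t') ≫ u' = prod.lift (κ ≫ k ≫ prod.snd) t' := by simp [u']
  -- `f` and `g'` agree exactly on the pairs of valid traces over the same list, as `hfg` says, and
  -- `p` removes the heads of both traces.
  let f : K ⨯ (LG ⨯ LG) ⟶ L ⨯ (LY ⨯ LY) := prod.lift (prod.snd ≫ prod.fst ≫ mα)
    (prod.lift (u ≫ ρ ≫ prod.snd) (u' ≫ ρ ≫ prod.snd))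
  let g' : K ⨯ (LG ⨯ LG) ⟶ L ⨯ (LY ⨯ LY) := prod.lift (prod.snd ≫ prod.snd ≫ mα)
    (prod.lift (prod.snd ≫ prod.fst ≫ mη) (prod.snd ≫ prod.snd ≫ mη))
  let p : K ⨯ (LG ⨯ LG) ⟶ K ⨯ (LG ⨯ LG) := prod.lift prod.fst
    (prod.lift (prod.snd ≫ prod.fst ≫ tl) (prod.snd ≫ prod.snd ≫ tl))
  have hfg {T : C} (κ : T ⟶ K) (t t' : T ⟶ LG) :
      prod.lift κ (prod.lift t t') ≫ f = prod.lift κ (prod.lift t t') ≫ g' ↔ t ≫ mα = t' ≫ mα ∧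
        prod.lift (κ ≫ k ≫ prod.fst) t ≫ ρ ≫ prod.snd = t ≫ mη ∧
        prod.lift (κ ≫ k ≫ prod.snd) t' ≫ ρ ≫ prod.snd = t' ≫ mη := by
    constructor
    · intro h
      have h₁ := congrArg (· ≫ prod.fst) h
      have h₂ := congrArg (· ≫ prod.snd ≫ prod.fst) h
      have h₃ := congrArg (· ≫ prod.snd ≫ prod.snd) h
      simp [f, g', reassoc_of% hu, reassoc_of% hu'] at h₁ h₂ h₃
      exact ⟨h₁, h₂, h₃⟩
    · rintro ⟨h₁, h₂, h₃⟩
      simp [f, g', reassoc_of% hu, reassoc_of% hu', h₁, h₂, h₃]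
  have hp {T : C} (κ : T ⟶ K) (t t' : T ⟶ LG) : prod.lift κ (prod.lift t t') ≫ p =
      prod.lift κ (prod.lift (t ≫ tl) (t' ≫ tl)) := by simp [p]
  have hq {T : C} (q : T ⟶ K ⨯ (LG ⨯ LG)) :
      ∃ (κ : T ⟶ K) (t t' : T ⟶ LG), q = prod.lift κ (prod.lift t t') :=
    ⟨q ≫ prod.fst, q ≫ prod.snd ≫ prod.fst, q ≫ prod.snd ≫ prod.snd, by ext <;> simp⟩
  have hval {T : C} {a a' : T ⟶ G} (h₁ : a ≫ α = a' ≫ α)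
      (h₂ : I.map (a ≫ η) ≫ π = I.map (a' ≫ η) ≫ π) :
      I.map (a ≫ w) ≫ π = I.map (a' ≫ w) ≫ π := by
    have h₁ := congrArg I.map h₁
    simp only [I.map_comp, Category.assoc] at h₁ h₂
    simp only [I.map_comp, Category.assoc, hw, prod.comp_lift_assoc, h₁, h₂]
  have hΦ := isRepr_eq J (I.map (u ≫ ρ ≫ prod.fst) ≫ π) (I.map (u' ≫ ρ ≫ prod.fst) ≫ π)
  have key {T : C} (q : T ⟶ K ⨯ (LG ⨯ LG)) (h : q ≫ f = q ≫ g') :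
      I.map q ≫ I.map (u ≫ ρ ≫ prod.fst) ≫ π = I.map q ≫ I.map (u' ≫ ρ ≫ prod.fst) ≫ π := by
    refine hSG.wellFounded_induction_on (f := f) (g := g') (prod.snd ≫ prod.fst) p
      (fun q h ↦ ?_) (fun q h hn ↦ ?_) (fun q a l h ↦ ?_) hΦ
      (fun q h hn ↦ ?_) (fun q a l h hc ih ↦ ?_) q h
    all_goals obtain ⟨κ, t, t', rfl⟩ := hq q
    · have h' := (hfg _ _ _).1 h
      refine hS.cases₂ hSG hSG hα hα (IsRepr.eq (p ≫ f) (p ≫ g')) _ t t' h'.1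
        (fun {T'} e ht ht' ↦ ?_) fun {T'} e a m a' m' ht ht' ha hm ↦ ?_
      · rw [prod.comp_lift, prod.comp_lift, ht, ht', reassoc_of% hp, reassoc_of% hp, hfg]
        simp only [tl_nil, reassoc_of% trace_nil hρ, hη.nil, prod.lift_snd, and_self]
      · rw [prod.comp_lift, prod.comp_lift, ht, ht', reassoc_of% hp, reassoc_of% hp, hfg]
        simp only [tl_cons]
        obtain ⟨-, k₁⟩ := of_trace_cons hSY hη hρ (x := e ≫ κ ≫ k ≫ prod.fst) (γ := a) (t := m) (by
          simpa [ht, reassoc_of% ht] using congrArg (e ≫ ·) h'.2.1)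
        obtain ⟨-, k₂⟩ := of_trace_cons hSY hη hρ (x := e ≫ κ ≫ k ≫ prod.snd) (γ := a') (t := m') (by
          simpa [ht', reassoc_of% ht'] using congrArg (e ≫ ·) h'.2.2)
        exact ⟨hm, by simpa using k₁, by simpa using k₂⟩
    · obtain rfl : t = SG.nil _ := by simpa using hn
      have h' := (hfg _ _ _).1 h
      refine (hS.cases₂ hSG hSG hα hα (IsRepr.eq p (𝟙 _)) _ _ t' h'.1
        (fun {T'} e ht ht' ↦ ?_) fun {T'} e a m a' m' ht ht' ha hm ↦ ?_).trans (Category.comp_id _)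
      · have : e ≫ prod.lift κ (prod.lift (SG.nil _) t') =
            prod.lift (e ≫ κ) (prod.lift (SG.nil T') (SG.nil T')) := by
          rw [prod.comp_lift, prod.comp_lift, ht, ht']
        rw [this, hp, tl_nil, Category.comp_id]
      · rw [SG.comp_nil] at ht
        exact (hSG.isInitial_of_nil_eq_cons ht).some.hom_ext _ _
    · obtain rfl : t = SG.cons a l := by simpa using h
      rw [reassoc_of% hp]
      simp [tl_cons]
    · obtain rfl : t = SG.nil _ := by simpa using hn
      have h' := (hfg _ _ _).1 h
      refine hS.cases₂ hSG hSG hα hα hΦ _ _ t' h'.1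
        (fun {T'} e ht ht' ↦ ?_) fun {T'} e a m a' m' ht ht' ha hm ↦ ?_
      · simp only [prod.comp_lift, ht, ht', ← I.map_comp_assoc, reassoc_of% hu, reassoc_of% hu',
          reassoc_of% trace_nil hρ, prod.lift_fst]
        simp only [I.map_comp, Category.assoc, hβ]
        simpa using congrArg (· ≫ b) (hkx (e ≫ κ))
      · rw [SG.comp_nil] at ht
        exact hΦ.of_isInitial (hSG.isInitial_of_nil_eq_cons ht) _
    · obtain rfl : t = SG.cons a l := by simpa using hc
      have h' := (hfg _ _ _).1 h
      refine hS.cases₂ hSG hSG hα hα hΦ _ _ t' h'.1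
        (fun {T'} e ht ht' ↦ ?_) fun {T'} e a m a' m' ht ht' ha hm ↦ ?_
      · rw [SG.comp_cons] at ht
        exact hΦ.of_isInitial (hSG.isInitial_of_nil_eq_cons ht.symm) _
      · obtain ⟨k₁, -⟩ := of_trace_cons hSY hη hρ (x := e ≫ κ ≫ k ≫ prod.fst) (γ := a) (t := m) (by
          simpa [ht, reassoc_of% ht] using congrArg (e ≫ ·) h'.2.1)
        obtain ⟨k₂, -⟩ := of_trace_cons hSY hη hρ (x := e ≫ κ ≫ k ≫ prod.snd) (γ := a') (t := m') (by
          simpa [ht', reassoc_of% ht'] using congrArg (e ≫ ·) h'.2.2)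
        have ih' := hΦ.precomp ih e
        simp only [hp, prod.comp_lift, ht, ht', tl_cons, ← I.map_comp_assoc, reassoc_of% hu,
          reassoc_of% hu', reassoc_of% trace_cons hρ, prod.lift_fst] at ih' ⊢
        have t₁ : e ≫ l = m := (hSG.cons_injective (by simpa using ht)).2
        have t₂ : e ≫ t' ≫ tl = m' := by rw [reassoc_of% ht', tl_cons]
        simp only [t₁, t₂, Category.assoc, k₁, k₂] at ih'
        exact hval ha ih'
  obtain ⟨κ, hκ⟩ := (hk (prod.lift (v ≫ prod.fst) (v' ≫ prod.fst))).1 (by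
    simp only [← I.map_comp_assoc, prod.lift_fst, prod.lift_snd, hx])
  have h₁ : prod.lift (κ ≫ k ≫ prod.fst) (v ≫ prod.snd) = v := by
    ext <;> simp [reassoc_of% hκ]
  have h₂ : prod.lift (κ ≫ k ≫ prod.snd) (v' ≫ prod.snd) = v' := by
    ext <;> simp [reassoc_of% hκ]
  have := key (prod.lift κ (prod.lift (v ≫ prod.snd) (v' ≫ prod.snd)))
    ((hfg _ _ _).2 ⟨by simpa using hl, by simpa [h₁] using hv, by simpa [h₂] using hv'⟩)
  simpa only [← I.map_comp_assoc, reassoc_of% hu, reassoc_of% hu', h₁, h₂] using this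

end Trace

end IsExactCompletion

end

/-! ### The canonical functor preserves list objects -/

section

variable {C : Type*} [Category* C] {D : Type*} [Category* D]

namespace IsExactCompletion

variable [IsLocos C] {J : MorphismProperty C} [IsCovering J]
  {I : C ⥤ D} [IsExactCompletion J I] [HasFiniteLimits D]
include J I

/-- The canonical functor preserves list objects. -/
theorem isUniversal_map {A L : C} {S : ListAlg A L} (hS : S.IsUniversal)
    {SI : ListAlg (I.obj A) (I.obj L)} (hnil : ∀ T : C, I.map (S.nil T) = SI.nil (I.obj T))
    (hcons : ∀ {T : C} (a : T ⟶ A) (l : T ⟶ L),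
      I.map (S.cons a l) = SI.cons (I.map a) (I.map l)) : SI.IsUniversal := by
  intro X Y b g
  obtain ⟨P, πX, hπX, -⟩ := exists_cover (J := J) (I := I) X
  -- The recursion equations need only be tested on parameters represented in `P.A` and on entries
  -- and lists from `C`.
  have isRec_mk {r : X ⨯ I.obj L ⟶ Y}
      (h₁ : ∀ {T : C} (x : T ⟶ P.A), prod.lift (I.map x ≫ πX) (I.map (S.nil T)) ≫ r =
        I.map x ≫ πX ≫ b)
      (h₂ : ∀ {T : C} (x : T ⟶ P.A) (a : T ⟶ A) (l : T ⟶ L),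
        prod.lift (I.map x ≫ πX) (I.map (S.cons a l)) ≫ r =
          prod.lift (I.map a) (prod.lift (I.map x ≫ πX) (I.map l) ≫ r) ≫ g) :
      SI.IsRec b g r := by
    refine ⟨fun x ↦ hom_ext J I fun {T} t ↦ ?_, fun x a l ↦ hom_ext J I fun {T} t ↦ ?_⟩
    · obtain ⟨T', e, x', he, hx'⟩ := exists_lift hπX (t ≫ x)
      have := epi_map (I := I) he
      rw [← cancel_epi (I.map e)]
      have := h₁ x'
      rw [hnil, reassoc_of% hx', hx'] at this
      simpa using this
    · obtain ⟨T', e, x', he, hx'⟩ := exists_lift hπX (t ≫ x)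
      have := epi_map (I := I) he
      rw [← cancel_epi (I.map e)]
      obtain ⟨a', ha'⟩ := exists_map_eq J (I.map e ≫ t ≫ a)
      obtain ⟨l', hl'⟩ := exists_map_eq J (I.map e ≫ t ≫ l)
      have := h₂ x' a' l'
      rw [hcons, hx', ha', hl'] at this
      simpa using this
  -- Uniqueness is induction over lists in `C`, applied to the representable predicate that `r` and
  -- `r'` agree.
  have ext {r r' : X ⨯ I.obj L ⟶ Y} (hr : SI.IsRec b g r) (hr' : SI.IsRec b g r') : r = r' := by
    have hκ {T : C} (x : T ⟶ P.A) (l : T ⟶ L) : I.map (prod.lift x l) ≫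
        prod.lift (I.map prod.fst ≫ πX) (I.map prod.snd) =
          prod.lift (I.map x ≫ πX) (I.map l) := by
      simp [← I.map_comp, ← I.map_comp_assoc]
    have key {T : C} (v : T ⟶ P.A ⨯ L) :
        I.map v ≫ prod.lift (I.map prod.fst ≫ πX) (I.map prod.snd) ≫ r =
          I.map v ≫ prod.lift (I.map prod.fst ≫ πX) (I.map prod.snd) ≫ r' := hS.induction
      (isRepr_eq J (prod.lift (I.map prod.fst ≫ πX) (I.map prod.snd) ≫ r)
        (prod.lift (I.map prod.fst ≫ πX) (I.map prod.snd) ≫ r'))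
      (fun x ↦ by rw [reassoc_of% hκ, reassoc_of% hκ, hnil, hr.nil, hr'.nil])
      (fun x a l ih ↦ by
        rw [reassoc_of% hκ, reassoc_of% hκ] at ih ⊢
        rw [hcons, hr.cons, hr'.cons, ih]) v
    refine hom_ext J I fun {T} v ↦ ?_
    obtain ⟨T', e, x, he, hx⟩ := exists_lift hπX (v ≫ prod.fst)
    obtain ⟨l, hl⟩ := exists_map_eq J (I.map e ≫ v ≫ prod.snd)
    have := epi_map (I := I) he
    have h := key (prod.lift x l)
    have hxl : prod.lift (I.map x ≫ πX) (I.map l) = I.map e ≫ v := by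
      rw [hx, hl]
      ext <;> simp
    rwa [reassoc_of% hκ, reassoc_of% hκ, hxl, Category.assoc, Category.assoc, cancel_epi] at h
  suffices h : ∃ r, SI.IsRec b g r by
    obtain ⟨r, hr⟩ := h
    exact ⟨r, hr, fun r' hr' ↦ ext hr' hr⟩
  obtain ⟨Q, πY, hπY, -⟩ := exists_cover (J := J) (I := I) Y
  -- The data `b` and `g` have representatives only over the covers `B` of `P.A` and `G` of `A ⨯
  -- Q.A`. Without sections of these covers there is no recursion in `C` to run, so traces over `G`
  -- are used.
  obtain ⟨B, eB, β, heB, hβ⟩ := exists_lift hπY (πX ≫ b)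
  obtain ⟨G, eG, w, heG, hw⟩ := exists_lift hπY
    (prod.lift (I.map (prod.fst : A ⨯ Q.A ⟶ A)) (I.map prod.snd ≫ πY) ≫ g)
  obtain ⟨LG, SG, hSG⟩ := IsLocos.exists_isUniversal G
  obtain ⟨LY, SY, hSY⟩ := IsLocos.exists_isUniversal Q.A
  obtain ⟨mα, hα⟩ := hSG.exists_isHom S (eG ≫ prod.fst)
  obtain ⟨mη, hη⟩ := hSG.exists_isHom SY (eG ≫ prod.snd)
  obtain ⟨ρ, hρ⟩ := hSG.exists_rec (prod.lift β (SY.nil B))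
    (prod.lift (prod.fst ≫ w) (SY.cons (prod.snd ≫ prod.fst) (prod.snd ≫ prod.snd)))
  -- The object of valid traces.
  let W : C := equalizer (ρ ≫ prod.snd) (prod.snd ≫ mη)
  let ι : W ⟶ B ⨯ LG := equalizer.ι (ρ ≫ prod.snd) (prod.snd ≫ mη)
  have hι : ι ≫ ρ ≫ prod.snd = ι ≫ prod.snd ≫ mη := equalizer.condition _ _
  have hW {T : C} (v : T ⟶ B ⨯ LG) (hv : v ≫ ρ ≫ prod.snd = v ≫ prod.snd ≫ mη) :
      ∃ t : T ⟶ W, t ≫ ι = v := ⟨equalizer.lift v hv, equalizer.lift_ι _ _⟩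
  have trace_nil {T : C} (x : T ⟶ B) : ∃ t : T ⟶ W, t ≫ ι = prod.lift x (SG.nil T) :=
    hW _ (by rw [reassoc_of% trace_nil hρ]; simp [hη.nil])
  have trace_cons {T : C} (t : T ⟶ W) (γ : T ⟶ G) (h : t ≫ ι ≫ ρ ≫ prod.fst = γ ≫ eG ≫ prod.snd) :
      (∃ t' : T ⟶ W, t' ≫ ι = prod.lift (t ≫ ι ≫ prod.fst) (SG.cons γ (t ≫ ι ≫ prod.snd))) ∧
      prod.lift (t ≫ ι ≫ prod.fst) (SG.cons γ (t ≫ ι ≫ prod.snd)) ≫ ρ ≫ prod.fst = γ ≫ w := by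
    have e : prod.lift (t ≫ ι ≫ prod.fst) (t ≫ ι ≫ prod.snd) = t ≫ ι := by ext <;> simp
    constructor
    · refine hW _ ?_
      rw [reassoc_of% trace_cons hρ, prod.lift_snd, e, prod.lift_snd_assoc, hη.cons]
      simp only [Category.assoc, h, hι]
    · rw [reassoc_of% trace_cons hρ, prod.lift_fst]
  -- Traces exist locally: each entry of the list requires a further cover, pulled back from `eG`,
  -- and the covers compose along the induction.
  have lift_locally {T : C} (v : T ⟶ P.A ⨯ L) :
      LiftsLocally J (ι ≫ prod.lift (prod.fst ≫ eB) (prod.snd ≫ mα)) v := by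
    refine hS.induction (isRepr_liftsLocally J _) (fun {T} x ↦ ?_) (fun {T} x a l ih ↦ ?_) v
    · obtain ⟨t, ht⟩ := trace_nil (pullback.snd x eB)
      refine ⟨_, pullback.fst x eB, t, IsCovering.pullback_fst _ _ heB, ?_⟩
      rw [reassoc_of% ht]
      simp [pullback.condition, hα.nil]
    · obtain ⟨T₁, e₁, t, he₁, ht⟩ := ih
      let c : T₁ ⟶ A ⨯ Q.A := prod.lift (e₁ ≫ a) (t ≫ ι ≫ ρ ≫ prod.fst)
      let e₂ := pullback.fst c eG
      let γ := pullback.snd c eG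
      have hγ : γ ≫ eG = e₂ ≫ c := pullback.condition.symm
      obtain ⟨⟨t', ht'⟩, -⟩ := trace_cons (e₂ ≫ t) γ (by rw [reassoc_of% hγ]; simp [c])
      have h₁ : t ≫ ι ≫ prod.fst ≫ eB = e₁ ≫ x := by simpa using congrArg (· ≫ prod.fst) ht
      have h₂ : t ≫ ι ≫ prod.snd ≫ mα = e₁ ≫ l := by simpa using congrArg (· ≫ prod.snd) ht
      refine ⟨_, e₂ ≫ e₁, t', IsCovering.comp_mem _ _ (IsCovering.pullback_fst _ _ heG) he₁, ?_⟩
      rw [reassoc_of% ht']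
      ext
      · simp [h₁]
      · simp [hα.cons, h₂, reassoc_of% hγ, c]
  have sv {T : C} (t t' : T ⟶ W)
      (hx : I.map (t ≫ ι ≫ prod.fst ≫ eB) ≫ πX = I.map (t' ≫ ι ≫ prod.fst ≫ eB) ≫ πX)
      (hl : t ≫ ι ≫ prod.snd ≫ mα = t' ≫ ι ≫ prod.snd ≫ mα) :
      I.map (t ≫ ι ≫ ρ ≫ prod.fst) ≫ πY = I.map (t' ≫ ι ≫ ρ ≫ prod.fst) ≫ πY := by
    have := trace_singleValued (J := J) (v := t ≫ ι) (v' := t' ≫ ι) hS hSG hSY hα hη hρ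
      (x := I.map eB ≫ πX) (g := g) (hβ.trans (Category.assoc _ _ _).symm)
      (hw.trans (by rw [prod.comp_lift_assoc, I.map_comp, I.map_comp, Category.assoc]))
      (by simp [hι]) (by simp [hι]) (by simpa using hx) (by simpa using hl)
    simpa using this
  let κ : I.obj W ⟶ X ⨯ I.obj L :=
    prod.lift (I.map (ι ≫ prod.fst ≫ eB) ≫ πX) (I.map (ι ≫ prod.snd ≫ mα))
  have hκ {T : C} (t : T ⟶ W) : I.map t ≫ κ = prod.lift (I.map (t ≫ ι ≫ prod.fst ≫ eB) ≫ πX)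
      (I.map (t ≫ ι ≫ prod.snd ≫ mα)) := by
    rw [prod.comp_lift, ← I.map_comp_assoc, ← I.map_comp]
  have hκs : LocSurj J I κ := ⟨fun {T} v ↦ by
    obtain ⟨T₁, e₁, x, he₁, hx⟩ := exists_lift hπX (v ≫ prod.fst)
    obtain ⟨l, hl⟩ := exists_map_eq J (I.map e₁ ≫ v ≫ prod.snd)
    obtain ⟨T₂, e₂, t, he₂, ht⟩ := lift_locally (prod.lift x l)
    have h₁ : t ≫ ι ≫ prod.fst ≫ eB = e₂ ≫ x := by simpa using congrArg (· ≫ prod.fst) ht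
    have h₂ : t ≫ ι ≫ prod.snd ≫ mα = e₂ ≫ l := by simpa using congrArg (· ≫ prod.snd) ht
    refine ⟨T₂, e₂ ≫ e₁, I.map t, IsCovering.comp_mem _ _ he₂ he₁, ?_⟩
    rw [hκ, h₁, h₂]
    ext
    · simp [hx]
    · simp [hl]⟩
  -- The final value of a trace depends in `Y` only on its start in `X` and on its underlying list,
  -- so it descends along the locally surjective `κ`.
  obtain ⟨r, hr, -⟩ := existsUnique_desc κ hκs (I.map (ι ≫ ρ ≫ prod.fst) ≫ πY) (fun t t' h ↦ by
    rw [hκ, hκ] at h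
    rw [← I.map_comp_assoc, ← I.map_comp_assoc]
    exact sv t t' (by simpa only [prod.lift_fst] using congrArg (· ≫ prod.fst) h)
      (map_injective (I := I) J (by simpa only [prod.lift_snd] using congrArg (· ≫ prod.snd) h)))
  have hr {T : C} (t : T ⟶ W) : prod.lift (I.map (t ≫ ι ≫ prod.fst ≫ eB) ≫ πX)
      (I.map (t ≫ ι ≫ prod.snd ≫ mα)) ≫ r = I.map (t ≫ ι ≫ ρ ≫ prod.fst) ≫ πY := by
    rw [← hκ, Category.assoc, hr, ← I.map_comp_assoc]
  refine ⟨r, isRec_mk (fun {T} x ↦ ?_) (fun {T} x a l ↦ ?_)⟩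
  · have he := IsCovering.pullback_fst (J := J) x eB heB
    have := epi_map (I := I) he
    obtain ⟨t, ht⟩ := trace_nil (pullback.snd x eB)
    have h := hr t
    rw [reassoc_of% ht, reassoc_of% ht, reassoc_of% ht, prod.lift_fst_assoc, prod.lift_snd_assoc,
      reassoc_of% AriUniv.IsExactCompletion.trace_nil hρ, prod.lift_fst, ← pullback.condition,
      hα.nil, I.map_comp_assoc (pullback.snd x eB), hβ, ← I.map_comp_assoc,
      ← pullback.condition] at h
    rw [← cancel_epi (I.map (pullback.fst x eB))]
    rw [← S.comp_nil (pullback.fst x eB), I.map_comp, I.map_comp, Category.assoc,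
      ← prod.comp_lift, Category.assoc, Category.assoc] at h
    exact h
  · obtain ⟨T₁, e₁, t, he₁, ht⟩ := lift_locally (prod.lift x l)
    have h₁ : t ≫ ι ≫ prod.fst ≫ eB = e₁ ≫ x := by simpa using congrArg (· ≫ prod.fst) ht
    have h₂ : t ≫ ι ≫ prod.snd ≫ mα = e₁ ≫ l := by simpa using congrArg (· ≫ prod.snd) ht
    let c : T₁ ⟶ A ⨯ Q.A := prod.lift (e₁ ≫ a) (t ≫ ι ≫ ρ ≫ prod.fst)
    let e₂ := pullback.fst c eG
    let γ := pullback.snd c eG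
    have hγ : γ ≫ eG = e₂ ≫ c := pullback.condition.symm
    obtain ⟨⟨t', ht'⟩, hw'⟩ := trace_cons (e₂ ≫ t) γ (by rw [reassoc_of% hγ]; simp [c])
    have he : J (e₂ ≫ e₁) := IsCovering.comp_mem _ _ (IsCovering.pullback_fst c eG heG) he₁
    have := epi_map (I := I) he
    have k := hr t
    rw [h₁, h₂] at k
    have k' := hr t'
    simp only [Category.assoc] at ht' hw'
    rw [reassoc_of% ht', reassoc_of% ht', reassoc_of% ht', hw', prod.lift_fst_assoc,
      prod.lift_snd_assoc, hα.cons, I.map_comp_assoc γ, hw, ← I.map_comp_assoc, hγ] at k'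
    simp only [Category.assoc, h₁, h₂, reassoc_of% hγ] at k'
    have hc : c ≫ prod.fst = e₁ ≫ a := prod.lift_fst _ _
    have hc' : c ≫ prod.snd = t ≫ ι ≫ ρ ≫ prod.fst := prod.lift_snd _ _
    have hc'' : I.map c ≫ prod.lift (I.map prod.fst) (I.map prod.snd ≫ πY) =
        prod.lift (I.map (e₁ ≫ a)) (I.map (t ≫ ι ≫ ρ ≫ prod.fst) ≫ πY) := by
      rw [prod.comp_lift, ← I.map_comp, ← I.map_comp_assoc, hc, hc']
    rw [hc, I.map_comp_assoc e₂ c, reassoc_of% hc'', ← k] at k'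
    rw [← cancel_epi (I.map (e₂ ≫ e₁))]
    have hcons : e₂ ≫ e₁ ≫ S.cons a l = S.cons (e₂ ≫ e₁ ≫ a) (e₂ ≫ e₁ ≫ l) := by
      rw [S.comp_cons, S.comp_cons]
    simp only [← hcons] at k'
    simpa only [I.map_comp, prod.comp_lift_assoc, Category.assoc] using k'

end IsExactCompletion

end

section

variable {C : Type*} [Category* C] {D : Type*} [Category* D]

/-! #### List algebras and functors -/

namespace ListAlg

/-- The image of a list algebra under a functor which preserves finite products. -/
noncomputable def map [HasFiniteProducts C] (F : C ⥤ D) [PreservesFiniteProducts F] {A L : C}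
    (S : ListAlg A L) : ListAlg (F.obj A) (F.obj L) :=
  ofMaps (nil := F.map (S.nil (⊤_ C))) (cons := F.map (S.cons prod.fst prod.snd))
    (IsTerminal.isTerminalObj F _ terminalIsTerminal)
    (mapIsLimitOfPreservesOfIsLimit F _ _ (prodIsProd A L))

section

variable [HasFiniteProducts C] (F : C ⥤ D) [PreservesFiniteProducts F] {A L : C} (S : ListAlg A L)

theorem map_nil (T : C) : (S.map F).nil (F.obj T) = F.map (S.nil T) := by
  rw [← S.comp_nil (terminal.from T), F.map_comp]
  exact congrArg (· ≫ _) ((IsTerminal.isTerminalObj F _ terminalIsTerminal).hom_ext _ _)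

theorem map_cons {T : C} (a : T ⟶ A) (l : T ⟶ L) :
    (S.map F).cons (F.map a) (F.map l) = F.map (S.cons a l) := by
  have : S.cons a l = prod.lift a l ≫ S.cons prod.fst prod.snd := by simp
  rw [this, F.map_comp]
  refine congrArg (· ≫ _) (fan_hom_ext (mapIsLimitOfPreservesOfIsLimit F _ _ (prodIsProd A L))
    ?_ ?_)
  · rw [fanLift_fst, ← F.map_comp, prod.lift_fst]
  · rw [fanLift_snd, ← F.map_comp, prod.lift_snd]

/-- Stages outside the image of `F` are reached from generic ones: the operations over any stage are
restrictions of those over `F.obj (⊤_ C)` and `F.obj (A ⨯ L)`. -/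
theorem map_isHom {A' L' : C} {S : ListAlg A L} {S' : ListAlg A' L'} {f : A ⟶ A'} {φ : L ⟶ L'}
    (h : S.IsHom S' f φ) : (S.map F).IsHom (S'.map F) (F.map f) (F.map φ) := by
  have hP := mapIsLimitOfPreservesOfIsLimit F _ _ (prodIsProd A L)
  have hn (T : C) : (S.map F).nil (F.obj T) ≫ F.map φ = (S'.map F).nil (F.obj T) := by
    rw [map_nil, map_nil, ← F.map_comp, h.nil]
  have hc {T : C} (a : T ⟶ A) (l : T ⟶ L) : (S.map F).cons (F.map a) (F.map l) ≫ F.map φ =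
      (S'.map F).cons (F.map a ≫ F.map f) (F.map l ≫ F.map φ) := by
    rw [map_cons, ← F.map_comp, h.cons, ← F.map_comp, ← F.map_comp, map_cons]
  refine ⟨fun T ↦ ?_, fun a l ↦ ?_⟩
  · rw [← (S.map F).comp_nil ((IsTerminal.isTerminalObj F _ terminalIsTerminal).from T),
      Category.assoc, hn, comp_nil]
  · have := congrArg (fanLift hP a l ≫ ·) (hc prod.fst prod.snd)
    simpa only [comp_cons, comp_cons_assoc, fanLift_fst, fanLift_snd, fanLift_fst_assoc,
      fanLift_snd_assoc] using this

end

/-- Functors which preserve some list objects preserve all of them. -/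
theorem preservesListObjects [HasFiniteProducts C] [HasFiniteProducts D] (F : C ⥤ D)
    [PreservesFiniteProducts F]
    (h : ∀ A : C, ∃ (L : C) (S : ListAlg A L), S.IsUniversal ∧ (S.map F).IsUniversal) :
    PreservesListObjects F := by
  intro A L T P nil fst snd cons hL
  obtain ⟨hT, hP, hS⟩ := (isParamListObject_iff _ _ _ _).1 hL
  obtain ⟨L', S', hS', hF⟩ := h A
  obtain ⟨i, hi⟩ := hS'.exists_iso hS
  have key : ofMaps (nil := F.map nil) (cons := F.map cons) (IsTerminal.isTerminalObj F _ hT)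
      (mapIsLimitOfPreservesOfIsLimit F _ _ hP) =
        map F (ofMaps (nil := nil) (cons := cons) hT hP) := by
    refine eq_of_nil_cons (funext fun Z ↦ ?_) fun {Z} a l ↦ ?_
    · change _ = _ ≫ F.map (hT.from _ ≫ nil)
      rw [F.map_comp, ← Category.assoc]
      exact congrArg (· ≫ _) ((IsTerminal.isTerminalObj F _ hT).hom_ext _ _)
    · change _ = fanLift _ a l ≫ F.map (fanLift hP prod.fst prod.snd ≫ cons)
      rw [F.map_comp, ← Category.assoc]
      refine congrArg (· ≫ _) (fan_hom_ext (mapIsLimitOfPreservesOfIsLimit F _ _ hP) ?_ ?_)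
      · rw [Category.assoc, ← F.map_comp, fanLift_fst, fanLift_fst, fanLift_fst]
      · rw [Category.assoc, ← F.map_comp, fanLift_snd, fanLift_snd, fanLift_snd]
  refine (isParamListObject_iff _ _ _ _).2 ⟨IsTerminal.isTerminalObj F _ hT,
    mapIsLimitOfPreservesOfIsLimit F _ _ hP, ?_⟩
  have hi' := map_isHom F hi
  rw [F.map_id] at hi'
  rw [key]
  exact fun {X Y} b g ↦ hF.of_iso (F.mapIso i) hi' b g

theorem _root_.AriUniv.PreservesListObjects.isUniversal_map [HasFiniteProducts C] [HasFiniteProducts D]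
    {F : C ⥤ D} [PreservesFiniteProducts F] (h : PreservesListObjects F) {A L : C}
    {S : ListAlg A L} (hS : S.IsUniversal) : (S.map F).IsUniversal := by
  obtain ⟨hT, hP, h⟩ := (isParamListObject_iff _ _ _ _).1 (h _ _ _ _ hS.isParamListObject)
  have key : ofMaps (nil := F.map (S.nil (⊤_ C))) (cons := F.map (S.cons prod.fst prod.snd)) hT hP =
      S.map F := by
    unfold map
    congr 1 <;> exact Subsingleton.elim _ _
  rw [← key]
  exact fun {X Y} b g ↦ h b g

end ListAlg

/-! #### Lists in quotients -/

theorem exists_desc_of_isRegularEpi {X Y Z : C} {f : X ⟶ Y} (hf : IsRegularEpi f) (g : X ⟶ Z)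
    (h : ∀ {T : C} (x x' : T ⟶ X), x ≫ f = x' ≫ f → x ≫ g = x' ≫ g) : ∃ d : Y ⟶ Z, f ≫ d = g := by
  obtain ⟨⟨e⟩⟩ := hf
  exact ⟨Cofork.IsColimit.desc e.isColimit g (h _ _ e.w), Cofork.IsColimit.π_desc' e.isColimit _ _⟩

/-- Exhibits the product of `Z` with `f` as a base change of `f`, so that it is a regular
epimorphism when `f` is one; recursion with parameters needs this. -/
theorem isPullback_prod_map [HasBinaryProducts C] (Z : C) {X Y : C} (f : X ⟶ Y) :
    IsPullback (prod.snd : Z ⨯ X ⟶ X) (prod.map (𝟙 Z) f) f prod.snd :=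
  ⟨⟨by simp⟩, ⟨PullbackCone.IsLimit.mk _ (fun s ↦ prod.lift (s.snd ≫ prod.fst) s.fst)
    (fun s ↦ by simp) (fun s ↦ by ext <;> simp [s.condition]) (fun s m h₁ h₂ ↦ by
      ext
      · simp [← h₂]
      · simp [← h₁])⟩⟩

/-- The lists on a quotient are a quotient of the lists. -/
theorem ListAlg.IsUniversal.of_quotient [Regular C] {R A X LR L LX : C}
    {SR : ListAlg R LR} (hSR : SR.IsUniversal) {S : ListAlg A L} (hS : S.IsUniversal)
    {SX : ListAlg X LX} {p₁ p₂ : R ⟶ A} {q₁ q₂ : LR ⟶ L} (h₁ : SR.IsHom S p₁ q₁)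
    (h₂ : SR.IsHom S p₂ q₂) {π : A ⟶ X} {κ : L ⟶ LX} (h : S.IsHom SX π κ) (hp : p₁ ≫ π = p₂ ≫ π)
    (hπ : IsRegularEpi π) (hκ : IsRegularEpi κ)
    (hq : ∀ {T : C} (l l' : T ⟶ L), l ≫ κ = l' ≫ κ → ∃ (T' : C) (e : T' ⟶ T) (t : T' ⟶ LR), Epi e ∧
      t ≫ q₁ = e ≫ l ∧ t ≫ q₂ = e ≫ l') : SX.IsUniversal := by
  intro Z Y b g
  have := Regular.regularEpiIsStableUnderBaseChange (C := C)
  have hZ : IsRegularEpi (prod.map (𝟙 Z) κ) :=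
    MorphismProperty.of_isPullback (P := .regularEpi C) (isPullback_prod_map Z κ) hκ
  have hmap {T : C} (z : T ⟶ Z) (l : T ⟶ L) :
      prod.lift z l ≫ prod.map (𝟙 Z) κ = prod.lift z (l ≫ κ) := by simp
  obtain ⟨r, hr⟩ := hS.exists_rec b (prod.map π (𝟙 Y) ≫ g)
  -- Both sides solve the same recursion over `LR`, because `p₁ ≫ π = p₂ ≫ π`. Hence `r` does not
  -- distinguish related lists and descends along `κ`.
  have hqr : prod.map (𝟙 Z) q₁ ≫ r = prod.map (𝟙 Z) q₂ ≫ r := by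
    refine hSR.hom_ext (b := b) (g := prod.map (p₁ ≫ π) (𝟙 Y) ≫ g) ⟨fun x ↦ ?_, fun x a l ↦ ?_⟩
      ⟨fun x ↦ ?_, fun x a l ↦ ?_⟩
    · simpa [h₁.nil] using hr.nil x
    · simpa [h₁.cons] using hr.cons x (a ≫ p₁) (l ≫ q₁)
    · simpa [h₂.nil] using hr.nil x
    · simpa [h₂.cons, hp] using hr.cons x (a ≫ p₂) (l ≫ q₂)
  obtain ⟨d, hd⟩ := exists_desc_of_isRegularEpi hZ r (fun {T} v v' hv ↦ by
    have hv₁ : v ≫ prod.fst = v' ≫ prod.fst := by simpa using congrArg (· ≫ prod.fst) hv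
    have hv₂ : v ≫ prod.snd ≫ κ = v' ≫ prod.snd ≫ κ := by simpa using congrArg (· ≫ prod.snd) hv
    obtain ⟨T', e, t, he, ht, ht'⟩ := hq (v ≫ prod.snd) (v' ≫ prod.snd) (by simpa using hv₂)
    have k₁ : e ≫ v = prod.lift (e ≫ v ≫ prod.fst) t ≫ prod.map (𝟙 Z) q₁ := by ext <;> simp [ht]
    have k₂ : e ≫ v' = prod.lift (e ≫ v ≫ prod.fst) t ≫ prod.map (𝟙 Z) q₂ := by
      ext <;> simp [ht', hv₁]
    rw [← cancel_epi e, reassoc_of% k₁, reassoc_of% k₂, hqr])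
  have hd' {T : C} (z : T ⟶ Z) (l : T ⟶ L) : prod.lift z (l ≫ κ) ≫ d = prod.lift z l ≫ r := by
    rw [← hd, reassoc_of% hmap]
  refine ⟨d, ⟨fun x ↦ ?_, fun x a l ↦ ?_⟩, fun d' hd'' ↦ ?_⟩
  · rw [← h.nil, hd', hr.nil]
  -- The entry and the list are lifted to `A` and `L` over regular covers of the stage, where the
  -- equation for `r` applies.
  · have e₁ : IsRegularEpi (pullback.fst a π) := inferInstance
    have e₂ : IsRegularEpi (pullback.fst (pullback.fst a π ≫ l) κ) := inferInstance
    rw [← cancel_epi (pullback.fst a π), ← cancel_epi (pullback.fst (pullback.fst a π ≫ l) κ)]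
    have := hr.cons (pullback.fst (pullback.fst a π ≫ l) κ ≫ pullback.fst a π ≫ x)
      (pullback.fst (pullback.fst a π ≫ l) κ ≫ pullback.snd a π)
      (pullback.snd (pullback.fst a π ≫ l) κ)
    rw [← hd', ← hd', h.cons] at this
    simpa [← pullback.condition] using this
  · have : Epi (prod.map (𝟙 Z) κ) := inferInstance
    rw [← cancel_epi (prod.map (𝟙 Z) κ), hd]
    refine hS.hom_ext (b := b) (g := prod.map π (𝟙 Y) ≫ g) ⟨fun x ↦ ?_, fun x a l ↦ ?_⟩ hr
    · simpa [h.nil] using hd''.nil x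
    · simpa [h.cons] using hd''.cons x (a ≫ π) (l ≫ κ)

end

/-! ### Quotients of pseudo-equivalence relations, and list objects in an exact completion -/

section

variable {C : Type*} [Category* C] {D : Type*} [Category* D]

namespace IsExactCompletion

section

variable [HasFiniteLimits C] {J : MorphismProperty C} [IsCovering J] {I : C ⥤ D}
  [IsExactCompletion J I]
include J I

variable (J I) in
/-- Every pseudo-equivalence relation has a quotient, which only depends on its local closure. -/
theorem exists_quotient_of_pseudoEquivRel (P : PseudoEquivRel C) :
    ∃ (X : D) (π : I.obj P.A ⟶ X), LocSurj J I π ∧ ∀ {T : C} (a a' : T ⟶ P.A),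
      I.map a ≫ π = I.map a' ≫ π ↔
        ∃ (T' : C) (e : T' ⟶ T), J e ∧ P.Rel (e ≫ a) (e ≫ a') := by
  -- Kernels are local because covers become epic in `D`, so the relation is first made local.
  refine exists_quotient' J (I := I)
    (fun T a a' ↦ ∃ (T' : C) (e : T' ⟶ T), J e ∧ P.Rel (e ≫ a) (e ≫ a'))
    (fun T ↦ ⟨fun a ↦ ⟨T, 𝟙 T, IsCovering.id_mem T, .refl P _⟩, ?_, ?_⟩) ?_ ?_
  · rintro a a' ⟨T', e, he, h⟩
    exact ⟨T', e, he, h.symm⟩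
  · rintro a a' a'' ⟨T₁, e₁, he₁, h₁⟩ ⟨T₂, e₂, he₂, h₂⟩
    refine ⟨_, pullback.fst e₁ e₂ ≫ e₁, IsCovering.comp_mem _ _
      (IsCovering.pullback_fst _ _ he₂) he₁, ?_⟩
    have k₁ := h₁.precomp (pullback.fst e₁ e₂)
    have k₂ := h₂.precomp (pullback.snd e₁ e₂)
    rw [← pullback.condition_assoc, ← pullback.condition_assoc] at k₂
    simpa using k₁.trans k₂
  · refine (isRepr_liftsLocally J (prod.lift P.p₁ P.p₂)).congr fun T v ↦ ⟨?_, ?_⟩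
    · rintro ⟨T', e, he, r, h₁, h₂⟩
      exact ⟨T', e, r, he, by ext <;> simp [h₁, h₂]⟩
    · rintro ⟨T', e, r, he, h⟩
      exact ⟨T', e, he, r, by simpa using congrArg (· ≫ prod.fst) h,
        by simpa using congrArg (· ≫ prod.snd) h⟩
  · rintro T T' a a' e he ⟨T'', e', he', h⟩
    exact ⟨T'', e' ≫ e, IsCovering.comp_mem _ _ he' he, by simpa using h⟩

end

variable [IsLocos C] {J : MorphismProperty C} [IsCovering J] {I : C ⥤ D} [IsExactCompletion J I]
include J I

variable (J I) in
/-- The list objects in `D`, as quotients of the list objects in `C`. -/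
theorem exists_isUniversal [HasFiniteLimits D] [PreservesFiniteLimits I] (X : D) :
    ∃ (A R L LR : C) (p₁ p₂ : R ⟶ A) (q₁ q₂ : LR ⟶ L) (S : ListAlg A L) (SR : ListAlg R LR)
      (π : I.obj A ⟶ X) (LX : D) (SX : ListAlg X LX) (κ : I.obj L ⟶ LX), S.IsUniversal ∧
      SR.IsUniversal ∧ SR.IsHom S p₁ q₁ ∧ SR.IsHom S p₂ q₂ ∧ I.map p₁ ≫ π = I.map p₂ ≫ π ∧
      LocSurj J I π ∧ (S.map I).IsHom SX π κ ∧ LocSurj J I κ ∧ (∀ {T : C} (l l' : T ⟶ L),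
        I.map l ≫ κ = I.map l' ≫ κ → ∃ (T' : C) (e : T' ⟶ T), J e ∧
          ∃ t : T' ⟶ LR, t ≫ q₁ = e ≫ l ∧ t ≫ q₂ = e ≫ l') ∧ SX.IsUniversal := by
  have : Regular D := by
    have := isExact J I
    exact IsExact.regular D
  obtain ⟨P, π, hπ, hP⟩ := exists_cover (J := J) (I := I) X
  obtain ⟨L, S, hS⟩ := IsLocos.exists_isUniversal P.A
  obtain ⟨LR, SR, hSR⟩ := IsLocos.exists_isUniversal P.R
  obtain ⟨q₁, h₁⟩ := hSR.exists_isHom S P.p₁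
  obtain ⟨q₂, h₂⟩ := hSR.exists_isHom S P.p₂
  obtain ⟨LX, κ, hκ, hLX⟩ : ∃ (LX : D) (κ : I.obj L ⟶ LX), LocSurj J I κ ∧
      ∀ {T : C} (l l' : T ⟶ L), I.map l ≫ κ = I.map l' ≫ κ ↔ ∃ (T' : C) (e : T' ⟶ T), J e ∧
        ∃ t : T' ⟶ LR, t ≫ q₁ = e ≫ l ∧ t ≫ q₂ = e ≫ l' :=
    exists_quotient_of_pseudoEquivRel J I (PseudoEquivRel.list hS hSR h₁ h₂)
  let c : I.obj (P.A ⨯ L) ⟶ X ⨯ LX := prod.lift (I.map prod.fst ≫ π) (I.map prod.snd ≫ κ)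
  have hc' {T : C} (v : T ⟶ P.A ⨯ L) : I.map v ≫ c =
      prod.lift (I.map (v ≫ prod.fst) ≫ π) (I.map (v ≫ prod.snd) ≫ κ) := by
    rw [prod.comp_lift, I.map_comp_assoc, I.map_comp_assoc]
  have hc : LocSurj J I c := ⟨fun {T} v ↦ by
    obtain ⟨T₁, e₁, a, he₁, ha⟩ := exists_lift hπ (v ≫ prod.fst)
    obtain ⟨T₂, e₂, l, he₂, hl⟩ := exists_lift hκ (I.map e₁ ≫ v ≫ prod.snd)
    refine ⟨T₂, e₂ ≫ e₁, I.map (prod.lift (e₂ ≫ a) l), IsCovering.comp_mem _ _ he₂ he₁, ?_⟩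
    rw [hc']
    ext
    · simp [ha]
    · simp [hl]⟩
  -- A witness that the heads are related can be consed onto a local witness that the tails are, so
  -- consing respects the two relations and descends.
  obtain ⟨cons, hcons, -⟩ := existsUnique_desc c hc (I.map (S.cons prod.fst prod.snd) ≫ κ)
    (fun {T} v v' h ↦ by
      rw [hc', hc'] at h
      have k₁ : I.map (v ≫ prod.fst) ≫ π = I.map (v' ≫ prod.fst) ≫ π := by
        simpa only [prod.lift_fst] using congrArg (· ≫ prod.fst) h
      have k₂ : I.map (v ≫ prod.snd) ≫ κ = I.map (v' ≫ prod.snd) ≫ κ := by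
        simpa only [prod.lift_snd] using congrArg (· ≫ prod.snd) h
      obtain ⟨r, hr₁, hr₂⟩ := (hP _ _).1 k₁
      obtain ⟨T', e, he, t, ht₁, ht₂⟩ := (hLX _ _).1 k₂
      rw [← I.map_comp_assoc, ← I.map_comp_assoc, hLX]
      refine ⟨T', e, he, SR.cons (e ≫ r) t, ?_, ?_⟩
      · simp [h₁.cons, hr₁, ht₁]
      · simp [h₂.cons, hr₂, ht₂])
  have hT := IsTerminal.isTerminalObj I _ (terminalIsTerminal (C := C))
  let SX : ListAlg X LX :=
    { nil := fun T ↦ hT.from T ≫ I.map (S.nil _) ≫ κ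
      cons := fun x l ↦ prod.lift x l ≫ cons
      comp_nil := fun f ↦ by rw [← Category.assoc, hT.comp_from]
      comp_cons := fun f x l ↦ by rw [prod.comp_lift_assoc] }
  have hSI : (S.map I).IsUniversal := fun {X Y} b g ↦
    isUniversal_map (J := J) hS (fun T ↦ (S.map_nil I T).symm) (fun a l ↦ (S.map_cons I a l).symm) b g
  have hSRI : (SR.map I).IsUniversal := fun {X Y} b g ↦
    isUniversal_map (J := J) hSR (fun T ↦ (SR.map_nil I T).symm)
      (fun a l ↦ (SR.map_cons I a l).symm) b g
  have hhom : (S.map I).IsHom SX π κ := by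
    refine ⟨fun T ↦ ?_, fun {T} a l ↦ hom_ext J I fun {Z} z ↦ ?_⟩
    · rw [← (S.map I).comp_nil (hT.from T), Category.assoc, S.map_nil I]
    · obtain ⟨a', ha'⟩ := exists_map_eq J (z ≫ a)
      obtain ⟨l', hl'⟩ := exists_map_eq J (z ≫ l)
      have h : I.map (prod.lift a' l') ≫ c = z ≫ prod.lift (a ≫ π) (l ≫ κ) := by
        rw [hc', prod.lift_fst, prod.lift_snd, ha', hl', prod.comp_lift, Category.assoc,
          Category.assoc]
      change _ = z ≫ prod.lift (a ≫ π) (l ≫ κ) ≫ cons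
      rw [← reassoc_of% h, hcons, ← I.map_comp_assoc, ListAlg.comp_cons_assoc, ← ha', ← hl',
        S.map_cons I]
      simp
  have hp : I.map P.p₁ ≫ π = I.map P.p₂ ≫ π := (hP P.p₁ P.p₂).2 ⟨𝟙 _, by simp, by simp⟩
  refine ⟨P.A, P.R, L, LR, P.p₁, P.p₂, q₁, q₂, S, SR, π, LX, SX, κ, fun {X Y} b g ↦ hS b g,
    fun {X Y} b g ↦ hSR b g, h₁, h₂, hp, hπ, hhom, hκ, fun l l' ↦ (hLX l l').1,
    fun {Z Y} b g ↦ hSRI.of_quotient hSI (SR.map_isHom I h₁) (SR.map_isHom I h₂)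
    hhom hp hπ.isRegularEpi hκ.isRegularEpi (fun {T} l l' h ↦ ?_) b g⟩
  obtain ⟨PT, πT, hπT, -⟩ := exists_cover (J := J) (I := I) T
  obtain ⟨m, hm⟩ := exists_map_eq J (πT ≫ l)
  obtain ⟨m', hm'⟩ := exists_map_eq J (πT ≫ l')
  obtain ⟨T', e, he, t, ht₁, ht₂⟩ := (hLX m m').1 (by
    rw [hm, hm', Category.assoc, Category.assoc, h])
  have := hπT.epi
  have := epi_map (I := I) he
  refine ⟨_, I.map e ≫ πT, I.map t, inferInstance, ?_, ?_⟩
  · rw [← I.map_comp, ht₁, I.map_comp, hm, Category.assoc]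
  · rw [← I.map_comp, ht₂, I.map_comp, hm', Category.assoc]

variable (J I) in
theorem isArithmeticUniverse : IsArithmeticUniverse D where
  __ := isExact J I
  __ := finitaryExtensive J I
  exists_list X := by
    have := hasFiniteLimits J I
    have := preservesFiniteLimits J I
    obtain ⟨-, -, -, -, -, -, -, -, -, -, -, L, S, -, -, -, -, -, -, -, -, -, -, hS⟩ :=
      exists_isUniversal J I X
    exact ⟨L, _, _, hS.isParamListObject⟩

variable (J I) in
theorem isLocosFunctor [IsLocos D] : IsLocosFunctor I where
  preservesFiniteLimits := preservesFiniteLimits J I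
  preservesFiniteCoproducts := preservesFiniteCoproducts J I
  preservesListObjects {A L T P} nil fst snd cons h := by
    have := preservesFiniteLimits J I
    refine ListAlg.preservesListObjects I (fun A ↦ ?_) nil fst snd cons h
    obtain ⟨L, S, hS⟩ := IsLocos.exists_isUniversal A
    exact ⟨L, S, hS, fun {X Y} b g ↦ isUniversal_map (J := J) hS (fun T ↦ (S.map_nil I T).symm)
      (fun a l ↦ (S.map_cons I a l).symm) b g⟩

end IsExactCompletion

end

section

variable {C : Type u} [Category.{v} C]

/-! ### The ex/lex completion is an exact completion -/

/-- Split epimorphisms. -/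
def splitEpis (C : Type u) [Category.{v} C] : MorphismProperty C :=
  fun X Y f ↦ ∃ s : Y ⟶ X, s ≫ f = 𝟙 Y

/-- A section of the cover turns a local lift into a global one, so each `π` serves as its own
image. -/
instance [HasPullbacks C] : IsCovering (splitEpis C) where
  id_mem X := ⟨𝟙 X, by simp⟩
  comp_mem f g := by
    rintro ⟨s, hs⟩ ⟨t, ht⟩
    exact ⟨t ≫ s, by simp [reassoc_of% hs, ht]⟩
  pullback_fst f g := by
    rintro ⟨s, hs⟩
    exact ⟨pullback.lift (𝟙 _) (f ≫ s) (by simp [hs]), pullback.lift_fst _ _ _⟩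
  sum h h' h₁ h₂ := by
    rintro ⟨s, hs⟩ ⟨t, ht⟩
    obtain ⟨d, hd₁, hd₂⟩ := h.exists_desc (s ≫ _) (t ≫ _)
    refine ⟨d, h.hom_ext ?_ ?_⟩
    · rw [reassoc_of% hd₁, h₁, reassoc_of% hs, Category.comp_id]
    · rw [reassoc_of% hd₂, h₂, reassoc_of% ht, Category.comp_id]
  exists_image {P V} π := by
    refine ⟨P, π, fun {T} v ↦ ⟨?_, ?_⟩⟩
    · rintro ⟨T', e, t, ⟨s, hs⟩, ht⟩
      exact ⟨s ≫ t, by rw [Category.assoc, ht, reassoc_of% hs]⟩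
    · rintro ⟨t, rfl⟩
      exact ⟨T, 𝟙 T, t, ⟨𝟙 T, by simp⟩, by simp⟩

namespace ExLex

/-- The map from an object of `C` given by a generalised element. -/
def elem {T : C} {X : ExLex C} (x : T ⟶ X.rel.A) : (embedding C).obj T ⟶ X :=
  Quotient.mk _ ⟨x, .refl X.rel (𝟙 T ≫ x)⟩

theorem exists_elem_eq {T : C} {X : ExLex C} (x : (embedding C).obj T ⟶ X) : ∃ y, elem y = x := by
  induction x using Quotient.inductionOn with
  | h x => exact ⟨x.1, rfl⟩

theorem exists_map_eq {A B : C} (f : (embedding C).obj A ⟶ (embedding C).obj B) :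
    ∃ g : A ⟶ B, (embedding C).map g = f :=
  exists_elem_eq f

theorem elem_eq_elem_iff {T : C} {X : ExLex C} (x y : T ⟶ X.rel.A) : elem x = elem y ↔ X.rel.Rel x y :=
  Quotient.eq

theorem map_comp_elem {T T' : C} {X : ExLex C} (e : T' ⟶ T) (x : T ⟶ X.rel.A) :
    (embedding C).map e ≫ elem x = elem (e ≫ x) := rfl

theorem elem_id_comp_mk {X Y : ExLex C} (f : PreHom X Y) :
    elem (𝟙 X.rel.A) ≫ (Quotient.mk _ f : X ⟶ Y) = elem f.1 :=
  congrArg (Quotient.mk _) (Subtype.ext (Category.id_comp _))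

theorem epi_elem_id (X : ExLex C) : Epi (elem (𝟙 X.rel.A)) where
  left_cancellation {Y} f g h := by
    induction f using Quotient.inductionOn with | h f => ?_
    induction g using Quotient.inductionOn with | h g => ?_
    have h' := (elem_id_comp_mk f).symm.trans (h.trans (elem_id_comp_mk g))
    exact Quotient.sound ((elem_eq_elem_iff _ _).1 h')

theorem elem_eq {T : C} {X : ExLex C} (x : T ⟶ X.rel.A) :
    elem x = (embedding C).map x ≫ elem (𝟙 X.rel.A) := by
  rw [map_comp_elem, Category.comp_id]

theorem locSurj_elem_id (P : PseudoEquivRel C) :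
    LocSurj (splitEpis C) (embedding C) (elem (X := ⟨P⟩) (𝟙 P.A)) where
  exists_lift {T} y := by
    obtain ⟨y, rfl⟩ := exists_elem_eq y
    exact ⟨T, 𝟙 T, (embedding C).map y, ⟨𝟙 T, by simp⟩, by
      rw [← elem_eq, CategoryTheory.Functor.map_id, Category.id_comp]⟩

theorem map_comp_elem_id_iff (P : PseudoEquivRel C) {T : C} (a a' : T ⟶ P.A) :
    (embedding C).map a ≫ elem (X := ⟨P⟩) (𝟙 P.A) = (embedding C).map a' ≫ elem (X := ⟨P⟩) (𝟙 P.A) ↔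
      P.Rel a a' := by
  rw [← elem_eq, ← elem_eq, elem_eq_elem_iff]

instance : IsExactCompletion (splitEpis C) (embedding C) where
  full := ⟨exists_map_eq⟩
  faithful := ⟨fun {A B f g} h ↦ by
    exact (PseudoEquivRel.rel_discrete_iff f g).1
      ((elem_eq_elem_iff (X := (embedding C).obj B) f g).1 h)⟩
  exists_cover X := ⟨X.rel, elem (𝟙 X.rel.A), locSurj_elem_id X.rel, map_comp_elem_id_iff X.rel⟩
  existsUnique_desc {A X Y} π hπ f hf := by
    have := epi_elem_id X
    -- As covers split, local surjectivity at the generic element of `X` yields a map `a` that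
    -- chooses preimages under `π`; the descended map is `f` along `a`.
    obtain ⟨T, e, x, ⟨s, hs⟩, hx⟩ := hπ.exists_lift (elem (𝟙 X.rel.A))
    obtain ⟨a, ha⟩ := exists_map_eq ((embedding C).map s ≫ x)
    have ha : (embedding C).map a ≫ π = elem (𝟙 X.rel.A) := by
      rw [ha, Category.assoc, hx, ← Functor.map_comp_assoc, hs, CategoryTheory.Functor.map_id,
        Category.id_comp]
    obtain ⟨f', rfl⟩ := exists_elem_eq f
    obtain ⟨p, rfl⟩ := exists_elem_eq π
    have hrel : Y.rel.Rel (X.rel.p₁ ≫ a ≫ f') (X.rel.p₂ ≫ a ≫ f') := by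
      rw [← elem_eq_elem_iff, ← Category.assoc, ← Category.assoc, ← map_comp_elem, ← map_comp_elem]
      apply hf
      rw [Functor.map_comp_assoc, Functor.map_comp_assoc, ha, ← elem_eq, ← elem_eq, elem_eq_elem_iff]
      exact ⟨𝟙 _, by simp, by simp⟩
    let d : X ⟶ Y := Quotient.mk _ ⟨a ≫ f', hrel⟩
    have hd : elem (𝟙 X.rel.A) ≫ d = (embedding C).map a ≫ elem f' := elem_id_comp_mk _
    refine ⟨d, ?_, fun d' hd' ↦ ?_⟩
    · have h := hf (p ≫ a) (𝟙 A) (by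
        rw [Functor.map_comp_assoc, ha, ← elem_eq, CategoryTheory.Functor.map_id, Category.id_comp])
      rw [CategoryTheory.Functor.map_id, Category.id_comp, Functor.map_comp_assoc, ← hd, ← Category.assoc,
        ← elem_eq] at h
      exact h
    · rw [← cancel_epi (elem (𝟙 X.rel.A)), hd, ← hd', ← ha, Category.assoc]
  exists_quotient P _ := ⟨⟨P⟩, elem (𝟙 P.A), locSurj_elem_id P, map_comp_elem_id_iff P⟩

instance [IsLocos C] : IsArithmeticUniverse (ExLex C) :=
  IsExactCompletion.isArithmeticUniverse (splitEpis C) (embedding C)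

end ExLex

end

section

variable {C : Type u} [Category.{v} C]

/-! ### Covers in a regular category -/

/-- Strong epimorphisms. -/
def strongEpis (C : Type u) [Category.{v} C] : MorphismProperty C :=
  fun _ _ f ↦ StrongEpi f

/-- Sums of covers are handled by constructing lifts summand by summand. A local lift along `π`
amounts to a lift along the monic part of its image factorisation, by orthogonality. -/
instance [Regular C] : IsCovering (strongEpis C) where
  id_mem X := inferInstanceAs (StrongEpi (𝟙 X))
  comp_mem f g (_ : StrongEpi f) (_ : StrongEpi g) := inferInstanceAs (StrongEpi (f ≫ g))
  pullback_fst f g (_ : StrongEpi g) := by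
    have : IsRegularEpi (pullback.fst f g) := inferInstance
    exact inferInstanceAs (StrongEpi (pullback.fst f g))
  sum {A B S A' B' S' i₁ i₂ j₁ j₂ f g h} hS hS' h₁ h₂ (_ : StrongEpi f) (_ : StrongEpi g) :=
    { epi := ⟨fun u u' hu ↦ hS.hom_ext
        (by rw [← cancel_epi f, ← reassoc_of% h₁, hu, reassoc_of% h₁])
        (by rw [← cancel_epi g, ← reassoc_of% h₂, hu, reassoc_of% h₂])⟩
      llp := fun X Y z _ ↦ ⟨fun {u v} sq ↦ by
        have sq₁ : CommSq (j₁ ≫ u) f z (i₁ ≫ v) := ⟨by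
          rw [Category.assoc, sq.w, reassoc_of% h₁]⟩
        have sq₂ : CommSq (j₂ ≫ u) g z (i₂ ≫ v) := ⟨by
          rw [Category.assoc, sq.w, reassoc_of% h₂]⟩
        obtain ⟨d, hd₁, hd₂⟩ := hS.exists_desc sq₁.lift sq₂.lift
        have hd : d ≫ z = v := hS.hom_ext (by rw [reassoc_of% hd₁, sq₁.fac_right])
          (by rw [reassoc_of% hd₂, sq₂.fac_right])
        exact ⟨⟨⟨d, by rw [← cancel_mono z, Category.assoc, hd, sq.w], hd⟩⟩⟩⟩ }
  exists_image {P V} π := by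
    let F := Regular.strongEpiMonoFactorisation π
    have hF : F.e ≫ F.m = π := F.fac
    refine ⟨F.I, F.m, fun {T} v ↦ ⟨?_, ?_⟩⟩
    · rintro ⟨T', e, t, he : StrongEpi e, ht⟩
      have sq : CommSq (t ≫ F.e) e F.m v := ⟨by rw [Category.assoc, hF, ht]⟩
      exact ⟨sq.lift, sq.fac_right⟩
    · rintro ⟨t, rfl⟩
      have : IsRegularEpi (pullback.fst t F.e) := inferInstance
      exact ⟨_, pullback.fst t F.e, pullback.snd t F.e,
        inferInstanceAs (StrongEpi (pullback.fst t F.e)), by rw [pullback.condition_assoc, hF]⟩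

namespace PseudoEquivRel

/-- A pair of maps which represents the same relation as a pseudo-equivalence relation is a
pseudo-equivalence relation. -/
def ofRel (P : PseudoEquivRel C) {R : C} (p₁ p₂ : R ⟶ P.A) (h : ∀ {T : C} (x y : T ⟶ P.A),
    (∃ r : T ⟶ R, r ≫ p₁ = x ∧ r ≫ p₂ = y) ↔ P.Rel x y) : PseudoEquivRel C where
  A := P.A
  R := R
  p₁ := p₁
  p₂ := p₂
  reflexive := (h _ _).2 (.refl P _)
  symmetric := (h _ _).2 ((h _ _).1 ⟨𝟙 _, by simp, by simp⟩).symm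
  transitive x y hxy := (h _ _).2 (((h _ _).1 ⟨x, rfl, rfl⟩).trans
    (hxy ▸ (h _ _).1 ⟨y, rfl, rfl⟩))

/-- In a regular category, a pseudo-equivalence relation which is local may be replaced by an
equivalence relation. -/
theorem exists_jointlyMono [Regular C] (P : PseudoEquivRel C)
    (hP : ∀ {T T' : C} (x y : T ⟶ P.A) (e : T' ⟶ T), strongEpis C e →
      P.Rel (e ≫ x) (e ≫ y) → P.Rel x y) :
    ∃ (R : C) (p₁ p₂ : R ⟶ P.A), JointlyMono₂ p₁ p₂ ∧ ∀ {T : C} (x y : T ⟶ P.A),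
      (∃ r : T ⟶ R, r ≫ p₁ = x ∧ r ≫ p₂ = y) ↔ P.Rel x y := by
  let i := (ExReg.image P.p₁ P.p₂).arrow
  refine ⟨_, i ≫ prod.fst, i ≫ prod.snd, ⟨fun {_} f g h₁ h₂ ↦
    (cancel_mono i).1 (prod.hom_ext (by simpa using h₁) (by simpa using h₂))⟩, fun {T} x y ↦ ?_⟩
  have hI : ExReg.Holds (ExReg.image P.p₁ P.p₂) x y ↔ P.Rel x y := by
    rw [ExReg.holds_image_iff]
    exact ⟨fun ⟨T', e, he, m, h⟩ ↦ hP x y e he ⟨m, h⟩,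
      fun ⟨r, h₁, h₂⟩ ↦ ⟨T, 𝟙 T, inferInstance, r, by simpa using h₁, by simpa using h₂⟩⟩
  rw [← hI]
  constructor
  · rintro ⟨r, rfl, rfl⟩
    exact (ExReg.holds_arrow _).precomp r
  · intro h
    have k : Subobject.factorThru _ _ h ≫ i = prod.lift x y := Subobject.factorThru_arrow _ _ h
    exact ⟨Subobject.factorThru _ _ h, by simp [reassoc_of% k], by simp [reassoc_of% k]⟩

end PseudoEquivRel

/-! ### The ex/reg completion is an exact completion -/

namespace ExReg

variable [Regular C]

/-- The map `F`, out of an object of `C`, takes the generalised element `t` to the class of the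
generalised element `x`. -/
def HasValue {T S : C} {X : ExReg C} (F : (embedding C).obj T ⟶ X) (t : S ⟶ T)
    (x : S ⟶ X.rel.A) : Prop :=
  Holds (A := T) (FunRel.graph F) t x

namespace HasValue

variable {T S S' : C} {X : ExReg C} {F : (embedding C).obj T ⟶ X} {t : S ⟶ T} {x y : S ⟶ X.rel.A}

theorem precomp (h : HasValue F t x) (e : S' ⟶ S) : HasValue F (e ≫ t) (e ≫ x) :=
  Holds.precomp h e

theorem of_cover (e : S' ⟶ S) [StrongEpi e] (h : HasValue F (e ≫ t) (e ≫ x)) : HasValue F t x :=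
  Holds.of_cover e h

theorem congr (h : HasValue F t x) (h' : X.rel.Rel x y) : HasValue F t y :=
  FunRel.invariant F (.refl _ _) h' h

theorem rel (h : HasValue F t x) (h' : HasValue F t y) : X.rel.Rel x y :=
  FunRel.singleValued F h h'

end HasValue

theorem exists_hasValue {T S : C} {X : ExReg C} (F : (embedding C).obj T ⟶ X) (t : S ⟶ T) :
    ∃ (S' : C) (e : S' ⟶ S) (_ : StrongEpi e) (x : S' ⟶ X.rel.A), HasValue F (e ≫ t) x :=
  (total_iff _).1 (FunRel.total F) t

/-- Locally `F` has some value at `x`; it is also a value of `G`, hence related to any given value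
of `G`, and invariance of `F` concludes. -/
theorem FunRel.eq_of_le {X Y : ExReg C} {F G : FunRel X Y}
    (h : ∀ {T : C} (x : T ⟶ X.rel.A) (y : T ⟶ Y.rel.A), Holds F.graph x y → Holds G.graph x y) :
    F = G := by
  refine FunRel.ext_holds fun x y ↦ ⟨h x y, fun hxy ↦ ?_⟩
  obtain ⟨T', e, he, z, hz⟩ := (total_iff _).1 F.total x
  exact .of_cover e (F.invariant (.refl _ _) (G.singleValued (h _ _ hz) (hxy.precomp e)) hz)

theorem HasValue.eq_of_le {T : C} {X : ExReg C} {F G : (embedding C).obj T ⟶ X}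
    (h : ∀ {S : C} (t : S ⟶ T) (x : S ⟶ X.rel.A), HasValue F t x → HasValue G t x) : F = G :=
  FunRel.eq_of_le (fun t x ↦ h t x)

theorem hasValue_comp_iff {A : C} {X Y : ExReg C} (F : (embedding C).obj A ⟶ X) (G : X ⟶ Y)
    {T : C} (x : T ⟶ A) (z : T ⟶ Y.rel.A) : HasValue (F ≫ G) x z ↔
      ∃ (T' : C) (e : T' ⟶ T) (_ : StrongEpi e) (y : T' ⟶ X.rel.A),
        HasValue F (e ≫ x) y ∧ Holds (FunRel.graph G) y (e ≫ z) :=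
  holds_compRel_iff _ _ _ _

theorem hasValue_map_iff {A B T : C} (f : A ⟶ B) (x : T ⟶ A) (y : T ⟶ B) :
    HasValue ((embedding C).map f) x y ↔ x ≫ f = y :=
  holds_graphOf_iff f x y

theorem hasValue_map_comp_iff {A B : C} {X : ExReg C} (f : A ⟶ B) (G : (embedding C).obj B ⟶ X)
    {T : C} (x : T ⟶ A) (z : T ⟶ X.rel.A) :
    HasValue ((embedding C).map f ≫ G) x z ↔ HasValue G (x ≫ f) z := by
  refine (hasValue_comp_iff _ _ _ _).trans ⟨?_, fun h ↦ ?_⟩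
  · rintro ⟨T', e, he, y, h₁, h₂⟩
    obtain rfl := (hasValue_map_iff _ _ _).1 h₁
    have h₂ : HasValue G ((e ≫ x) ≫ f) (e ≫ z) := h₂
    rw [Category.assoc] at h₂
    exact h₂.of_cover e
  · refine ⟨T, 𝟙 T, inferInstance, x ≫ f, (hasValue_map_iff f _ _).2 ?_, ?_⟩
    · exact congrArg (· ≫ f) (Category.id_comp x)
    · rw [Category.id_comp]
      exact h

/-- Maps from an object of `C` are equal if they have a common value. -/
theorem HasValue.map_comp_eq {T B B' : C} {X : ExReg C} {F : (embedding C).obj B ⟶ X}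
    {G : (embedding C).obj B' ⟶ X} {b : T ⟶ B} {b' : T ⟶ B'} {x : T ⟶ X.rel.A}
    (h : HasValue F b x) (h' : HasValue G b' x) :
    (embedding C).map b ≫ F = (embedding C).map b' ≫ G := by
  refine HasValue.eq_of_le fun t y hy ↦ ?_
  rw [hasValue_map_comp_iff] at hy ⊢
  exact (h'.precomp t).congr ((h.precomp t).rel hy)

theorem HasValue.of_map_comp_eq {T B B' : C} {X : ExReg C} {F : (embedding C).obj B ⟶ X}
    {G : (embedding C).obj B' ⟶ X} {b : T ⟶ B} {b' : T ⟶ B'} {x : T ⟶ X.rel.A}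
    (h : HasValue F b x) (h' : (embedding C).map b ≫ F = (embedding C).map b' ≫ G) :
    HasValue G b' x := by
  have : HasValue ((embedding C).map b' ≫ G) (𝟙 T) x := by
    rw [← h', hasValue_map_comp_iff, Category.id_comp]
    exact h
  rwa [hasValue_map_comp_iff, Category.id_comp] at this

/-- The quotient map. -/
noncomputable def quot (X : ExReg C) : (embedding C).obj X.rel.A ⟶ X where
  graph := X.subobject
  invariant {T x x' y y'} hx hy h := by
    obtain rfl := (PseudoEquivRel.rel_discrete_iff _ _).1 hx
    exact (holds_subobject_iff X x y').2 (((holds_subobject_iff X x y).1 h).trans hy)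
  total := (FunRel.id X).total
  singleValued := (FunRel.id X).singleValued

theorem hasValue_quot_iff (X : ExReg C) {T : C} (x y : T ⟶ X.rel.A) :
    HasValue X.quot x y ↔ X.rel.Rel x y :=
  holds_subobject_iff X x y

theorem map_comp_quot_iff (X : ExReg C) {T : C} (x y : T ⟶ X.rel.A) :
    (embedding C).map x ≫ X.quot = (embedding C).map y ≫ X.quot ↔ X.rel.Rel x y := by
  constructor
  · exact fun h ↦ ((hasValue_quot_iff X _ _).1
      (((hasValue_quot_iff X x x).2 (.refl _ x)).of_map_comp_eq h)).symm
  · exact fun h ↦ ((hasValue_quot_iff X x y).2 h).map_comp_eq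
      ((hasValue_quot_iff X y y).2 (.refl _ y))

/-- Totality of a functional relation says that it has a value over a cover, and such a value is a
lift. -/
theorem locSurj_quot (X : ExReg C) : LocSurj (strongEpis C) (embedding C) X.quot where
  exists_lift {T} F := by
    obtain ⟨T', e, he, x, hx⟩ := exists_hasValue F (𝟙 T)
    rw [Category.comp_id] at hx
    exact ⟨T', e, (embedding C).map x, he,
      ((hasValue_quot_iff X x x).2 (.refl _ x)).map_comp_eq hx⟩

/-- Values in a trivial equivalence relation are unique, so a value found over a cover descends
along that cover. -/
theorem exists_map_eq {A B : C} (F : (embedding C).obj A ⟶ (embedding C).obj B) :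
    ∃ f : A ⟶ B, (embedding C).map f = F := by
  obtain ⟨T, e, he, b, hb⟩ := exists_hasValue F (𝟙 A)
  rw [Category.comp_id] at hb
  let b' : T ⟶ B := b
  have hb : HasValue F e b' := hb
  obtain ⟨f, hf⟩ := exists_desc_of_isRegularEpi (f := e) inferInstance b' (fun t t' h ↦
    (PseudoEquivRel.rel_discrete_iff _ _).1 ((hb.precomp t).rel (h ▸ hb.precomp t')))
  refine ⟨f, HasValue.eq_of_le fun t x hx ↦ ?_⟩
  obtain rfl := (hasValue_map_iff _ _ _).1 hx
  have h : HasValue F (pullback.fst t e ≫ t) (pullback.fst t e ≫ t ≫ f) := by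
    have h : pullback.fst t e ≫ t ≫ f = pullback.snd t e ≫ b' := by
      rw [pullback.condition_assoc, hf]
    have h' := hb.precomp (pullback.snd t e)
    rw [← pullback.condition] at h'
    exact (h ▸ h' :)
  have : IsRegularEpi (pullback.fst t e) := inferInstance
  exact h.of_cover _

/-- The map is the relational composite of the converse of `π` with `f`. Local surjectivity of `π`
makes it total, and `hf` makes it single-valued. -/
theorem exists_desc {A : C} {X Y : ExReg C} (π : (embedding C).obj A ⟶ X)
    (hπ : LocSurj (strongEpis C) (embedding C) π) (f : (embedding C).obj A ⟶ Y)
    (hf : ∀ {T : C} (a a' : T ⟶ A), (embedding C).map a ≫ π = (embedding C).map a' ≫ π →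
      (embedding C).map a ≫ f = (embedding C).map a' ≫ f) : ∃ d : X ⟶ Y, π ≫ d = f := by
  let p : Subobject (A ⨯ X.rel.A) := FunRel.graph π
  let q : Subobject (A ⨯ Y.rel.A) := FunRel.graph f
  have hd {T : C} (x : T ⟶ X.rel.A) (y : T ⟶ Y.rel.A) :
      Holds (compRel (image (p.arrow ≫ prod.snd) (p.arrow ≫ prod.fst)) q) x y ↔
        ∃ (T' : C) (e : T' ⟶ T) (_ : StrongEpi e) (a : T' ⟶ A),
          HasValue π a (e ≫ x) ∧ HasValue f a (e ≫ y) := by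
    rw [holds_compRel_iff]
    constructor
    · rintro ⟨T', e, he, a, h₁, h₂⟩
      obtain ⟨T'', e', he', m, h₃, h₄⟩ := (holds_image_iff _ _ _ _).1 h₁
      refine ⟨T'', e' ≫ e, inferInstance, e' ≫ a, ?_, ?_⟩
      · rw [Category.assoc, ← h₃, ← h₄]
        exact (holds_arrow p).precomp m
      · rw [Category.assoc]
        exact Holds.precomp h₂ e'
    · rintro ⟨T', e, he, a, h₁, h₂⟩
      have h₁ : Holds p a (e ≫ x) := h₁
      have k : p.factorThru _ h₁ ≫ p.arrow = prod.lift a (e ≫ x) := p.factorThru_arrow _ h₁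
      exact ⟨T', e, he, a, (holds_image_iff _ _ _ _).2 ⟨T', 𝟙 _, inferInstance,
        p.factorThru _ h₁, by simp [reassoc_of% k], by simp [reassoc_of% k]⟩, h₂⟩
  let d : FunRel X Y :=
    { graph := compRel (image (p.arrow ≫ prod.snd) (p.arrow ≫ prod.fst)) q
      invariant := fun hx hy h ↦ by
        rw [hd] at h ⊢
        obtain ⟨T', e, he, a, h₁, h₂⟩ := h
        exact ⟨T', e, he, a, h₁.congr (hx.precomp e), h₂.congr (hy.precomp e)⟩
      total := (total_iff _).2 fun {T} x ↦ by
        obtain ⟨T', e, z, he, hz⟩ := hπ.exists_lift ((embedding C).map x ≫ X.quot)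
        obtain ⟨a, rfl⟩ := exists_map_eq z
        have he : StrongEpi e := he
        obtain ⟨S, e', he', y, hy⟩ := exists_hasValue f a
        refine ⟨S, e' ≫ e, inferInstance, y, (hd _ _).2 ⟨S, 𝟙 S, inferInstance, e' ≫ a, ?_, ?_⟩⟩
        · rw [← Category.assoc, ← Functor.map_comp] at hz
          simpa using (((hasValue_quot_iff X _ _).2 (.refl _ _)).of_map_comp_eq
            hz.symm).precomp e'
        · simpa using hy
      singleValued := fun {T x y y'} h h' ↦ by
        rw [hd] at h h'
        obtain ⟨T₁, e₁, he₁, a₁, h₁, k₁⟩ := h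
        obtain ⟨T₂, e₂, he₂, a₂, h₂, k₂⟩ := h'
        have i₁ : IsRegularEpi (pullback.fst e₁ e₂) := inferInstance
        have i₂ : StrongEpi (pullback.fst e₁ e₂ ≫ e₁) := inferInstance
        refine rel_of_cover Y (pullback.fst e₁ e₂ ≫ e₁) ?_
        have h₁' := h₁.precomp (pullback.fst e₁ e₂)
        have h₂' := h₂.precomp (pullback.snd e₁ e₂)
        rw [← pullback.condition_assoc] at h₂'
        have hk := (k₁.precomp (pullback.fst e₁ e₂)).of_map_comp_eq
          (hf _ _ (h₁'.map_comp_eq h₂'))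
        have k₂' := k₂.precomp (pullback.snd e₁ e₂)
        rw [← pullback.condition_assoc] at k₂'
        simpa using hk.rel k₂' }
  refine ⟨d, HasValue.eq_of_le fun {T} a y h ↦ ?_⟩
  obtain ⟨T', e, he, x, h₁, h₂⟩ := (hasValue_comp_iff _ _ _ _).1 h
  obtain ⟨S, e', he', a', h₃, h₄⟩ := (hd _ _).1 h₂
  have := h₄.of_map_comp_eq (hf _ _ (h₃.map_comp_eq (h₁.precomp e')))
  exact (this.of_cover e').of_cover e

/-- The class of `y` lifts locally along `f`, so the graph of a map `k` at `(y, z)` can be read off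
from `f ≫ k`. -/
theorem epi_of_locSurj {X Y : ExReg C} (f : X ⟶ Y)
    (hf : LocSurj (strongEpis C) (embedding C) f) : Epi f where
  left_cancellation {Z} g h hgh := by
    refine FunRel.eq_of_le (X := Y) (Y := Z) fun {T} y z hyz ↦ ?_
    obtain ⟨T', e, x, he, hx⟩ := hf.exists_lift ((embedding C).map y ≫ Y.quot)
    have he : StrongEpi e := he
    have key (k : Y ⟶ Z) : HasValue (x ≫ f ≫ k) (𝟙 T') (e ≫ z) ↔
        Holds (FunRel.graph k) y z := by
      rw [reassoc_of% hx, hasValue_map_comp_iff, hasValue_map_comp_iff, hasValue_comp_iff]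
      constructor
      · rintro ⟨S, e', he', w, h₁, h₂⟩
        have h₁ := (hasValue_quot_iff Y _ _).1 h₁
        simp only [Category.id_comp] at h₁
        have := FunRel.invariant k h₁.symm (.refl _ _) h₂
        exact .of_cover e (.of_cover e' this)
      · exact fun h ↦ ⟨T', 𝟙 T', inferInstance, e ≫ y, (hasValue_quot_iff Y _ _).2
          (by simpa using .refl _ _), by simpa using Holds.precomp h e⟩
    rw [← key, ← hgh, key]
    exact hyz

instance : IsExactCompletion (strongEpis C) (embedding C) where
  full := ⟨exists_map_eq⟩
  faithful := ⟨fun {A B f g} h ↦ by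
    have : HasValue ((embedding C).map g) (𝟙 A) f := by
      rw [← h, hasValue_map_iff, Category.id_comp]
    simpa using ((hasValue_map_iff _ _ _).1 this).symm⟩
  exists_cover X := ⟨X.rel, X.quot, locSurj_quot X, map_comp_quot_iff X⟩
  existsUnique_desc π hπ f hf := by
    have := epi_of_locSurj π hπ
    obtain ⟨d, hd⟩ := exists_desc π hπ f hf
    exact ⟨d, hd, fun d' hd' ↦ by rw [← cancel_epi π, hd, ← hd']⟩
  exists_quotient P hP := by
    obtain ⟨R, p₁, p₂, hm, hR⟩ := P.exists_jointlyMono hP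
    let X : ExReg C := ⟨P.ofRel p₁ p₂ hR, hm⟩
    exact ⟨X, X.quot, locSurj_quot X, fun a a' ↦ (map_comp_quot_iff X a a').trans (hR a a')⟩

instance {E : Type u} [Category.{v} E] [IsRegularLocos E] : IsArithmeticUniverse (ExReg E) :=
  IsExactCompletion.isArithmeticUniverse (strongEpis E) (embedding E)

end ExReg

/-! ### An exact category is its own exact completion -/

/-- Lifting the identity of `Y` over a cover factors that cover through `f`. -/
theorem LocSurj.isRegularEpi_id [Regular C] {X Y : C} {f : X ⟶ Y}
    (hf : LocSurj (strongEpis C) (𝟭 C) f) : IsRegularEpi f := by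
  obtain ⟨T, e, x, he, hx⟩ := hf.exists_lift (𝟙 Y)
  have he : StrongEpi e := he
  have hx : x ≫ f = e := hx.trans (Category.comp_id e)
  rw [← hx] at he
  have := strongEpi_of_strongEpi x f
  infer_instance

theorem PseudoEquivRel.isEquivalenceRelation [HasPullbacks C] (P : PseudoEquivRel C)
    (hP : JointlyMono₂ P.p₁ P.p₂) : IsEquivalenceRelation P.p₁ P.p₂ := by
  obtain ⟨r, hr₁, hr₂⟩ := P.reflexive
  obtain ⟨s, hs₁, hs₂⟩ := P.symmetric
  obtain ⟨t, ht₁, ht₂⟩ := P.transitive _ _ (pullback.condition (f := P.p₂) (g := P.p₁))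
  exact ⟨⟨{ r := r, s := s, c := _, isLimit := pullbackIsPullback _ _, t := t,
            right_cancellation := hP.right_cancellation }⟩⟩

/-- Through this, quotients of pseudo-equivalence relations become available in the target of a
functor to be extended. -/
theorem isExactCompletion_id [IsExact C] :
    have := IsExact.regular C
    IsExactCompletion (strongEpis C) (𝟭 C) :=
  have := IsExact.regular C
  { full := inferInstance
    faithful := inferInstance
    exists_cover X := ⟨.discrete X, 𝟙 X, ⟨fun {T} y ↦ ⟨T, 𝟙 T, y, IsCovering.id_mem T,
      (Category.comp_id y).trans (Category.id_comp y).symm⟩⟩, fun a a' ↦ Iff.trans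
      (cancel_mono (𝟙 X)) (PseudoEquivRel.rel_discrete_iff a a').symm⟩
    existsUnique_desc π hπ f hf := by
      have := hπ.isRegularEpi_id
      obtain ⟨d, hd⟩ := exists_desc_of_isRegularEpi this f hf
      exact ⟨d, hd, fun d' hd' ↦ by rw [← cancel_epi π, hd, ← hd']⟩
    exists_quotient P hP := by
      obtain ⟨R, p₁, p₂, hm, hR⟩ := P.exists_jointlyMono hP
      obtain ⟨⟨e⟩⟩ := IsExact.universallyEffective p₁ p₂
        ((P.ofRel p₁ p₂ hR).isEquivalenceRelation hm)
      have : IsRegularEpi e.π := ⟨⟨⟨_, _, _, _, e.toEffectiveEquivalenceRelation.isCoequalizer⟩⟩⟩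
      refine ⟨e.B, e.π, ⟨fun {T} y ↦ ⟨_, pullback.fst y e.π, pullback.snd y e.π,
        IsCovering.pullback_fst (J := strongEpis C) _ _ (inferInstanceAs (StrongEpi e.π)),
        pullback.condition.symm⟩⟩, fun a a' ↦ Iff.trans ?_ (hR a a')⟩
      exact ⟨fun h ↦ ⟨e.isKernelPair.lift a a' h, e.isKernelPair.lift_fst _ _ _,
        e.isKernelPair.lift_snd _ _ _⟩, fun ⟨r, h₁, h₂⟩ ↦ by
          simp [← h₁, ← h₂, e.isKernelPair.w]⟩ }

end

section

/-! ### Extending a functor along the exact completion -/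

variable {C : Type*} [Category* C] [HasFiniteLimits C] {D : Type*} [Category* D]
  {E : Type*} [Category* E]

/-- The functor `F` takes the covers in `C` to regular epimorphisms. -/
class MapsCovers (J : MorphismProperty C) (F : C ⥤ E) : Prop where
  isRegularEpi_map : ∀ {X Y : C} (e : X ⟶ Y), J e → IsRegularEpi (F.map e)

/-- The image of a pseudo-equivalence relation under a functor which preserves pullbacks. -/
def PseudoEquivRel.map (P : PseudoEquivRel C) (F : C ⥤ E) [PreservesFiniteLimits F] :
    PseudoEquivRel E where
  A := F.obj P.A
  R := F.obj P.R
  p₁ := F.map P.p₁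
  p₂ := F.map P.p₂
  reflexive := by
    obtain ⟨r, h₁, h₂⟩ := P.reflexive
    exact ⟨F.map r, by rw [← F.map_comp, h₁, F.map_id], by rw [← F.map_comp, h₂, F.map_id]⟩
  symmetric := by
    obtain ⟨r, h₁, h₂⟩ := P.symmetric
    exact ⟨F.map r, by rw [← F.map_comp, h₁], by rw [← F.map_comp, h₂]⟩
  transitive x y h := by
    have sq := (IsPullback.of_hasPullback P.p₂ P.p₁).map F
    obtain ⟨t, h₁, h₂⟩ := P.transitive _ _ (pullback.condition (f := P.p₂) (g := P.p₁))
    exact ⟨sq.lift x y h ≫ F.map t,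
      by rw [Category.assoc, ← F.map_comp, h₁, F.map_comp, sq.lift_fst_assoc],
      by rw [Category.assoc, ← F.map_comp, h₂, F.map_comp, sq.lift_snd_assoc]⟩

variable (J : MorphismProperty C) (I : C ⥤ D) (F : C ⥤ E)

/-- A cover of `X` by an object of `C`, and the corresponding quotient in `E`. -/
structure Presentation (X : D) where
  A : C
  π : I.obj A ⟶ X
  surj : LocSurj J I π
  obj : E
  ρ : F.obj A ⟶ obj
  isRegularEpi : IsRegularEpi ρ
  map_comp_ρ : ∀ {T : C} (a a' : T ⟶ A), I.map a ≫ π = I.map a' ≫ π → F.map a ≫ ρ = F.map a' ≫ ρ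
  exists_of_eq : ∀ {T : E} (t t' : T ⟶ F.obj A), t ≫ ρ = t' ≫ ρ →
    ∃ (T' : E) (e : T' ⟶ T) (_ : StrongEpi e) (V : C) (v v' : V ⟶ A) (s : T' ⟶ F.obj V),
      I.map v ≫ π = I.map v' ≫ π ∧ s ≫ F.map v = e ≫ t ∧ s ≫ F.map v' = e ≫ t'

variable [IsCovering J] [IsExactCompletion J I] [IsExact E] [PreservesFiniteLimits F]
  [MapsCovers J F]

omit [IsCovering J] [MapsCovers J F] in
-- The image under `F` of a pseudo-equivalence relation presenting `X` is divided out in `E`.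
-- Elements of `E` identified by the quotient are locally related, and the generic related pair over
-- `P.R` witnesses this in `C`.
theorem nonempty_presentation (X : D) : Nonempty (Presentation J I F X) := by
  have := IsExact.regular E
  have := isExactCompletion_id (C := E)
  obtain ⟨P, π, hπ, hP⟩ := IsExactCompletion.exists_cover (J := J) (I := I) X
  obtain ⟨Q, ρ, hρ, h⟩ := IsExactCompletion.exists_quotient_of_pseudoEquivRel (strongEpis E) (𝟭 E)
    (P.map F)
  refine ⟨⟨P.A, π, hπ, Q, ρ, hρ.isRegularEpi_id, fun {T} a a' haa' ↦ ?_, fun {T} t t' htt' ↦ ?_⟩⟩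
  · obtain ⟨r, h₁, h₂⟩ := (hP a a').1 haa'
    refine (h (F.map a) (F.map a')).2 ⟨_, 𝟙 _, IsCovering.id_mem _, F.map r, ?_, ?_⟩
    · exact (by rw [← h₁, F.map_comp] : F.map r ≫ F.map P.p₁ = F.map a).trans
        (Category.id_comp _).symm
    · exact (by rw [← h₂, F.map_comp] : F.map r ≫ F.map P.p₂ = F.map a').trans
        (Category.id_comp _).symm
  · obtain ⟨T', e, he, r, h₁, h₂⟩ := (h t t').1 htt'
    exact ⟨T', e, he, P.R, P.p₁, P.p₂, r, (hP _ _).2 ⟨𝟙 _, by simp, by simp⟩, h₁, h₂⟩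

variable {J I F}

omit [HasFiniteLimits C] [IsCovering J] [IsExact E] [PreservesFiniteLimits F] in
theorem MapsCovers.epi_map {X Y : C} (e : X ⟶ Y) (he : J e) : Epi (F.map e) :=
  have := MapsCovers.isRegularEpi_map (J := J) (F := F) e he
  inferInstance

namespace Presentation

variable {X : D} (p : Presentation J I F X)

/-- `x` has a representative in `p.A` over a cover of `T`. As `F` makes the cover a regular
epimorphism and preserves its kernel pair, the class of the representative descends to `F.obj T`. -/
theorem existsUnique_val {T : C} (x : I.obj T ⟶ X) : ∃! z : F.obj T ⟶ p.obj,
    ∀ {T' : C} (e : T' ⟶ T) (a : T' ⟶ p.A), I.map a ≫ p.π = I.map e ≫ x →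
      F.map a ≫ p.ρ = F.map e ≫ z := by
  obtain ⟨T₀, e₀, a₀, he₀, h₀⟩ := IsExactCompletion.exists_lift p.surj x
  have hreg := MapsCovers.isRegularEpi_map (J := J) (F := F) e₀ he₀
  obtain ⟨z, hz⟩ := exists_desc_of_isRegularEpi hreg (F.map a₀ ≫ p.ρ) (fun {S} t t' h ↦ by
    have sq := (IsPullback.of_hasPullback e₀ e₀).map F
    obtain ⟨m, rfl, rfl⟩ := sq.exists_lift t t' h
    rw [Category.assoc, Category.assoc,
      ← F.map_comp_assoc, ← F.map_comp_assoc]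
    refine congrArg _ (p.map_comp_ρ _ _ ?_)
    rw [I.map_comp_assoc, I.map_comp_assoc, h₀, ← I.map_comp_assoc, ← I.map_comp_assoc,
      pullback.condition])
  refine ⟨z, fun {T'} e a h ↦ ?_, fun z' hz' ↦ by
    rw [← cancel_epi (F.map e₀), hz, hz' e₀ a₀ h₀]⟩
  have := MapsCovers.epi_map (F := F) (pullback.fst e e₀)
    (IsCovering.pullback_fst (J := J) _ _ he₀)
  rw [← cancel_epi (F.map (pullback.fst e e₀)), ← F.map_comp_assoc _ e, pullback.condition,
    F.map_comp_assoc, hz, ← F.map_comp_assoc, ← F.map_comp_assoc]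
  refine p.map_comp_ρ _ _ ?_
  rw [I.map_comp_assoc, I.map_comp_assoc, h, h₀, ← I.map_comp_assoc, ← I.map_comp_assoc,
    pullback.condition]

/-- The generalised element of `p.obj` which corresponds to a generalised element of `X`. -/
noncomputable def val {T : C} (x : I.obj T ⟶ X) : F.obj T ⟶ p.obj :=
  (p.existsUnique_val x).choose

theorem map_comp_val_of_eq {T T' : C} {x : I.obj T ⟶ X} {e : T' ⟶ T} {a : T' ⟶ p.A}
    (h : I.map a ≫ p.π = I.map e ≫ x) : F.map a ≫ p.ρ = F.map e ≫ p.val x :=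
  (p.existsUnique_val x).choose_spec.1 e a h

theorem val_π : p.val p.π = p.ρ := by
  simpa using (p.map_comp_val_of_eq (x := p.π) (e := 𝟙 _) (a := 𝟙 _) rfl).symm

theorem val_map_comp {T T' : C} (e : T' ⟶ T) (x : I.obj T ⟶ X) :
    p.val (I.map e ≫ x) = F.map e ≫ p.val x := by
  obtain ⟨T₁, e₁, a, he₁, ha⟩ := IsExactCompletion.exists_lift p.surj (I.map e ≫ x)
  have := MapsCovers.epi_map (F := F) e₁ he₁
  rw [← cancel_epi (F.map e₁), ← p.map_comp_val_of_eq ha, ← F.map_comp_assoc]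
  exact p.map_comp_val_of_eq (by rw [ha, I.map_comp_assoc])

theorem exists_val {T : E} (z : T ⟶ p.obj) : ∃ (T' : E) (e : T' ⟶ T) (_ : StrongEpi e) (V : C)
    (x : I.obj V ⟶ X) (s : T' ⟶ F.obj V), s ≫ p.val x = e ≫ z := by
  have := IsExact.regular E
  have := p.isRegularEpi
  have : IsRegularEpi (pullback.fst z p.ρ) := inferInstance
  exact ⟨_, pullback.fst z p.ρ, inferInstance, p.A, p.π, pullback.snd _ _, by
    rw [val_π, pullback.condition]⟩

theorem hom_ext {Z : E} {f g : p.obj ⟶ Z}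
    (h : ∀ {T : C} (x : I.obj T ⟶ X), p.val x ≫ f = p.val x ≫ g) : f = g := by
  have := p.isRegularEpi
  rw [← cancel_epi p.ρ, ← val_π, h]

/-- With `val_map_comp` and `hom_ext`, this makes `p.obj` the colimit of the objects `F.obj T` over
the elements of `X`, so that the extension is a pointwise left Kan extension. -/
theorem exists_desc {Z : E} (f : ∀ {T : C}, (I.obj T ⟶ X) → (F.obj T ⟶ Z))
    (hf : ∀ {T T' : C} (e : T' ⟶ T) (x : I.obj T ⟶ X), f (I.map e ≫ x) = F.map e ≫ f x) :
    ∃ d : p.obj ⟶ Z, ∀ {T : C} (x : I.obj T ⟶ X), p.val x ≫ d = f x := by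
  obtain ⟨d, hd⟩ := exists_desc_of_isRegularEpi p.isRegularEpi (f p.π) (fun {S} t t' h ↦ by
    obtain ⟨T', e, he, V, v, v', s, h, h₁, h₂⟩ := p.exists_of_eq t t' h
    rw [← cancel_epi e, ← reassoc_of% h₁, ← reassoc_of% h₂, ← hf, ← hf, h])
  refine ⟨d, fun {T} x ↦ ?_⟩
  obtain ⟨T₁, e, a, he, ha⟩ := IsExactCompletion.exists_lift p.surj x
  have := MapsCovers.epi_map (F := F) e he
  rw [← cancel_epi (F.map e), ← reassoc_of% p.map_comp_val_of_eq ha, hd, ← hf, ← hf, ha]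

/-- An equality in `E` is traced back to an equality in `D` over a stage `W` in `C`. The elements
`x` and `x'` are represented over a cover by `b` and `b'`, and `W` is the pullback, preserved by
`F`, of the pair `(b, b')` against a pair known to be identified in `X`. -/
theorem exists_of_comp_val_eq {T : E} {V : C} {s : T ⟶ F.obj V} {x x' : I.obj V ⟶ X}
    (h : s ≫ p.val x = s ≫ p.val x') : ∃ (T' : E) (e : T' ⟶ T) (_ : StrongEpi e) (W : C)
      (w : W ⟶ V) (r : T' ⟶ F.obj W), I.map w ≫ x = I.map w ≫ x' ∧ r ≫ F.map w = e ≫ s := by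
  have := IsExact.regular E
  obtain ⟨V₂, c, b, b', hc, hb, hb'⟩ : ∃ (V₂ : C) (c : V₂ ⟶ V) (b b' : V₂ ⟶ p.A), J c ∧
      I.map b ≫ p.π = I.map c ≫ x ∧ I.map b' ≫ p.π = I.map c ≫ x' := by
    obtain ⟨V₁, e₁, a, he₁, ha⟩ := IsExactCompletion.exists_lift p.surj x
    obtain ⟨V₂, e₂, a', he₂, ha'⟩ := IsExactCompletion.exists_lift p.surj (I.map e₁ ≫ x')
    exact ⟨V₂, e₂ ≫ e₁, e₂ ≫ a, a', IsCovering.comp_mem _ _ he₂ he₁, by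
      rw [I.map_comp_assoc, ha, I.map_comp_assoc], by rw [ha', I.map_comp_assoc]⟩
  have := MapsCovers.isRegularEpi_map (F := F) c hc
  have : IsRegularEpi (pullback.fst s (F.map c)) := inferInstance
  let s₁ := pullback.snd s (F.map c)
  have hs₁ : s₁ ≫ F.map c = pullback.fst s (F.map c) ≫ s := pullback.condition.symm
  obtain ⟨T₂, e, he, V₀, v, v', r, hv, h₁, h₂⟩ := p.exists_of_eq (s₁ ≫ F.map b) (s₁ ≫ F.map b')
    (by rw [Category.assoc, Category.assoc, p.map_comp_val_of_eq hb, p.map_comp_val_of_eq hb',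
      reassoc_of% hs₁, reassoc_of% hs₁, h])
  have sq := (IsPullback.of_hasPullback (prod.lift b b') (prod.lift v v')).map F
  obtain ⟨m, hm₁, hm₂⟩ : ∃ m, m ≫ F.map (pullback.fst _ _) = e ≫ s₁ ∧
      m ≫ F.map (pullback.snd (prod.lift b b') (prod.lift v v')) = r := by
    refine sq.exists_lift (e ≫ s₁) r ?_
    refine fan_hom_ext (mapIsLimitOfPreservesOfIsLimit F _ _ (prodIsProd p.A p.A)) ?_ ?_
    · simp only [Category.assoc, ← F.map_comp, prod.lift_fst]
      exact h₁.symm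
    · simp only [Category.assoc, ← F.map_comp, prod.lift_snd]
      exact h₂.symm
  have k₁ : pullback.fst (prod.lift b b') (prod.lift v v') ≫ b = pullback.snd _ _ ≫ v := by
    simpa using congrArg (· ≫ prod.fst) (pullback.condition (f := prod.lift b b')
      (g := prod.lift v v'))
  have k₂ : pullback.fst (prod.lift b b') (prod.lift v v') ≫ b' = pullback.snd _ _ ≫ v' := by
    simpa using congrArg (· ≫ prod.snd) (pullback.condition (f := prod.lift b b')
      (g := prod.lift v v'))
  refine ⟨T₂, e ≫ pullback.fst s (F.map c), inferInstance, _, pullback.fst _ _ ≫ c, m, ?_, ?_⟩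
  · rw [I.map_comp_assoc, ← hb, ← I.map_comp_assoc, k₁, I.map_comp_assoc, hv, ← I.map_comp_assoc,
      ← k₂, I.map_comp_assoc, hb', ← I.map_comp_assoc]
  · rw [F.map_comp, reassoc_of% hm₁, hs₁, Category.assoc]

variable {Y : D} (q : Presentation J I F Y)

theorem exists_map (f : X ⟶ Y) :
    ∃ d : p.obj ⟶ q.obj, ∀ {T : C} (x : I.obj T ⟶ X), p.val x ≫ d = q.val (x ≫ f) :=
  p.exists_desc (fun x ↦ q.val (x ≫ f)) (fun e x ↦ by rw [Category.assoc, val_map_comp])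

/-- The map induced by `f`. -/
noncomputable def map (f : X ⟶ Y) : p.obj ⟶ q.obj :=
  (p.exists_map q f).choose

theorem val_comp_map (f : X ⟶ Y) {T : C} (x : I.obj T ⟶ X) :
    p.val x ≫ p.map q f = q.val (x ≫ f) :=
  (p.exists_map q f).choose_spec x

theorem exists_inverse {B : C} (p : Presentation J I F (I.obj B)) :
    ∃ d : p.obj ⟶ F.obj B, ∀ {T : C} (f : T ⟶ B), p.val (I.map f) ≫ d = F.map f := by
  obtain ⟨d, hd⟩ := p.exists_desc (fun x ↦ F.map ((IsExactCompletion.exists_map_eq J x).choose))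
    (fun e x ↦ by
      rw [← F.map_comp]
      refine congrArg F.map (IsExactCompletion.map_injective (I := I) J ?_)
      rw [(IsExactCompletion.exists_map_eq J _).choose_spec, I.map_comp,
        (IsExactCompletion.exists_map_eq J _).choose_spec])
  refine ⟨d, fun f ↦ ?_⟩
  rw [hd]
  exact congrArg F.map (IsExactCompletion.map_injective (I := I) J
    (IsExactCompletion.exists_map_eq J _).choose_spec)

theorem isIso_val_id {B : C} (p : Presentation J I F (I.obj B)) : IsIso (p.val (𝟙 (I.obj B))) := by
  obtain ⟨d, hd⟩ := p.exists_inverse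
  refine ⟨d, by rw [← I.map_id, hd, F.map_id], p.hom_ext fun x ↦ ?_⟩
  obtain ⟨e, rfl⟩ := IsExactCompletion.exists_map_eq J x
  rw [reassoc_of% hd, ← val_map_comp, Category.comp_id, Category.comp_id]

end Presentation

variable (J I F)

/-- The extension of `F` along the exact completion. -/
noncomputable def extend : D ⥤ E where
  obj X := (nonempty_presentation J I F X).some.obj
  map f := (nonempty_presentation J I F _).some.map (nonempty_presentation J I F _).some f
  map_id X := Presentation.hom_ext _ fun x ↦ by
    rw [Presentation.val_comp_map, Category.comp_id, Category.comp_id]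
  map_comp f g := Presentation.hom_ext _ fun x ↦ by
    rw [Presentation.val_comp_map, reassoc_of% Presentation.val_comp_map,
      Presentation.val_comp_map, Category.assoc]

/-- The generalised element of the image of `X` which corresponds to a generalised element of
`X`. -/
noncomputable def extendVal {T : C} {X : D} (x : I.obj T ⟶ X) : F.obj T ⟶ (extend J I F).obj X :=
  (nonempty_presentation J I F X).some.val x

theorem extendVal_comp_map {T : C} {X Y : D} (x : I.obj T ⟶ X) (f : X ⟶ Y) :
    extendVal J I F x ≫ (extend J I F).map f = extendVal J I F (x ≫ f) :=
  Presentation.val_comp_map _ _ f x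

theorem extendVal_map_comp {T T' : C} {X : D} (e : T' ⟶ T) (x : I.obj T ⟶ X) :
    extendVal J I F (I.map e ≫ x) = F.map e ≫ extendVal J I F x :=
  Presentation.val_map_comp _ e x

theorem exists_extendVal {T : E} {X : D} (z : T ⟶ (extend J I F).obj X) :
    ∃ (T' : E) (e : T' ⟶ T) (_ : StrongEpi e) (V : C) (x : I.obj V ⟶ X) (s : T' ⟶ F.obj V),
      s ≫ extendVal J I F x = e ≫ z :=
  Presentation.exists_val _ z

variable {J I F}

theorem exists_of_comp_extendVal_eq {T : E} {V : C} {X : D} {s : T ⟶ F.obj V}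
    {x x' : I.obj V ⟶ X} (h : s ≫ extendVal J I F x = s ≫ extendVal J I F x') :
    ∃ (T' : E) (e : T' ⟶ T) (_ : StrongEpi e) (W : C) (w : W ⟶ V) (r : T' ⟶ F.obj W),
      I.map w ≫ x = I.map w ≫ x' ∧ r ≫ F.map w = e ≫ s :=
  Presentation.exists_of_comp_val_eq _ h

variable (J I F)

instance isIso_extendVal_id (B : C) : IsIso (extendVal J I F (𝟙 (I.obj B))) :=
  Presentation.isIso_val_id _

/-- The extension of `F` restricts to `F`. -/
noncomputable def embeddingExtendIso : F ≅ I ⋙ extend J I F :=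
  NatIso.ofComponents (fun T ↦ asIso (extendVal J I F (𝟙 (I.obj T)))) fun e ↦ by
    rw [asIso_hom, asIso_hom, ← extendVal_map_comp, Functor.comp_map, extendVal_comp_map,
      Category.comp_id, Category.id_comp]

end

section

/-! ### Preservation properties of the extension -/

variable {C : Type*} [Category* C] {D : Type*} [Category* D] {E : Type*} [Category* E]

theorem exists_desc_of_strongEpi [Regular E] {X Y Z : E} (f : X ⟶ Y) [StrongEpi f] (g : X ⟶ Z)
    (h : ∀ {T : E} (x x' : T ⟶ X), x ≫ f = x' ≫ f → x ≫ g = x' ≫ g) : ∃ d : Y ⟶ Z, f ≫ d = g :=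
  exists_desc_of_isRegularEpi inferInstance g h

/-- In a regular category, a square is a pullback if it is one locally on generalised elements. -/
theorem isPullback_of_locally [Regular E] {P X Y Z : E} {p : P ⟶ X} {q : P ⟶ Y} {f : X ⟶ Z}
    {g : Y ⟶ Z} (w : p ≫ f = q ≫ g)
    (h : ∀ {T : E} (x : T ⟶ X) (y : T ⟶ Y), x ≫ f = y ≫ g →
      ∃ (T' : E) (e : T' ⟶ T) (_ : StrongEpi e) (z : T' ⟶ P), z ≫ p = e ≫ x ∧ z ≫ q = e ≫ y)
    (h' : ∀ {T : E} (z z' : T ⟶ P), z ≫ p = z' ≫ p → z ≫ q = z' ≫ q → z = z') :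
    IsPullback p q f g := by
  have key (s : PullbackCone f g) : ∃ z : s.pt ⟶ P, z ≫ p = s.fst ∧ z ≫ q = s.snd := by
    obtain ⟨T, e, he, z, h₁, h₂⟩ := h s.fst s.snd s.condition
    obtain ⟨d, hd⟩ := exists_desc_of_strongEpi e z fun x x' hx ↦ h' _ _
      (by rw [Category.assoc, h₁, reassoc_of% hx, Category.assoc, h₁])
      (by rw [Category.assoc, h₂, reassoc_of% hx, Category.assoc, h₂])
    exact ⟨d, by rw [← cancel_epi e, reassoc_of% hd, h₁], by
      rw [← cancel_epi e, reassoc_of% hd, h₂]⟩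
  exact ⟨⟨w⟩, ⟨PullbackCone.IsLimit.mk w (fun s ↦ (key s).choose) (fun s ↦ (key s).choose_spec.1)
    (fun s ↦ (key s).choose_spec.2) (fun s m h₁ h₂ ↦ h' _ _ (h₁.trans (key s).choose_spec.1.symm)
      (h₂.trans (key s).choose_spec.2.symm))⟩⟩

/-- Quotients are unique up to isomorphism, and the one constructed by elements is locally
surjective and effective. -/
theorem LocSurj.of_isRegularEpi [HasFiniteLimits C] {J : MorphismProperty C} [IsCovering J]
    {I : C ⥤ D} [IsExactCompletion J I] {R X Q : D} {p₁ p₂ : R ⟶ X} {π : X ⟶ Q}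
    (w : p₁ ≫ π = p₂ ≫ π) (hp : IsEquivalenceRelation p₁ p₂) (hc : IsColimit (Cofork.ofπ π w)) :
    LocSurj J I π ∧ IsKernelPair π p₁ p₂ := by
  obtain ⟨Q', q, hq, hk⟩ := IsExactCompletion.exists_isUniversallyEffective (J := J) (I := I)
    p₁ p₂ hp
  have := hq.isRegularEpi
  let i := hk.toCoequalizer'.coconePointUniqueUpToIso hc
  have hi : q ≫ i.hom = π :=
    hk.toCoequalizer'.comp_coconePointUniqueUpToIso_hom hc WalkingParallelPair.one
  rw [← hi]
  exact ⟨hq.comp .of_isIso, hk.comp_of_mono⟩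

variable [HasFiniteLimits C] (J : MorphismProperty C) (I : C ⥤ D) (F : C ⥤ E)
  [IsCovering J] [IsExactCompletion J I] [IsExact E] [PreservesFiniteLimits F] [MapsCovers J F]

/-- The separate stages `V₁` and `V₂` are replaced by their product, which `F` preserves. -/
theorem exists_extendVal₂ {T : E} {X Y : D} (x : T ⟶ (extend J I F).obj X)
    (y : T ⟶ (extend J I F).obj Y) : ∃ (T' : E) (e : T' ⟶ T) (_ : StrongEpi e) (V : C)
      (x₀ : I.obj V ⟶ X) (y₀ : I.obj V ⟶ Y) (s : T' ⟶ F.obj V),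
      s ≫ extendVal J I F x₀ = e ≫ x ∧ s ≫ extendVal J I F y₀ = e ≫ y := by
  obtain ⟨T₁, e₁, he₁, V₁, x₀, s₁, h₁⟩ := exists_extendVal J I F x
  obtain ⟨T₂, e₂, he₂, V₂, y₀, s₂, h₂⟩ := exists_extendVal J I F (e₁ ≫ y)
  let hP := mapIsLimitOfPreservesOfIsLimit F _ _ (prodIsProd V₁ V₂)
  refine ⟨T₂, e₂ ≫ e₁, inferInstance, V₁ ⨯ V₂, I.map prod.fst ≫ x₀, I.map prod.snd ≫ y₀,
    fanLift hP (e₂ ≫ s₁) s₂, ?_, ?_⟩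
  · rw [extendVal_map_comp, ← Category.assoc, fanLift_fst, Category.assoc, h₁, Category.assoc]
  · rw [extendVal_map_comp, ← Category.assoc, fanLift_snd, h₂, Category.assoc]

theorem isRegularEpi_extend_map {X Y : D} {f : X ⟶ Y} (hf : LocSurj J I f) :
    IsRegularEpi ((extend J I F).map f) := by
  have := IsExact.regular E
  refine LocSurj.isRegularEpi_id ⟨fun {T} y ↦ ?_⟩
  obtain ⟨T', e, he, V, y₀, s, hs⟩ := exists_extendVal J I F y
  obtain ⟨V', c, x₀, hc, hx₀⟩ := hf.exists_lift y₀
  have := MapsCovers.isRegularEpi_map (F := F) c hc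
  have : IsRegularEpi (pullback.fst s (F.map c)) := inferInstance
  refine ⟨_, pullback.fst s (F.map c) ≫ e, pullback.snd s (F.map c) ≫ extendVal J I F x₀,
    inferInstanceAs (StrongEpi (_ ≫ e)), ?_⟩
  rw [Category.assoc, extendVal_comp_map, hx₀, extendVal_map_comp, ← pullback.condition_assoc, hs]
  exact (Category.assoc _ _ _).symm

/-- Elements in `E` are locally values of elements in `D`, and equality of values is locally
witnessed over a stage in `C` by `exists_of_comp_extendVal_eq`; over that stage the pullback
property in `D` applies. -/
theorem isPullback_extend_map {P X Y Z : D} {p : P ⟶ X} {q : P ⟶ Y} {f : X ⟶ Z} {g : Y ⟶ Z}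
    (sq : IsPullback p q f g) : IsPullback ((extend J I F).map p) ((extend J I F).map q)
      ((extend J I F).map f) ((extend J I F).map g) := by
  have := IsExact.regular E
  refine isPullback_of_locally (by rw [← Functor.map_comp, sq.w, Functor.map_comp])
    (fun {T} x y h ↦ ?_) (fun {T} z z' h₁ h₂ ↦ ?_)
  · obtain ⟨T₁, e₁, he₁, V, x₀, y₀, s, hx, hy⟩ := exists_extendVal₂ J I F x y
    obtain ⟨T₂, e₂, he₂, W, w, r, hw, hr⟩ := exists_of_comp_extendVal_eq (J := J) (I := I) (F := F)
      (s := s) (x := x₀ ≫ f) (x' := y₀ ≫ g) (by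
        rw [← extendVal_comp_map, ← extendVal_comp_map, reassoc_of% hx, reassoc_of% hy, h])
    obtain ⟨c, hc₁, hc₂⟩ := sq.exists_lift (I.map w ≫ x₀) (I.map w ≫ y₀)
      (by rw [Category.assoc, hw, Category.assoc])
    refine ⟨T₂, e₂ ≫ e₁, inferInstance, r ≫ extendVal J I F c, ?_, ?_⟩
    · rw [Category.assoc, extendVal_comp_map, hc₁, extendVal_map_comp, reassoc_of% hr, hx,
        Category.assoc]
    · rw [Category.assoc, extendVal_comp_map, hc₂, extendVal_map_comp, reassoc_of% hr, hy,
        Category.assoc]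
  · obtain ⟨T₁, e₁, he₁, V, x, x', s, hx, hx'⟩ := exists_extendVal₂ J I F z z'
    obtain ⟨T₂, e₂, he₂, W, w, r, hw, hr⟩ := exists_of_comp_extendVal_eq (J := J) (I := I) (F := F)
      (s := s) (x := x ≫ p) (x' := x' ≫ p) (by
        rw [← extendVal_comp_map, ← extendVal_comp_map, reassoc_of% hx, reassoc_of% hx', h₁])
    obtain ⟨T₃, e₃, he₃, W', w', r', hw', hr'⟩ := exists_of_comp_extendVal_eq (J := J) (I := I)
      (F := F) (s := r) (x := I.map w ≫ x ≫ q) (x' := I.map w ≫ x' ≫ q) (by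
        rw [extendVal_map_comp, extendVal_map_comp, reassoc_of% hr, reassoc_of% hr,
          ← extendVal_comp_map, ← extendVal_comp_map, reassoc_of% hx, reassoc_of% hx', h₂])
    have key : I.map w' ≫ I.map w ≫ x = I.map w' ≫ I.map w ≫ x' :=
      sq.hom_ext (by simp only [Category.assoc, hw]) (by simpa only [Category.assoc] using hw')
    rw [← cancel_epi (e₃ ≫ e₂ ≫ e₁)]
    simp only [Category.assoc]
    rw [← hx, ← hx', ← reassoc_of% hr, ← reassoc_of% hr, ← reassoc_of% hr', ← reassoc_of% hr',
      ← extendVal_map_comp, ← extendVal_map_comp, ← extendVal_map_comp, ← extendVal_map_comp, key]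

theorem preservesFiniteLimits_extend [HasFiniteLimits D] :
    PreservesFiniteLimits (extend J I F) := by
  have : HasFiniteLimits E := inferInstance
  have hT : IsTerminal ((extend J I F).obj (I.obj (⊤_ C))) :=
    (IsTerminal.isTerminalObj F _ terminalIsTerminal).ofIso ((embeddingExtendIso J I F).app _)
  have : PreservesLimit (Functor.empty.{0} D) (extend J I F) :=
    preservesTerminal_of_iso _ (((extend J I F).mapIso (terminalIsTerminal.uniqueUpToIso
      (IsExactCompletion.nonempty_isTerminal_map J I).some)) ≪≫
        hT.uniqueUpToIso terminalIsTerminal)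
  have := preservesLimitsOfShape_pempty_of_preservesTerminal (extend J I F)
  have : PreservesLimitsOfShape WalkingCospan (extend J I F) :=
    preservesLimitsOfShape_walkingCospan_of_forall_isPullback fun X Y Z f g _ ↦
      ⟨_, _, _, .of_hasPullback f g, isPullback_extend_map J I F (.of_hasPullback f g)⟩
  exact preservesFiniteLimits_of_preservesTerminal_and_pullbacks _

/-- The extension preserves the sum `1 ⨿ 1` coming from `C`, where it restricts to `F`. Any sum `A ⨿
B` is pulled back from it; pullbacks are preserved, and extensivity of `E` returns the sum. -/
theorem preservesFiniteCoproducts_extend [HasFiniteLimits D] [FinitaryExtensive C]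
    [FinitaryExtensive D] [FinitaryExtensive E] [PreservesFiniteCoproducts F] :
    PreservesFiniteCoproducts (extend J I F) := by
  have : PreservesFiniteCoproducts (I ⋙ extend J I F) :=
    ⟨fun n ↦ preservesColimitsOfShape_of_natIso (embeddingExtendIso J I F)⟩
  refine preservesFiniteCoproducts_of_isSum _ ?_ (fun {A B} ↦ ?_)
  · obtain ⟨hI⟩ := IsExactCompletion.nonempty_isInitial_map (I := I) J (initialIsInitial (C := C))
    exact ⟨(IsInitial.isInitialObj (I ⋙ extend J I F) _ initialIsInitial).ofIso
      ((extend J I F).mapIso (hI.uniqueUpToIso initialIsInitial))⟩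
  · obtain ⟨hT⟩ := IsExactCompletion.nonempty_isTerminal_map J I
    have h₁ := (isSum_coprod (⊤_ C) (⊤_ C)).map (I := I) J
    obtain ⟨k, hk₁, hk₂⟩ := (isSum_coprod A B).exists_desc (hT.from A ≫ I.map coprod.inl)
      (hT.from B ≫ I.map coprod.inr)
    have h₂ := (isSum_coprod (⊤_ C) (⊤_ C)).map_of_preserves (I ⋙ extend J I F)
    have s₁ := isPullback_extend_map J I F (h₁.isPullback_inl (isSum_coprod A B) hk₁ hk₂)
    have s₂ := isPullback_extend_map J I F (h₁.isPullback_inr (isSum_coprod A B) hk₁ hk₂)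
    exact ((BinaryCofan.isVanKampen_iff _).1 (FinitaryExtensive.van_kampen' _ h₂.some)
      (BinaryCofan.mk _ _) _ _ _ s₁.w.symm s₂.w.symm).2 ⟨s₁, s₂⟩

end

/-! ### List objects under the extension -/

namespace ListAlg

theorem map_isHom_of_natTrans {C : Type*} [Category* C] {D : Type*} [Category* D]
    {E : Type*} [Category* E] [HasFiniteProducts C] [HasFiniteProducts D] {I : C ⥤ D}
    {F : C ⥤ E} {G : D ⥤ E} [PreservesFiniteProducts I] [PreservesFiniteProducts F]
    [PreservesFiniteProducts G] (θ : F ⟶ I ⋙ G) {A L : C} (S : ListAlg A L) :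
    (S.map F).IsHom ((S.map I).map G) (θ.app A) (θ.app L) := by
  have hP := mapIsLimitOfPreservesOfIsLimit F _ _ (prodIsProd A L)
  have hn (T : C) : (S.map F).nil (F.obj T) ≫ θ.app L = ((S.map I).map G).nil (F.obj T) := by
    rw [map_nil, θ.naturality, Functor.comp_map, ← S.map_nil I, ← (S.map I).map_nil G]
    exact comp_nil _ _
  have hc {T : C} (a : T ⟶ A) (l : T ⟶ L) : (S.map F).cons (F.map a) (F.map l) ≫ θ.app L =
      ((S.map I).map G).cons (F.map a ≫ θ.app A) (F.map l ≫ θ.app L) := by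
    rw [map_cons, θ.naturality, θ.naturality, θ.naturality, Functor.comp_map, Functor.comp_map,
      Functor.comp_map, ← S.map_cons I, ← (S.map I).map_cons G]
    exact comp_cons _ _ _ _
  refine ⟨fun T ↦ ?_, fun a l ↦ ?_⟩
  · rw [← (S.map F).comp_nil ((IsTerminal.isTerminalObj F _ terminalIsTerminal).from T),
      Category.assoc, hn, comp_nil]
  · have := congrArg (fanLift hP a l ≫ ·) (hc prod.fst prod.snd)
    simpa only [comp_cons, comp_cons_assoc, fanLift_fst, fanLift_snd, fanLift_fst_assoc,
      fanLift_snd_assoc] using this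

end ListAlg

section

variable {C : Type*} [Category* C] [IsLocos C] {D : Type*} [Category* D] [IsArithmeticUniverse D]
  {E : Type*} [Category* E] [IsArithmeticUniverse E] (J : MorphismProperty C) [IsCovering J]
  (I : C ⥤ D) [IsExactCompletion J I] (F : C ⥤ E) [MapsCovers J F]

/-- Universality is moved from `S.map F` along `θ`. As the object of entries changes too, the
isomorphism is regarded as a quotient by the trivial relation. -/
theorem isUniversal_map_map [PreservesFiniteProducts I] [PreservesFiniteProducts F]
    {G : D ⥤ E} [PreservesFiniteProducts G] (θ : F ≅ I ⋙ G) (hF : PreservesListObjects F)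
    {A L : C} {S : ListAlg A L} (hS : S.IsUniversal) : ((S.map I).map G).IsUniversal := by
  have : Regular E := IsExact.regular E
  intro X Y b g
  refine ListAlg.IsUniversal.of_quotient (hF.isUniversal_map hS) (hF.isUniversal_map hS) (.id _)
    (.id _) (S.map_isHom_of_natTrans θ.hom) rfl inferInstance inferInstance (fun l l' h ↦ ?_) b g
  exact ⟨_, 𝟙 _, l, inferInstance, by simp, by simpa [cancel_mono] using h⟩

/-- The extension carries the presentation of `LX` as a quotient of lists from `C` to a presentation
of the same kind in `E`, where `ListAlg.IsUniversal.of_quotient` applies. -/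
theorem preservesListObjects_extend [PreservesFiniteLimits F] (hF : PreservesListObjects F) :
    PreservesListObjects (extend J I F) := by
  have : Regular E := IsExact.regular E
  have := IsExactCompletion.preservesFiniteLimits J I
  have := preservesFiniteLimits_extend J I F
  intro A' L' T' P' nil fst snd cons h'
  refine ListAlg.preservesListObjects (extend J I F) (fun X ↦ ?_) nil fst snd cons h'
  obtain ⟨A, R, L, LR, p₁, p₂, q₁, q₂, S, SR, π, LX, SX, κ, hS, hSR, h₁, h₂, hp, hπ, h, hκ, hq,
    hSX⟩ := IsExactCompletion.exists_isUniversal J I X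
  refine ⟨LX, SX, hSX, fun {Y Z} b g ↦ ?_⟩
  have hw : I.map q₁ ≫ κ = I.map q₂ ≫ κ :=
    ListAlg.IsUniversal.isHom_ext (PreservesListObjects.isUniversal_map
      (IsExactCompletion.isLocosFunctor J I).preservesListObjects hSR)
      ((ListAlg.map_isHom I h₁).comp h) (hp ▸ (ListAlg.map_isHom I h₂).comp h)
  -- The lists of related pairs cover the kernel pair of `κ`. The extension preserves this kernel
  -- pair and makes the cover a regular epimorphism, so lists identified in `E` are locally related.
  have hc : LocSurj J I (pullback.lift _ _ hw) := ⟨fun {T} y ↦ by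
    obtain ⟨l, hl⟩ := IsExactCompletion.exists_map_eq J (y ≫ pullback.fst κ κ)
    obtain ⟨l', hl'⟩ := IsExactCompletion.exists_map_eq J (y ≫ pullback.snd κ κ)
    obtain ⟨T', e, he, t, ht₁, ht₂⟩ := hq l l' (by
      rw [hl, hl', Category.assoc, Category.assoc, pullback.condition])
    refine ⟨T', e, I.map t, he, pullback.hom_ext ?_ ?_⟩
    · rw [Category.assoc, pullback.lift_fst, Category.assoc, ← hl, ← I.map_comp, ht₁, I.map_comp]
    · rw [Category.assoc, pullback.lift_snd, Category.assoc, ← hl', ← I.map_comp, ht₂,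
        I.map_comp]⟩
  refine ListAlg.IsUniversal.of_quotient (isUniversal_map_map I F (embeddingExtendIso J I F) hF hSR)
    (isUniversal_map_map I F (embeddingExtendIso J I F) hF hS)
    (ListAlg.map_isHom _ (ListAlg.map_isHom I h₁)) (ListAlg.map_isHom _ (ListAlg.map_isHom I h₂))
    (ListAlg.map_isHom _ h) (by rw [← Functor.map_comp, hp, Functor.map_comp])
    (isRegularEpi_extend_map J I F hπ) (isRegularEpi_extend_map J I F hκ) (fun {T} l l' hl ↦ ?_) b g
  have sq := isPullback_extend_map J I F (.of_hasPullback κ κ)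
  obtain ⟨m, rfl, rfl⟩ := sq.exists_lift l l' hl
  have := isRegularEpi_extend_map J I F hc
  have : IsRegularEpi (pullback.fst m ((extend J I F).map (pullback.lift _ _ hw))) := inferInstance
  refine ⟨_, pullback.fst m ((extend J I F).map (pullback.lift _ _ hw)), pullback.snd _ _,
    inferInstance, ?_, ?_⟩
  · rw [pullback.condition_assoc, ← Functor.map_comp, pullback.lift_fst]
  · rw [pullback.condition_assoc, ← Functor.map_comp, pullback.lift_snd]

theorem isAUFunctor_extend [PreservesFiniteLimits F] (hF : IsLocosFunctor F) :
    IsAUFunctor (extend J I F) where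
  preservesFiniteLimits := preservesFiniteLimits_extend J I F
  preservesFiniteCoproducts :=
    have := hF.preservesFiniteCoproducts
    preservesFiniteCoproducts_extend J I F
  preservesListObjects := preservesListObjects_extend J I F hF.preservesListObjects
  isColimit_map p₁ p₂ π w hp := fun ⟨hc⟩ ↦ by
    obtain ⟨hπ, hk⟩ := LocSurj.of_isRegularEpi (J := J) (I := I) w hp hc
    have := isRegularEpi_extend_map J I F hπ
    exact ⟨(show IsKernelPair _ _ _ from isPullback_extend_map J I F hk).toCoequalizer'⟩

end

section

/-! ### Restricting functors and transformations along the exact completion -/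

variable {C : Type*} [Category* C] [HasFiniteLimits C] {D : Type*} [Category* D]
  {E : Type*} [Category* E] {J : MorphismProperty C} [IsCovering J] {I : C ⥤ D}
  [IsExactCompletion J I] {G G' : D ⥤ E}
include J

variable (J I) in
theorem natTrans_ext_of_embedding
    (hG : ∀ {X Y : D} (f : X ⟶ Y), IsRegularEpi f → IsRegularEpi (G.map f)) {α β : G ⟶ G'}
    (h : ∀ A : C, α.app (I.obj A) = β.app (I.obj A)) : α = β := by
  ext X
  obtain ⟨P, π, hπ, -⟩ := IsExactCompletion.exists_cover (J := J) (I := I) X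
  have := hG π hπ.isRegularEpi
  rw [← cancel_epi (G.map π), α.naturality, β.naturality, h]

variable [HasPullbacks D] [PreservesLimitsOfShape WalkingCospan G]

variable (J) in
-- On a cover `π` of `X` the component must be `θ` followed by `G'.map π`. Compatibility on the
-- kernel pair of `π`, which `G` preserves, is checked on a further cover from `C`; there the
-- projections come from `C` and naturality of `θ` applies.
theorem exists_desc_natTrans
    (hG : ∀ {X Y : D} (f : X ⟶ Y), IsRegularEpi f → IsRegularEpi (G.map f))
    (θ : I ⋙ G ⟶ I ⋙ G') (X : D) : ∃ d : G.obj X ⟶ G'.obj X, ∀ {T : C} (x : I.obj T ⟶ X),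
      G.map x ≫ d = θ.app T ≫ G'.map x := by
  have hθ {T T' : C} (e : T ⟶ T') {Z : E} (z : G'.obj (I.obj T') ⟶ Z) :
      G.map (I.map e) ≫ θ.app T' ≫ z = θ.app T ≫ G'.map (I.map e) ≫ z := by
    simpa using θ.naturality_assoc e z
  obtain ⟨P, π, hπ, -⟩ := IsExactCompletion.exists_cover (J := J) (I := I) X
  obtain ⟨V, κ, hκ, -⟩ := IsExactCompletion.exists_cover (J := J) (I := I) (pullback π π)
  have := hG κ hκ.isRegularEpi
  obtain ⟨d, hd⟩ := exists_desc_of_isRegularEpi (hG π hπ.isRegularEpi) (θ.app _ ≫ G'.map π)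
    (fun {T} t t' h ↦ by
      obtain ⟨m, rfl, rfl⟩ := ((IsPullback.of_hasPullback π π).map G).exists_lift t t' h
      rw [Category.assoc, Category.assoc]
      congr 1
      rw [← cancel_epi (G.map κ), ← G.map_comp_assoc, ← G.map_comp_assoc]
      obtain ⟨v, hv⟩ := IsExactCompletion.exists_map_eq J (κ ≫ pullback.fst π π)
      obtain ⟨v', hv'⟩ := IsExactCompletion.exists_map_eq J (κ ≫ pullback.snd π π)
      rw [← hv, ← hv', hθ, hθ, ← G'.map_comp, ← G'.map_comp, hv, hv', Category.assoc,
        Category.assoc, pullback.condition])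
  refine ⟨d, fun {T} x ↦ ?_⟩
  obtain ⟨T', e, a, he, ha⟩ := IsExactCompletion.exists_lift hπ x
  have := hG (I.map e) (IsExactCompletion.locSurj_map (J := J) (I := I) he).isRegularEpi
  rw [← cancel_epi (G.map (I.map e)), ← G.map_comp_assoc, ← ha, G.map_comp_assoc, hd, hθ, hθ,
    ← G'.map_comp, ha, G'.map_comp]

variable (J) in
/-- Transformations extend along the exact completion. -/
theorem exists_natTrans_of_embedding
    (hG : ∀ {X Y : D} (f : X ⟶ Y), IsRegularEpi f → IsRegularEpi (G.map f))
    (θ : I ⋙ G ⟶ I ⋙ G') : ∃ α : G ⟶ G', ∀ A : C, α.app (I.obj A) = θ.app A := by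
  refine ⟨⟨fun X ↦ (exists_desc_natTrans J hG θ X).choose, fun X Y f ↦ ?_⟩, fun A ↦ ?_⟩
  · obtain ⟨P, π, hπ, -⟩ := IsExactCompletion.exists_cover (J := J) (I := I) X
    have := hG π hπ.isRegularEpi
    rw [← cancel_epi (G.map π), ← G.map_comp_assoc, (exists_desc_natTrans J hG θ Y).choose_spec,
      reassoc_of% (exists_desc_natTrans J hG θ X).choose_spec, G'.map_comp]
  · simpa using (exists_desc_natTrans J hG θ (I.obj A)).choose_spec (𝟙 _)

end

/-! ### Biadjunctions between 2-categories of functors -/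

section

universe w₁ w₂

variable {ι : Type w₁} (c : ι → Type u) [∀ i, Category.{v} (c i)]
  (P : ∀ i j, ObjectProperty (c i ⥤ c j)) {κ : Type w₂} (e : κ → ι)
  (Q : ∀ k l, ObjectProperty (c (e k) ⥤ c (e l)))

/-- Functors `c i ⥤ c (e (L i))` along which functors and natural transformations extend. -/
structure UniversalFunctors where
  L : ι → κ
  I (i : ι) : c i ⥤ c (e (L i))
  prop_I (i : ι) : P i (e (L i)) (I i)
  exists_ext {i : ι} {k : κ} (F : c i ⥤ c (e k)) (hF : P i (e k) F) :
    ∃ G : c (e (L i)) ⥤ c (e k), Q (L i) k G ∧ Nonempty (F ≅ I i ⋙ G)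
  hom_ext {i : ι} {k : κ} {G G' : c (e (L i)) ⥤ c (e k)} (hG : Q (L i) k G) {α β : G ⟶ G'}
    (h : ∀ A, α.app ((I i).obj A) = β.app ((I i).obj A)) : α = β
  exists_hom {i : ι} {k : κ} {G G' : c (e (L i)) ⥤ c (e k)} (hG : Q (L i) k G)
    (θ : I i ⋙ G ⟶ I i ⋙ G') : ∃ α : G ⟶ G', ∀ A, α.app ((I i).obj A) = θ.app A

variable {c P e Q}

namespace UniversalFunctors

variable (S : UniversalFunctors c P e Q)

section

variable {i : ι} {k : κ} {G G' : c (e (S.L i)) ⥤ c (e k)}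

/-- The extension of a natural transformation. -/
noncomputable def lift (hG : Q (S.L i) k G) (θ : S.I i ⋙ G ⟶ S.I i ⋙ G') : G ⟶ G' :=
  (S.exists_hom hG θ).choose

@[simp]
theorem lift_app (hG : Q (S.L i) k G) (θ : S.I i ⋙ G ⟶ S.I i ⋙ G') (A : c i) :
    (S.lift hG θ).app ((S.I i).obj A) = θ.app A :=
  (S.exists_hom hG θ).choose_spec A

/-- The extension of a natural isomorphism. -/
@[simps]
noncomputable def liftIso (hG : Q (S.L i) k G) (hG' : Q (S.L i) k G')
    (θ : S.I i ⋙ G ≅ S.I i ⋙ G') : G ≅ G' where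
  hom := S.lift hG θ.hom
  inv := S.lift hG' θ.inv
  hom_inv_id := S.hom_ext hG fun A ↦ by simp
  inv_hom_id := S.hom_ext hG' fun A ↦ by simp

end

variable (hid : ∀ i, P i i (𝟭 (c i)))
  (hcomp : ∀ {i j k} {F : c i ⥤ c j} {G : c j ⥤ c k}, P i j F → P j k G → P i k (F ⋙ G))
  (hid' : ∀ k, Q k k (𝟭 (c (e k))))
  (hcomp' : ∀ {k l m} {F : c (e k) ⥤ c (e l)} {G : c (e l) ⥤ c (e m)}, Q k l F → Q l m G →
    Q k m (F ⋙ G))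

/-- The functor induced by `F`. -/
noncomputable def map {i j : ι} {F : c i ⥤ c j} (hF : P i j F) :
    c (e (S.L i)) ⥤ c (e (S.L j)) :=
  (S.exists_ext (F ⋙ S.I j) (hcomp hF (S.prop_I j))).choose

variable {i j k l : ι} {F F' F'' : c i ⥤ c j} {G G' : c j ⥤ c k} {H : c k ⥤ c l}

theorem prop_map (hF : P i j F) : Q (S.L i) (S.L j) (S.map hcomp hF) :=
  (S.exists_ext (F ⋙ S.I j) (hcomp hF (S.prop_I j))).choose_spec.1

/-- The functor induced by `F` extends `F`. -/
noncomputable def mapIso (hF : P i j F) : F ⋙ S.I j ≅ S.I i ⋙ S.map hcomp hF :=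
  (S.exists_ext (F ⋙ S.I j) (hcomp hF (S.prop_I j))).choose_spec.2.some

/-- The transformation induced by `α`. -/
noncomputable def map₂ (hF : P i j F) (hF' : P i j F') (α : F ⟶ F') :
    S.map hcomp hF ⟶ S.map hcomp hF' :=
  S.lift (S.prop_map hcomp hF)
    ((S.mapIso hcomp hF).inv ≫ Functor.whiskerRight α _ ≫ (S.mapIso hcomp hF').hom)

@[simp]
theorem map₂_app (hF : P i j F) (hF' : P i j F') (α : F ⟶ F') (A : c i) :
    (S.map₂ hcomp hF hF' α).app ((S.I i).obj A) = (S.mapIso hcomp hF).inv.app A ≫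
      (S.I j).map (α.app A) ≫ (S.mapIso hcomp hF').hom.app A := by
  simp [map₂]

/-- This and the following coherence laws are equalities between transformations of extended
functors, so `hom_ext` reduces them to components on the image of `S.I`, which `mapIso` determines.
-/
theorem map₂_id (hF : P i j F) : S.map₂ hcomp hF hF (𝟙 F) = 𝟙 _ :=
  S.hom_ext (S.prop_map hcomp hF) fun A ↦ by simp

theorem map₂_comp (hF : P i j F) (hF' : P i j F') (hF'' : P i j F'') (α : F ⟶ F')
    (β : F' ⟶ F'') : S.map₂ hcomp hF hF'' (α ≫ β) =
      S.map₂ hcomp hF hF' α ≫ S.map₂ hcomp hF' hF'' β :=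
  S.hom_ext (S.prop_map hcomp hF) fun A ↦ by simp

/-- The functor induced by the identity is isomorphic to the identity. -/
noncomputable def mapId (i : ι) : S.map hcomp (hid i) ≅ 𝟭 (c (e (S.L i))) :=
  S.liftIso (S.prop_map hcomp _) (hid' _) (S.mapIso hcomp (hid i)).symm

@[simp]
theorem mapId_hom_app (i : ι) (A : c i) : (S.mapId hid hcomp hid' i).hom.app ((S.I i).obj A) =
    (S.mapIso hcomp (hid i)).inv.app A := by
  simp [mapId]

/-- The functor induced by a composite is isomorphic to the composite of the induced functors. -/
noncomputable def mapComp (hF : P i j F) (hG : P j k G) :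
    S.map hcomp (hcomp hF hG) ≅ S.map hcomp hF ⋙ S.map hcomp hG :=
  S.liftIso (S.prop_map hcomp _) (hcomp' (S.prop_map hcomp hF) (S.prop_map hcomp hG))
    ((S.mapIso hcomp (hcomp hF hG)).symm ≪≫ Functor.isoWhiskerLeft F (S.mapIso hcomp hG) ≪≫
      Functor.isoWhiskerRight (S.mapIso hcomp hF) (S.map hcomp hG))

@[simp]
theorem mapComp_hom_app (hF : P i j F) (hG : P j k G) (A : c i) :
    (S.mapComp hcomp hcomp' hF hG).hom.app ((S.I i).obj A) =
      (S.mapIso hcomp (hcomp hF hG)).inv.app A ≫ (S.mapIso hcomp hG).hom.app (F.obj A) ≫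
        (S.map hcomp hG).map ((S.mapIso hcomp hF).hom.app A) := by
  simp [mapComp]

@[simp]
theorem mapComp_inv_app (hF : P i j F) (hG : P j k G) (A : c i) :
    (S.mapComp hcomp hcomp' hF hG).inv.app ((S.I i).obj A) =
      (S.map hcomp hG).map ((S.mapIso hcomp hF).inv.app A) ≫
        (S.mapIso hcomp hG).inv.app (F.obj A) ≫ (S.mapIso hcomp (hcomp hF hG)).hom.app A := by
  simp [mapComp]

theorem map₂_whiskerLeft (hF : P i j F) (hG : P j k G) (hG' : P j k G') (α : G ⟶ G') :
    S.map₂ hcomp (hcomp hF hG) (hcomp hF hG') (Functor.whiskerLeft F α) =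
      (S.mapComp hcomp hcomp' hF hG).hom ≫
        Functor.whiskerLeft (S.map hcomp hF) (S.map₂ hcomp hG hG' α) ≫
        (S.mapComp hcomp hcomp' hF hG').inv :=
  S.hom_ext (S.prop_map hcomp _) fun A ↦ by
    simp

theorem map₂_whiskerRight (hF : P i j F) (hF' : P i j F') (hG : P j k G) (α : F ⟶ F') :
    S.map₂ hcomp (hcomp hF hG) (hcomp hF' hG) (Functor.whiskerRight α G) =
      (S.mapComp hcomp hcomp' hF hG).hom ≫
        Functor.whiskerRight (S.map₂ hcomp hF hF' α) (S.map hcomp hG) ≫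
        (S.mapComp hcomp hcomp' hF' hG).inv :=
  S.hom_ext (S.prop_map hcomp _) fun A ↦ by
    have h {Z} := (S.mapIso hcomp hG).hom.naturality_assoc (α.app A) (Z := Z)
    simp only [Functor.comp_map] at h
    simp [← h]

theorem map₂_associator (hF : P i j F) (hG : P j k G) (hH : P k l H) :
    S.map₂ hcomp (hcomp (hcomp hF hG) hH) (hcomp hF (hcomp hG hH)) (Functor.associator F G H).hom =
      (S.mapComp hcomp hcomp' (hcomp hF hG) hH).hom ≫
        Functor.whiskerRight (S.mapComp hcomp hcomp' hF hG).hom (S.map hcomp hH) ≫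
        (Functor.associator _ _ _).hom ≫
        Functor.whiskerLeft (S.map hcomp hF) (S.mapComp hcomp hcomp' hG hH).inv ≫
        (S.mapComp hcomp hcomp' hF (hcomp hG hH)).inv :=
  S.hom_ext (S.prop_map hcomp _) fun A ↦ by
    have h : (S.mapComp hcomp hcomp' hG hH).inv.app ((S.map hcomp hF).obj ((S.I i).obj A)) ≫
        (S.map hcomp (hcomp hG hH)).map ((S.mapIso hcomp hF).inv.app A) =
        (S.map hcomp hH).map ((S.map hcomp hG).map ((S.mapIso hcomp hF).inv.app A)) ≫
          (S.mapComp hcomp hcomp' hG hH).inv.app ((S.I j).obj (F.obj A)) :=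
      ((S.mapComp hcomp hcomp' hG hH).inv.naturality _).symm
    have h' {Z : c (e (S.L l))} (z : _ ⟶ Z) :
        (S.map hcomp hH).map ((S.map hcomp hG).map ((S.mapIso hcomp hF).hom.app A)) ≫
        (S.map hcomp hH).map ((S.map hcomp hG).map ((S.mapIso hcomp hF).inv.app A)) ≫ z = z := by
      rw [← Functor.map_comp_assoc, ← Functor.map_comp, Iso.hom_inv_id_app,
        CategoryTheory.Functor.map_id, CategoryTheory.Functor.map_id]
      exact Category.id_comp z
    simp [reassoc_of% h, h']

theorem map₂_leftUnitor (hF : P i j F) :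
    S.map₂ hcomp (hcomp (hid i) hF) hF (Functor.leftUnitor F).hom =
      (S.mapComp hcomp hcomp' (hid i) hF).hom ≫
        Functor.whiskerRight (S.mapId hid hcomp hid' i).hom (S.map hcomp hF) ≫
        (Functor.leftUnitor _).hom :=
  S.hom_ext (S.prop_map hcomp _) fun A ↦ by
    simp

theorem map₂_rightUnitor (hF : P i j F) :
    S.map₂ hcomp (hcomp hF (hid j)) hF (Functor.rightUnitor F).hom =
      (S.mapComp hcomp hcomp' hF (hid j)).hom ≫
        Functor.whiskerLeft (S.map hcomp hF) (S.mapId hid hcomp hid' j).hom ≫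
        (Functor.rightUnitor _).hom :=
  S.hom_ext (S.prop_map hcomp _) fun A ↦ by
    simp

end UniversalFunctors

end

/-! ### The pseudofunctor and the biadjunction given by universal functors -/

section

universe w₁ w₂

variable {ι : Type w₁} (c : ι → Type u) [∀ i, Category.{v} (c i)]
  (P : ∀ i j, ObjectProperty (c i ⥤ c j)) {κ : Type w₂} (e : κ → ι)
  (Q : ∀ k l, ObjectProperty (c (e k) ⥤ c (e l)))
  (hid : ∀ i, P i i (𝟭 (c i)))
  (hcomp : ∀ {i j k} {F : c i ⥤ c j} {G : c j ⥤ c k}, P i j F → P j k G → P i k (F ⋙ G))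
  (hid' : ∀ k, Q k k (𝟭 (c (e k))))
  (hcomp' : ∀ {k l m} {F : c (e k) ⥤ c (e l)} {G : c (e l) ⥤ c (e m)}, Q k l F → Q l m G →
    Q k m (F ⋙ G))
  (hQ : ∀ {k l} {F : c (e k) ⥤ c (e l)}, Q k l F → P (e k) (e l) F)

/-- The inclusion of a 2-category of functors into one with more functors. -/
def forgetOfLE :
    letI := bicategoryOfFunctors c P hid hcomp
    letI := bicategoryOfFunctors (fun k ↦ c (e k)) Q hid' hcomp'
    κ ⥤ᵖ ι :=
  letI := bicategoryOfFunctors c P hid hcomp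
  letI := bicategoryOfFunctors (fun k ↦ c (e k)) Q hid' hcomp'
  { obj k := e k
    map F := ⟨F.obj, hQ F.property⟩
    map₂ η := ObjectProperty.homMk η.hom
    mapId _ := Iso.refl _
    mapComp _ _ := Iso.refl _
    map₂_whisker_left _ _ _ _ := ObjectProperty.hom_ext _ (NatTrans.ext (funext fun _ ↦
      (by simp : ∀ {C : Type u} [Category.{v} C] {X Y : C} (f : X ⟶ Y), f = 𝟙 _ ≫ f ≫ 𝟙 _) _))
    map₂_whisker_right _ _ := ObjectProperty.hom_ext _ (NatTrans.ext (funext fun _ ↦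
      (by simp : ∀ {C : Type u} [Category.{v} C] {X Y : C} (f : X ⟶ Y), f = 𝟙 _ ≫ f ≫ 𝟙 _) _))
    map₂_associator _ _ H := ObjectProperty.hom_ext _ (NatTrans.ext (funext fun X ↦ by
      change 𝟙 _ = 𝟙 _ ≫ H.obj.map (𝟙 _) ≫ 𝟙 _ ≫ 𝟙 _ ≫ 𝟙 _
      simp))
    map₂_left_unitor F := ObjectProperty.hom_ext _ (NatTrans.ext (funext fun X ↦ by
      change 𝟙 _ = 𝟙 _ ≫ F.obj.map (𝟙 _) ≫ 𝟙 _
      simp))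
    map₂_right_unitor F := ObjectProperty.hom_ext _ (NatTrans.ext (funext fun X ↦ by
      change 𝟙 _ = 𝟙 _ ≫ 𝟙 _ ≫ 𝟙 _
      simp)) }

namespace UniversalFunctors

variable {c P e Q} (S : UniversalFunctors c P e Q)

theorem mapIso_naturality {i j : ι} {F F' : c i ⥤ c j} (hF : P i j F) (hF' : P i j F')
    (α : F ⟶ F') (A : c i) : (S.I j).map (α.app A) ≫ (S.mapIso hcomp hF').hom.app A =
      (S.mapIso hcomp hF).hom.app A ≫ (S.map₂ hcomp hF hF' α).app ((S.I i).obj A) := by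
  simp

/-- The identities are kept in the form to which the axiom of a strong transformation unfolds. -/
theorem mapIso_id {i : ι} (A : c i) : (S.mapIso hcomp (hid i)).hom.app A ≫
    (S.mapId hid hcomp hid' i).hom.app ((S.I i).obj A) ≫ 𝟙 _ = (S.I i).map (𝟙 A) ≫ 𝟙 _ ≫ 𝟙 _ := by
  simp

theorem mapIso_comp {i j k : ι} {F : c i ⥤ c j} {G : c j ⥤ c k} (hF : P i j F) (hG : P j k G)
    (A : c i) : (S.mapIso hcomp (hcomp hF hG)).hom.app A ≫
      (S.mapComp hcomp hcomp' hF hG).hom.app ((S.I i).obj A) ≫ 𝟙 _ =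
        (S.I k).map (𝟙 _) ≫ 𝟙 _ ≫ (S.mapIso hcomp hG).hom.app (F.obj A) ≫
          𝟙 _ ≫ (S.map hcomp hG).map ((S.mapIso hcomp hF).hom.app A) ≫ 𝟙 _ := by
  simp

/-- The pseudofunctor given by extending functors. -/
noncomputable def pseudofunctor :
    letI := bicategoryOfFunctors c P hid hcomp
    letI := bicategoryOfFunctors (fun k ↦ c (e k)) Q hid' hcomp'
    ι ⥤ᵖ κ :=
  letI := bicategoryOfFunctors c P hid hcomp
  letI := bicategoryOfFunctors (fun k ↦ c (e k)) Q hid' hcomp'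
  { obj := S.L
    map F := ⟨S.map hcomp F.property, S.prop_map hcomp F.property⟩
    map₂ {_ _ F F'} α := ObjectProperty.homMk (S.map₂ hcomp F.property F'.property α.hom)
    map₂_id F := ObjectProperty.hom_ext _ (S.map₂_id hcomp F.property)
    map₂_comp {_ _ F F' F''} α β := ObjectProperty.hom_ext _
      (S.map₂_comp hcomp F.property F'.property F''.property α.hom β.hom)
    mapId i := ObjectProperty.isoMk _ (S.mapId hid hcomp hid' i)
    mapComp F G := ObjectProperty.isoMk _ (S.mapComp hcomp hcomp' F.property G.property)
    map₂_whisker_left {_ _ _} F {G G'} α := ObjectProperty.hom_ext _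
      (S.map₂_whiskerLeft hcomp hcomp' F.property G.property G'.property α.hom)
    map₂_whisker_right {_ _ _ F F'} α G := ObjectProperty.hom_ext _
      (S.map₂_whiskerRight hcomp hcomp' F.property F'.property G.property α.hom)
    map₂_associator F G H := ObjectProperty.hom_ext _
      (S.map₂_associator hcomp hcomp' F.property G.property H.property)
    map₂_left_unitor F := ObjectProperty.hom_ext _
      (S.map₂_leftUnitor hid hcomp hid' hcomp' F.property)
    map₂_right_unitor F := ObjectProperty.hom_ext _
      (S.map₂_rightUnitor hid hcomp hid' hcomp' F.property) }

/-- The universal functors are the unit of a biadjunction. -/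
noncomputable def biadjunction :
    letI := bicategoryOfFunctors c P hid hcomp
    letI := bicategoryOfFunctors (fun k ↦ c (e k)) Q hid' hcomp'
    Biadjunction (S.pseudofunctor hid hcomp hid' hcomp')
      (forgetOfLE c P e Q hid hcomp hid' hcomp' hQ) :=
  letI := bicategoryOfFunctors c P hid hcomp
  letI := bicategoryOfFunctors (fun k ↦ c (e k)) Q hid' hcomp'
  { unit :=
      { app i := ⟨S.I i, S.prop_I i⟩
        naturality F := ObjectProperty.isoMk _ (S.mapIso hcomp F.property)
        naturality_naturality {i j F F'} α := ObjectProperty.hom_ext _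
          (NatTrans.ext (funext fun A ↦
            S.mapIso_naturality hcomp F.property F'.property α.hom A))
        naturality_id i := ObjectProperty.hom_ext _ (NatTrans.ext (funext fun A ↦
          S.mapIso_id hid hcomp hid' A))
        naturality_comp {i j k} F G := ObjectProperty.hom_ext _ (NatTrans.ext (funext fun A ↦
          S.mapIso_comp hcomp hcomp' F.property G.property A)) }
    isEquivalence i k :=
      { faithful := ⟨fun {G G' α β} h ↦ ObjectProperty.hom_ext _ (S.hom_ext G.property fun A ↦
          congrArg (fun γ ↦ γ.hom.app A) h)⟩
        full := ⟨fun {G G'} θ ↦ by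
          obtain ⟨α, hα⟩ := S.exists_hom G.property θ.hom
          exact ⟨ObjectProperty.homMk α, ObjectProperty.hom_ext _ (NatTrans.ext (funext hα))⟩⟩
        essSurj := ⟨fun F ↦ by
          obtain ⟨G, hG, ⟨i⟩⟩ := S.exists_ext F.obj F.property
          exact ⟨⟨G, hG⟩, ⟨ObjectProperty.isoMk _ i.symm⟩⟩⟩ } }

end UniversalFunctors

end

/-! ### The exact completions as left biadjoints -/

section

variable {C : Type*} [Category* C] {E : Type*} [Category* E]

instance mapsCovers_splitEpis (F : C ⥤ E) : MapsCovers (splitEpis C) F where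
  isRegularEpi_map e := by
    rintro ⟨s, hs⟩
    have : IsSplitEpi (F.map e) := ⟨⟨F.map s, by rw [← F.map_comp, hs, F.map_id]⟩⟩
    infer_instance

theorem mapsCovers_strongEpis [Regular C] {F : C ⥤ E}
    (hF : ∀ {X Y : C} (f : X ⟶ Y), IsRegularEpi f → IsRegularEpi (F.map f)) :
    MapsCovers (strongEpis C) F where
  isRegularEpi_map e (_ : StrongEpi e) := hF e inferInstance

end

/-- Locos functors into arithmetic universes extend along the ex/lex completion. -/
noncomputable def ExLex.universalFunctors : UniversalFunctors LOCOS.carrier.{v, max u v}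
    (fun _ _ F ↦ IsLocosFunctor F) (fun E : AU.{v, max u v} ↦ ⟨E.carrier⟩)
    (fun D E (F : D.carrier ⥤ E.carrier) ↦ IsAUFunctor F) where
  -- Objects of the completion contain both objects and maps of `E`, so they form a type in `max u
  -- v`.
  L E := ⟨ExLex E.carrier⟩
  I E := ExLex.embedding E.carrier
  prop_I E := IsExactCompletion.isLocosFunctor (splitEpis _) _
  exists_ext {E D} F hF := by
    have := hF.preservesFiniteLimits
    exact ⟨extend (splitEpis _) (ExLex.embedding E.carrier) (E := D.carrier) F,
      isAUFunctor_extend _ _ _ hF, ⟨embeddingExtendIso _ _ _⟩⟩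
  hom_ext {E D G G'} hG α β h := natTrans_ext_of_embedding (splitEpis _)
    (ExLex.embedding E.carrier) (E := D.carrier) hG.isRegularLocosFunctor.map_isRegularEpi h
  exists_hom {E D G G'} hG θ := by
    have := hG.preservesFiniteLimits
    exact exists_natTrans_of_embedding (splitEpis _) (I := ExLex.embedding E.carrier)
      (E := D.carrier) hG.isRegularLocosFunctor.map_isRegularEpi θ

/-- The ex/lex completion, as a pseudofunctor. -/
noncomputable def ExLex.pseudofunctor : LOCOS.{v, max u v} ⥤ᵖ AU.{v, max u v} :=
  universalFunctors.{v, u}.pseudofunctor (fun _ ↦ IsLocosFunctor.id _) (fun hF hG ↦ hF.comp hG)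
    (fun _ ↦ IsAUFunctor.id _) (fun hF hG ↦ hF.comp hG)

/-- The ex/lex completion is left biadjoint to the forgetful 2-functor. -/
noncomputable def ExLex.biadjunction :
    Biadjunction ExLex.pseudofunctor.{v, u} AU.forgetToLOCOS :=
  universalFunctors.{v, u}.biadjunction (fun _ ↦ IsLocosFunctor.id _) (fun hF hG ↦ hF.comp hG)
    (fun _ ↦ IsAUFunctor.id _) (fun hF hG ↦ hF.comp hG) (fun h ↦ h.toIsLocosFunctor)

theorem IsRegularLocosFunctor.id (C : Type*) [Category* C] [IsLocos C] :
    IsRegularLocosFunctor (𝟭 C) where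
  __ := IsLocosFunctor.id C
  map_isRegularEpi _ h := h

theorem IsRegularLocosFunctor.comp {C D E : Type*} [Category* C] [Category* D] [Category* E]
    [IsLocos C] [IsLocos D] [IsLocos E] {F : C ⥤ D} {G : D ⥤ E} (hF : IsRegularLocosFunctor F)
    (hG : IsRegularLocosFunctor G) : IsRegularLocosFunctor (F ⋙ G) where
  __ := hF.toIsLocosFunctor.comp hG.toIsLocosFunctor
  map_isRegularEpi _ h := hG.map_isRegularEpi _ (hF.map_isRegularEpi _ h)

/-- Regular locos functors into arithmetic universes extend along the ex/reg completion. -/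
noncomputable def ExReg.universalFunctors : UniversalFunctors REGLOC.carrier.{u, u}
    (fun _ _ F ↦ IsRegularLocosFunctor F) (fun E : AU.{u, u} ↦ ⟨E.carrier⟩)
    (fun D E (F : D.carrier ⥤ E.carrier) ↦ IsAUFunctor F) where
  -- Maps in the completion are given by subobjects, which live in the larger of the two universes;
  -- with a single universe the completion stays in the same 2-category.
  L E := ⟨ExReg E.carrier⟩
  I E := ExReg.embedding E.carrier
  prop_I E :=
    { IsExactCompletion.isLocosFunctor (strongEpis _) _ with
      map_isRegularEpi := fun f hf ↦ (IsExactCompletion.locSurj_map (J := strongEpis _)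
        (I := ExReg.embedding E.carrier) (inferInstanceAs (StrongEpi f))).isRegularEpi }
  exists_ext {E D} F hF := by
    have := hF.preservesFiniteLimits
    have := mapsCovers_strongEpis hF.map_isRegularEpi
    exact ⟨extend (strongEpis _) (ExReg.embedding E.carrier) (E := D.carrier) F,
      isAUFunctor_extend _ _ _ hF.toIsLocosFunctor, ⟨embeddingExtendIso _ _ _⟩⟩
  hom_ext {E D G G'} hG α β h := natTrans_ext_of_embedding (strongEpis _)
    (ExReg.embedding E.carrier) (E := D.carrier) hG.isRegularLocosFunctor.map_isRegularEpi h
  exists_hom {E D G G'} hG θ := by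
    have := hG.preservesFiniteLimits
    exact exists_natTrans_of_embedding (strongEpis _) (I := ExReg.embedding E.carrier)
      (E := D.carrier) hG.isRegularLocosFunctor.map_isRegularEpi θ

/-- The ex/reg completion, as a pseudofunctor. -/
noncomputable def ExReg.pseudofunctor : REGLOC.{u, u} ⥤ᵖ AU.{u, u} :=
  universalFunctors.{u}.pseudofunctor (fun _ ↦ IsRegularLocosFunctor.id _)
    (fun hF hG ↦ hF.comp hG) (fun _ ↦ IsAUFunctor.id _) (fun hF hG ↦ hF.comp hG)

/-- The ex/reg completion is left biadjoint to the forgetful 2-functor. -/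
noncomputable def ExReg.biadjunction :
    Biadjunction ExReg.pseudofunctor.{u} AU.forgetToREGLOC :=
  universalFunctors.{u}.biadjunction (fun _ ↦ IsRegularLocosFunctor.id _)
    (fun hF hG ↦ hF.comp hG) (fun _ ↦ IsAUFunctor.id _) (fun hF hG ↦ hF.comp hG)
    (fun h ↦ h.isRegularLocosFunctor)

end AriUniv

theorem mainTheorem7 :
    (∀ (E : Type u) [Category.{v} E] [AriUniv.IsLocos E],
      AriUniv.IsArithmeticUniverse (AriUniv.ExLex E)) ∧
    (∀ (E : Type u) [Category.{v} E] [AriUniv.IsRegularLocos E],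
      AriUniv.IsArithmeticUniverse (AriUniv.ExReg E)) ∧
    (∃ (h : ∀ E : AriUniv.LOCOS.{v, max u v},
          AriUniv.IsArithmeticUniverse (AriUniv.ExLex E.carrier))
        (L : AriUniv.LOCOS.{v, max u v} ⥤ᵖ AriUniv.AU.{v, max u v})
        (hL : ∀ E, L.obj E = ⟨AriUniv.ExLex E.carrier⟩)
        (adj : AriUniv.Biadjunction L AriUniv.AU.forgetToLOCOS),
      ∀ E, (adj.unit.app E ≫ AriUniv.AU.forgetToLOCOS.map (eqToHom (hL E))).obj =
        AriUniv.ExLex.embedding E.carrier) ∧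
    (∃ (h : ∀ E : AriUniv.REGLOC.{u, u},
          AriUniv.IsArithmeticUniverse (AriUniv.ExReg E.carrier))
        (L : AriUniv.REGLOC.{u, u} ⥤ᵖ AriUniv.AU.{u, u})
        (hL : ∀ E, L.obj E = ⟨AriUniv.ExReg E.carrier⟩)
        (adj : AriUniv.Biadjunction L AriUniv.AU.forgetToREGLOC),
      ∀ E, (adj.unit.app E ≫ AriUniv.AU.forgetToREGLOC.map (eqToHom (hL E))).obj =
        AriUniv.ExReg.embedding E.carrier) :=
  ⟨fun _ ↦ inferInstance, fun _ ↦ inferInstance,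
    -- The pseudofunctor is the completion on objects by definition, so the `eqToHom` is an identity
    -- and the unit is the canonical functor on the nose.
    ⟨fun _ ↦ inferInstance, AriUniv.ExLex.pseudofunctor.{v, u}, fun _ ↦ rfl,
      AriUniv.ExLex.biadjunction.{v, u}, fun _ ↦ rfl⟩,
    ⟨fun _ ↦ inferInstance, AriUniv.ExReg.pseudofunctor, fun _ ↦ rfl, AriUniv.ExReg.biadjunction,
      fun _ ↦ rfl⟩⟩
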